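/- Let $p$ be a prime and let $K$ be a complete discrete valuation field of characteristic $0$ with perfect residue field of characteristic $p$. Fix an algebraic closure $\overline K$ of $K$ and a compatible sequence $(\zeta_{p^n})_{n\ge 0}$ of primitive $p^n$-th roots of unity in $\overline K$ ($\zeta_{p^{n+1}}^p=\zeta_{p^n}$). Put $K_\infty=\bigcup_n K(\zeta_{p^n})$, $\Gamma_K=\mathrm{Gal}(K_\infty/K)$, let $\mathcal O$ be the ring of integers of the completion $\widehat{K_\infty}$, let $\mathcal O^\flat=\varprojlim_{x\mapsto x^p}\mathcal O/p$ be its tilt, and let $\widetilde{\mathbb A}_K^+=W(\mathcal O^\flat)$ be its ring of $p$-typical Witt vectors, with the induced $\Gamma_K$-action. Let $\varepsilon=(1,\zeta_p,\zeta_{p^2},\dots)\in\mathcal O^\flat$ and $\mu=[\varepsilon]-1\in\widetilde{\mathbb A}_K^+$; the ideal $(\mu)$ is $\Gamma_K$-stable, so a semilinear $\Gamma_K$-action on an $\widetilde{\mathbb A}_K^+$-module $N$ extends uniquely to a semilinear action on $N[1/\mu]$. A semilinear $\Gamma_K$-action on an $\widetilde{\mathbb A}_K^+$-module $N$ is called trivial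 modulo $\mu$ if $(N/\mu N)^{\Gamma_K}$ is a finite projective $(\widetilde{\mathbb A}_K^+/\mu)^{\Gamma_K}$-module and the canonical map $$(N/\mu N)^{\Gamma_K}\otimes_{(\widetilde{\mathbb A}_K^+/\mu)^{\Gamma_K}}\widetilde{\mathbb A}_K^+/\mu\longrightarrow N/\mu N$$ is an isomorphism. Then: (i) Let $N$ be a finite free $\widetilde{\mathbb A}_K^+$-module with a semilinear $\Gamma_K$-action. There is at most one $\Gamma_K$-stable finite free $\widetilde{\mathbb A}_K^+$-submodule $N'$ of $N[1/\mu]$ such that the natural map $N'[1/\mu]\to N[1/\mu]$ is an isomorphism and the $\Gamma_K$-action on $N'$ is trivial modulo $\mu$. (ii) Let $N_1,N_2$ be finite free $\widetilde{\mathbb A}_K^+$-modules with semilinear $\Gamma_K$-actions that are trivial modulo $\mu$. Then every $\Gamma_K$-equivariant $\widetilde{\mathbb A}_K^+[1/\mu]$-linear map $f\colon N_1[1/\mu]\to N_2[1/\mu]$ satisfies $f(N_1)\subseteq N_2$. -/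

import Mathlib

open scoped NNReal

section Tilt
variable {O : Type*} [CommRing O] {p : ℕ} [Fact p.Prime] [Fact (¬ IsUnit (p : O))]

/-- The endomorphism of `O / p` induced by a ring endomorphism of `O`. -/
def modPMap (f : O →+* O) : ModP O p →+* ModP O p :=
  Ideal.quotientMap _ f (by
    rw [Ideal.span_le, Set.singleton_subset_iff]
    simp)

/-- The endomorphism of the tilt of `O` induced by a ring endomorphism of `O`. -/
noncomputable def tiltMap (f : O →+* O) : PreTilt O p →+* PreTilt O p :=
  Perfection.map p (modPMap f)

theorem coeff_tiltMap (f : O →+* O) (n : ℕ) (x : PreTilt O p) :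
    PreTilt.coeff n (tiltMap f x) = modPMap f (PreTilt.coeff n x) := rfl

theorem tilt_ext {x y : PreTilt O p} (h : ∀ n, PreTilt.coeff n x = PreTilt.coeff n y) : x = y :=
  Perfection.ext h

theorem tiltMap_id : tiltMap (RingHom.id O) = RingHom.id (PreTilt O p) := by
  ext x
  refine tilt_ext fun n => ?_
  rw [coeff_tiltMap]
  obtain ⟨y, hy⟩ := Ideal.Quotient.mk_surjective (PreTilt.coeff n x)
  simp [← hy, modPMap]

theorem tiltMap_comp (f g : O →+* O) :
    tiltMap (p := p) (f.comp g) = (tiltMap f).comp (tiltMap g) := by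
  ext x
  refine tilt_ext fun n => ?_
  simp only [coeff_tiltMap, RingHom.comp_apply]
  obtain ⟨y, hy⟩ := Ideal.Quotient.mk_surjective (PreTilt.coeff n x)
  simp [← hy, modPMap]

/-- The element of the tilt of `O` given by a `p`-power compatible sequence in `O`. -/
def tiltOfSeq (c : ℕ → O) (hc : ∀ n, c (n + 1) ^ p = c n) : PreTilt O p :=
  ⟨fun n => Ideal.Quotient.mk _ (c n), fun n => by rw [← map_pow, hc]⟩

theorem coeff_tiltOfSeq (c : ℕ → O) (hc : ∀ n, c (n + 1) ^ p = c n) (n : ℕ) :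
    PreTilt.coeff n (tiltOfSeq c hc) = Ideal.Quotient.mk _ (c n) := rfl

theorem tiltMap_tiltOfSeq (f : O →+* O) (c : ℕ → O) (hc : ∀ n, c (n + 1) ^ p = c n) :
    tiltMap f (tiltOfSeq c hc) = tiltOfSeq (fun n => f (c n)) (fun n => by rw [← map_pow, hc]) :=
  rfl

theorem tilt_sub_one_dvd [IsDomain O] (z c : ℕ → O) (hz : ∀ n, z (n + 1) ^ p = z n)
    (hc : ∀ n, c (n + 1) ^ p = c n) (hprim : ∀ n, IsPrimitiveRoot (z n) (p ^ n)) (hc0 : c 0 = 1) :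
    tiltOfSeq z hz - 1 ∣ tiltOfSeq (p := p) c hc - 1 := by
  have hp : p.Prime := Fact.out
  have hroot : ∀ n, c n ^ p ^ n = 1 := by
    intro n
    induction n with
    | zero => simpa using hc0
    | succ n ih => rw [pow_succ', pow_mul, hc, ih]
  have hex : ∀ n, ∃ a : ℕ, z n ^ a = c n := fun n => by
    have : NeZero (p ^ n) := ⟨pow_ne_zero _ hp.ne_zero⟩
    obtain ⟨i, -, hi⟩ := (hprim n).eq_pow_of_pow_eq_one (hroot n)
    exact ⟨i, hi⟩
  choose a ha using hex
  have key : ∀ n, ∀ i j : ℕ, z (n + 1) ^ i = z (n + 1) ^ j →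
      ∑ k ∈ Finset.range i, z (n + 1) ^ k = ∑ k ∈ Finset.range j, z (n + 1) ^ k := by
    intro n i j hij
    have h1 : z (n + 1) - 1 ≠ 0 :=
      sub_ne_zero.2 ((hprim (n + 1)).ne_one (Nat.one_lt_pow (Nat.succ_ne_zero n) hp.one_lt))
    apply mul_right_cancel₀ h1
    rw [geom_sum_mul, geom_sum_mul, hij]
  have hzz : ∀ n (e : ℕ), z (n + 1) ^ (p * e) = z n ^ e := fun n e => by rw [pow_mul, hz]
  let w : ℕ → ModP O p := fun n => Ideal.Quotient.mk _ (∑ k ∈ Finset.range (a n), z n ^ k)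
  have hw : ∀ n, w (n + 2) ^ p = w (n + 1) := by
    intro n
    have h1 : w (n + 2) ^ p = ∑ k ∈ Finset.range (a (n + 2)),
        (Ideal.Quotient.mk _ (z (n + 1) ^ k) : ModP O p) := by
      simp only [w, map_sum]
      rw [sum_pow_char]
      refine Finset.sum_congr rfl fun k _ => ?_
      rw [← map_pow, ← pow_mul, mul_comm, hzz]
    rw [h1, ← map_sum]
    refine congrArg _ (key n _ _ ?_)
    rw [ha, ← hc (n + 1), ← ha (n + 2), ← pow_mul, mul_comm, hzz]
  let y : PreTilt O p := ⟨fun n => w (n + 1) ^ p, fun n => by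
    show (w (n + 2) ^ p) ^ p = _
    rw [hw]⟩
  have hy : ∀ n, PreTilt.coeff n y = w (n + 1) ^ p := fun n => rfl
  have hy' : ∀ n, PreTilt.coeff (n + 1) y = w (n + 1) := fun n => hw n
  refine ⟨y, ?_⟩
  have h : ∀ n, PreTilt.coeff (n + 1) (tiltOfSeq c hc - 1) =
      PreTilt.coeff (n + 1) ((tiltOfSeq z hz - 1) * y) := by
    intro n
    rw [map_mul, hy', map_sub, map_sub, map_one, coeff_tiltOfSeq, coeff_tiltOfSeq]
    simp only [w]
    rw [← map_one (Ideal.Quotient.mk _), ← map_sub, ← map_sub, ← map_mul, mul_geom_sum, ha]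
  refine tilt_ext fun n => ?_
  rw [← PreTilt.coeff_pow_p, h, PreTilt.coeff_pow_p]

theorem tiltOfSeq_ne_one [IsDomain O] (z : ℕ → O) (hz : ∀ n, z (n + 1) ^ p = z n)
    (hprim : ∀ n, IsPrimitiveRoot (z n) (p ^ n)) (hp0 : (p : O) ≠ 0) :
    tiltOfSeq (p := p) z hz ≠ 1 := by
  intro h
  have hp : p.Prime := Fact.out
  have h2 : (Ideal.Quotient.mk (Ideal.span {(p : O)}) (z 2)) = 1 := by
    have := congrArg (PreTilt.coeff 2) h
    rwa [coeff_tiltOfSeq, map_one] at this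
  rw [← map_one (Ideal.Quotient.mk _), Ideal.Quotient.eq, Ideal.mem_span_singleton] at h2
  have h3 : ((p : O) ^ 2) ∣ z 1 - 1 := by
    have := dvd_sub_pow_of_dvd_sub h2 1
    simpa [hz 1] using this
  have h4 : ((p : O) ^ 2) ∣ p := by
    have h5 : ∑ i ∈ Finset.range p, z 1 ^ i = 0 := by
      have := (hprim 1).geom_sum_eq_zero (by simpa using hp.one_lt)
      simpa using this
    have h6 : ((p : O) ^ 2) ∣ ∑ i ∈ Finset.range p, (z 1 ^ i - 1) :=
      Finset.dvd_sum fun i _ => h3.trans (by simpa using sub_dvd_pow_sub_pow (z 1) 1 i)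
    rw [Finset.sum_sub_distrib, h5] at h6
    simpa using h6
  obtain ⟨t, ht⟩ := h4
  have : (p : O) * t = 1 := by
    apply mul_left_cancel₀ hp0
    rw [mul_one, ← mul_assoc, ← pow_two, ← ht]
  exact (Fact.out : ¬ IsUnit (p : O)) (IsUnit.of_mul_eq_one _ this)

theorem teichmuller_sub_one_dvd [IsDomain O] [IsDomain (PreTilt O p)]
    (z c : ℕ → O) (hz : ∀ n, z (n + 1) ^ p = z n)
    (hc : ∀ n, c (n + 1) ^ p = c n) (hprim : ∀ n, IsPrimitiveRoot (z n) (p ^ n)) (hc0 : c 0 = 1)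
    (hp0 : (p : O) ≠ 0) :
    WittVector.teichmuller p (tiltOfSeq z hz) - 1 ∣
      WittVector.teichmuller p (tiltOfSeq (p := p) c hc) - 1 := by
  have hp : p.Prime := Fact.out
  set μ : WittVector p (PreTilt O p) := WittVector.teichmuller p (tiltOfSeq z hz) - 1 with hμ
  have cc : ∀ x : PreTilt O p, WittVector.constantCoeff (WittVector.teichmuller p x) = x :=
    fun x => WittVector.teichmuller_coeff_zero p x
  have pdvd : ∀ x : WittVector p (PreTilt O p), (p : WittVector p (PreTilt O p)) ∣ x ↔ WittVector.constantCoeff x = 0 :=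
    fun x => by
      rw [← Ideal.mem_span_singleton, ← WittVector.ker_constantCoeff, RingHom.mem_ker]
  have hμp : ¬ (p : WittVector p (PreTilt O p)) ∣ μ := by
    rw [pdvd, hμ, map_sub, map_one, cc, sub_eq_zero]
    exact tiltOfSeq_ne_one z hz hprim hp0
  have hpp : Prime (p : WittVector p (PreTilt O p)) := by
    refine ⟨WittVector.p_nonzero p _, fun h => ?_, fun x y h => ?_⟩
    · exact hμp (h.dvd)
    · rw [pdvd, map_mul, mul_eq_zero] at h
      rwa [pdvd, pdvd]
  -- divisibility modulo every power of `p`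
  have approx : ∀ k : ℕ, ∃ y, (p : WittVector p (PreTilt O p)) ^ (k + 1) ∣
      WittVector.teichmuller p (tiltOfSeq c hc) - 1 - μ * y := by
    intro k
    have hroot : c k ^ p ^ k = 1 := by
      have : ∀ n, c n ^ p ^ n = 1 := by
        intro n
        induction n with
        | zero => simpa using hc0
        | succ n ih => rw [pow_succ', pow_mul, hc, ih]
      exact this k
    have : NeZero (p ^ k) := ⟨pow_ne_zero _ hp.ne_zero⟩
    obtain ⟨a, -, ha⟩ := (hprim k).eq_pow_of_pow_eq_one hroot
    let b := a * (p ^ k - 1)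
    let d : ℕ → O := fun n => c (n + k) * z (n + k) ^ b
    have hd : ∀ n, d (n + 1) ^ p = d n := fun n => by
      simp only [d]
      rw [show n + 1 + k = n + k + 1 by ring, mul_pow, hc, ← pow_mul, mul_comm b, pow_mul, hz]
    have hd0 : d 0 = 1 := by
      simp only [d, zero_add, b]
      rw [← ha, ← pow_add, show a + a * (p ^ k - 1) = p ^ k * a by
        obtain ⟨t, ht⟩ := Nat.exists_eq_add_of_le (Nat.one_le_pow k p hp.pos)
        rw [ht, Nat.add_sub_cancel_left]; ring,
        pow_mul, (hprim k).pow_eq_one, one_pow]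
    have hpow : ∀ (e : ℕ → O) (_ : ∀ n, e (n + 1) ^ p = e n) (n : ℕ),
        e (n + k) ^ p ^ k = e n := by
      clear hd0 hd d b ha hroot this
      intro e he n
      induction k with
      | zero => simp
      | succ k ih => rw [pow_succ', pow_mul, ← add_assoc, he, ih]
    have hmul : tiltOfSeq (p := p) c hc * tiltOfSeq z hz ^ b = tiltOfSeq d hd ^ p ^ k := by
      refine tilt_ext fun n => ?_
      rw [map_mul, map_pow, map_pow, coeff_tiltOfSeq, coeff_tiltOfSeq, coeff_tiltOfSeq,
        ← map_pow, ← map_pow, ← map_mul]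
      simp only [d]
      rw [mul_pow, hpow c hc, ← pow_mul (z (n + k)), mul_comm b, pow_mul (z (n + k)), hpow z hz]
    obtain ⟨q, hq⟩ := tilt_sub_one_dvd z d hz hd hprim hd0
    have hT : (p : WittVector p (PreTilt O p)) ∣ WittVector.teichmuller p (tiltOfSeq d hd) -
        (1 + μ * WittVector.teichmuller p q) := by
      rw [pdvd, map_sub, map_add, map_mul, map_one, cc, cc, hμ, map_sub, cc, map_one, ← hq]
      ring
    have hT2 := dvd_sub_pow_of_dvd_sub hT k
    rw [← map_pow, ← hmul, map_mul, map_pow] at hT2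
    obtain ⟨s, hs⟩ : μ ∣ (1 + μ * WittVector.teichmuller p q) ^ p ^ k - 1 := by
      have := sub_dvd_pow_sub_pow (1 + μ * WittVector.teichmuller p q) 1 (p ^ k)
      rw [one_pow] at this
      rw [add_sub_cancel_left] at this
      exact (dvd_mul_right _ _).trans this
    obtain ⟨r, hr⟩ : μ ∣ WittVector.teichmuller p (tiltOfSeq z hz) ^ b - 1 := by
      simpa using sub_dvd_pow_sub_pow (WittVector.teichmuller p (tiltOfSeq z hz)) 1 b
    refine ⟨s - WittVector.teichmuller p (tiltOfSeq c hc) * r, ?_⟩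
    convert hT2 using 1
    linear_combination (-1 : WittVector p (PreTilt O p)) * WittVector.teichmuller p (tiltOfSeq c hc) * hr + hs
  -- conclude by completeness
  choose y hy using approx
  have hcauchy : ∀ k, (p : WittVector p (PreTilt O p)) ^ (k + 1) ∣ y (k + 1) - y k := by
    intro k
    have h1 : (p : WittVector p (PreTilt O p)) ^ (k + 1) ∣ μ * (y (k + 1) - y k) := by
      have := dvd_sub (hy k) ((pow_dvd_pow _ (Nat.le_succ _)).trans (hy (k + 1)))
      convert this using 1
      ring
    exact hpp.pow_dvd_of_dvd_mul_left _ hμp h1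
  have hc' : ∀ m n, m ≤ n → (p : WittVector p (PreTilt O p)) ^ m ∣ y n - y m := by
    intro m n hmn
    induction n, hmn using Nat.le_induction with
    | base => simp
    | succ n hmn ih =>
      have := dvd_add ((pow_dvd_pow _ (hmn.trans (Nat.le_succ n))).trans (hcauchy n)) ih
      simpa using this
  obtain ⟨L, hL⟩ := (WittVector.isAdicCompleteIdealSpanP (p := p) (k := PreTilt O p)).prec'
    (f := y) (fun {m n} hmn => by
      rw [SModEq.sub_mem, smul_eq_mul, Ideal.mul_top, Ideal.span_singleton_pow,
        Ideal.mem_span_singleton, ← dvd_neg, neg_sub]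
      exact hc' m n hmn)
  refine ⟨L, sub_eq_zero.1 ?_⟩
  refine (WittVector.isAdicCompleteIdealSpanP (p := p) (k := PreTilt O p)).haus' _ fun n => ?_
  have := hL n
  rw [SModEq.sub_mem, smul_eq_mul, Ideal.mul_top, Ideal.span_singleton_pow,
        Ideal.mem_span_singleton] at this ⊢
  have h2 := dvd_add ((pow_dvd_pow _ (Nat.le_succ n)).trans (hy n)) (this.mul_left μ)
  convert h2 using 1
  ring

theorem teichmuller_sub_one_dvd_map [IsDomain O] [IsDomain (PreTilt O p)]
    (z : ℕ → O) (hz : ∀ n, z (n + 1) ^ p = z n) (hprim : ∀ n, IsPrimitiveRoot (z n) (p ^ n))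
    (hp0 : (p : O) ≠ 0) (f : O →+* O) :
    WittVector.teichmuller p (tiltOfSeq z hz) - 1 ∣
      WittVector.map (tiltMap f) (WittVector.teichmuller p (tiltOfSeq (p := p) z hz) - 1) := by
  rw [map_sub, map_one, WittVector.map_teichmuller, tiltMap_tiltOfSeq]
  refine teichmuller_sub_one_dvd _ _ hz _ hprim ?_ hp0
  have h0 : z 0 = 1 := by
    have := (hprim 0).pow_eq_one
    simpa using this
  show f (z 0) = 1
  rw [h0, map_one]

end Tilt
section Semilinear

/-- A semilinear action of a group `G` on a module `M` over a ring `B` with `G`-action. -/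
structure SemilinearAction (G B M : Type*) [Group G] [CommRing B] [MulSemiringAction G B]
    [AddCommGroup M] [Module B M] where
  /-- the action, by additive endomorphisms -/
  act : G →* AddMonoid.End M
  act_smul : ∀ (g : G) (b : B) (m : M), act g (b • m) = (g • b) • act g m

variable {G B M : Type*} [Group G] [CommRing B] [MulSemiringAction G B]
  [AddCommGroup M] [Module B M]

/-- The endomorphism of `B / I` induced by `g`, for a `G`-stable ideal `I`. -/
def quotientAct (I : Ideal B) (hI : ∀ (g : G), ∀ b ∈ I, g • b ∈ I) (g : G) : B ⧸ I →+* B ⧸ I :=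
  Ideal.quotientMap I (MulSemiringAction.toRingHom G B g) (fun b hb => hI g b hb)

/-- The ring of invariants `(B / I)^G`. -/
def quotientInvariants (I : Ideal B) (hI : ∀ (g : G), ∀ b ∈ I, g • b ∈ I) : Subring (B ⧸ I) where
  carrier := {x | ∀ g : G, quotientAct I hI g x = x}
  mul_mem' ha hb g := by rw [map_mul, ha g, hb g]
  one_mem' g := map_one _
  add_mem' ha hb g := by rw [map_add, ha g, hb g]
  zero_mem' g := map_zero _
  neg_mem' ha g := by rw [map_neg, ha g]

namespace SemilinearAction

/-- The action of `g` as a semilinear map. -/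
def toSemilinearMap (ρ : SemilinearAction G B M) (g : G) :
    M →ₛₗ[MulSemiringAction.toRingHom G B g] M where
  toFun := ρ.act g
  map_add' := map_add _
  map_smul' := ρ.act_smul g

/-- The map on `M / I M` induced by `g`, for a `G`-stable ideal `I`. -/
def quotientMap (ρ : SemilinearAction G B M) (I : Ideal B)
    (hI : ∀ (g : G), ∀ b ∈ I, g • b ∈ I) (g : G) :
    M ⧸ (I • ⊤ : Submodule B M) →ₛₗ[MulSemiringAction.toRingHom G B g]
      M ⧸ (I • ⊤ : Submodule B M) :=
  Submodule.mapQ _ _ (ρ.toSemilinearMap g) (by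
    refine Submodule.smul_le.2 fun b hb m _ => ?_
    show ρ.act g (b • m) ∈ (I • ⊤ : Submodule B M)
    rw [ρ.act_smul]
    exact Submodule.smul_mem_smul (hI g b hb) trivial)

/-- The `(B / I)^G`-module of invariants `(M / I M)^G`. -/
def invariants (ρ : SemilinearAction G B M) (I : Ideal B)
    (hI : ∀ (g : G), ∀ b ∈ I, g • b ∈ I) :
    Submodule (quotientInvariants I hI) (M ⧸ (I • ⊤ : Submodule B M)) where
  carrier := {x | ∀ g : G, ρ.quotientMap I hI g x = x}
  add_mem' ha hb g := by rw [map_add, ha g, hb g]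
  zero_mem' g := map_zero _
  smul_mem' := by
    rintro ⟨r, hr⟩ x hx g
    obtain ⟨b, rfl⟩ := Ideal.Quotient.mk_surjective r
    have h1 : ((⟨Ideal.Quotient.mk I b, hr⟩ : quotientInvariants I hI) • x) = b • x := rfl
    have h2 : Ideal.Quotient.mk I (g • b) = Ideal.Quotient.mk I b := hr g
    rw [h1, map_smulₛₗ, hx g]
    exact congrArg (fun c : B ⧸ I => c • x) h2

/-- The action on `M` is trivial modulo the `G`-stable ideal `I`: the `(B / I)^G`-module
`(M / I M)^G` is finite projective and `(B / I) ⊗ (M / I M)^G → M / I M` is an isomorphism. -/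
structure IsTrivialMod (ρ : SemilinearAction G B M) (I : Ideal B)
    (hI : ∀ (g : G), ∀ b ∈ I, g • b ∈ I) : Prop where
  finite : Module.Finite (quotientInvariants I hI) (ρ.invariants I hI)
  projective : Module.Projective (quotientInvariants I hI) (ρ.invariants I hI)
  isBaseChange : IsBaseChange (B ⧸ I) (ρ.invariants I hI).subtype

/-- The restriction of a semilinear action to a stable submodule. -/
def restrict (ρ : SemilinearAction G B M) (N : Submodule B M)
    (hN : ∀ (g : G), ∀ x ∈ N, ρ.act g x ∈ N) : SemilinearAction G B N where
  act :=
    { toFun := fun g =>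
        { toFun := fun x => ⟨ρ.act g x, hN g x x.2⟩
          map_zero' := Subtype.ext (map_zero (ρ.act g))
          map_add' := fun x y => Subtype.ext (map_add (ρ.act g) (x : M) (y : M)) }
      map_one' := by
        ext x
        show ρ.act 1 (x : M) = x
        rw [map_one]; rfl
      map_mul' := fun g h => by
        ext x
        show ρ.act (g * h) (x : M) = ρ.act g (ρ.act h x)
        rw [map_mul]; rfl }
  act_smul g b x := Subtype.ext (ρ.act_smul g b x)

section Localize

theorem smul_cancel (S : Submonoid B)
    (hS : ∀ (g : G), ∀ s ∈ S, IsUnit (algebraMap B (Localization S) (g • s)))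
    (g : G) {s : B} (hs : s ∈ S) {x y : LocalizedModule S M}
    (h : (g • s) • x = (g • s) • y) : x = y := by
  rw [← algebraMap_smul (Localization S), ← algebraMap_smul (Localization S) (g • s) y] at h
  exact (hS g s hs).smul_left_cancel.1 h

theorem localize_aux (S : Submonoid B)
    (hS : ∀ (g : G), ∀ s ∈ S, IsUnit (algebraMap B (Localization S) (g • s)))
    (g : G) (y : LocalizedModule S M) {s : B} (hs : s ∈ S) :
    (g • s) • (Ring.inverse (algebraMap B (Localization S) (g • s)) • y) = y := by
  rw [← algebraMap_smul (Localization S) (g • s), smul_smul,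
    Ring.mul_inverse_cancel _ (hS g s hs), one_smul]

/-- The map `m / s ↦ g(s)⁻¹ g(m)` on `S⁻¹M`. -/
noncomputable def localizeFun (ρ : SemilinearAction G B M) (S : Submonoid B)
    (hS : ∀ (g : G), ∀ s ∈ S, IsUnit (algebraMap B (Localization S) (g • s))) (g : G)
    (x : LocalizedModule S M) : LocalizedModule S M :=
  x.liftOn (fun ms => Ring.inverse (algebraMap B (Localization S) (g • (ms.2 : B))) •
      LocalizedModule.mkLinearMap S M (ρ.act g ms.1)) (by
    rintro ⟨m, s⟩ ⟨m', s'⟩ ⟨u, hu⟩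
    have key : ∀ (b : B) (n : M), LocalizedModule.mkLinearMap S M (ρ.act g (b • n)) =
        (g • b) • LocalizedModule.mkLinearMap S M (ρ.act g n) := fun b n => by
      rw [ρ.act_smul, map_smul]
    have hu' : ((u : B) * s') • m = ((u : B) * s) • m' := by
      simpa [mul_smul, Submonoid.smul_def] using hu
    have h := congrArg (fun n => LocalizedModule.mkLinearMap S M (ρ.act g n)) hu'
    simp only [key] at h
    refine smul_cancel S hS g (S.mul_mem (S.mul_mem u.2 s.2) s'.2) ?_
    have e1 : g • ((u : B) * s * s') = (g • ((u : B) * s')) * (g • (s : B)) := by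
      simp only [smul_mul']; ring
    have e2 : g • ((u : B) * s * s') = (g • ((u : B) * s)) * (g • (s' : B)) := by
      simp only [smul_mul']
    conv_lhs => rw [e1, mul_smul, localize_aux S hS g _ s.2]
    conv_rhs => rw [e2, mul_smul, localize_aux S hS g _ s'.2]
    exact h)

theorem smul_localizeFun_mk (ρ : SemilinearAction G B M) (S : Submonoid B)
    (hS : ∀ (g : G), ∀ s ∈ S, IsUnit (algebraMap B (Localization S) (g • s))) (g : G)
    (m : M) (s : S) : (g • (s : B)) • ρ.localizeFun S hS g (LocalizedModule.mk m s) =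
      LocalizedModule.mkLinearMap S M (ρ.act g m) := by
  rw [localizeFun, LocalizedModule.liftOn_mk]
  exact localize_aux S hS g _ s.2

theorem localizeFun_eq (ρ : SemilinearAction G B M) (S : Submonoid B)
    (hS : ∀ (g : G), ∀ s ∈ S, IsUnit (algebraMap B (Localization S) (g • s))) (g : G)
    (x y : LocalizedModule S M) (m : M) (s : S)
    (hx : (s : B) • x = LocalizedModule.mkLinearMap S M m)
    (hy : (g • (s : B)) • y = LocalizedModule.mkLinearMap S M (ρ.act g m)) :
    ρ.localizeFun S hS g x = y := by
  have : x = LocalizedModule.mk m s := by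
    refine IsLocalizedModule.smul_injective (LocalizedModule.mkLinearMap S M) s ?_
    show (s : B) • x = (s : B) • _
    rw [hx, LocalizedModule.smul'_mk]
    exact (LocalizedModule.mk_cancel s m).symm
  rw [this]
  refine smul_cancel S hS g s.2 ?_
  rw [smul_localizeFun_mk, hy]

theorem localizeFun_smul (ρ : SemilinearAction G B M) (S : Submonoid B)
    (hS : ∀ (g : G), ∀ s ∈ S, IsUnit (algebraMap B (Localization S) (g • s))) (g : G)
    (b : B) (x : LocalizedModule S M) :
    ρ.localizeFun S hS g (b • x) = (g • b) • ρ.localizeFun S hS g x := by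
  induction x with | _ m s
  refine ρ.localizeFun_eq S hS g _ _ (b • m) s ?_ ?_
  · rw [LocalizedModule.smul'_mk, LocalizedModule.smul'_mk]
    exact LocalizedModule.mk_cancel s _
  · rw [smul_comm, smul_localizeFun_mk, ρ.act_smul, map_smul]

theorem localizeFun_add (ρ : SemilinearAction G B M) (S : Submonoid B)
    (hS : ∀ (g : G), ∀ s ∈ S, IsUnit (algebraMap B (Localization S) (g • s))) (g : G)
    (x y : LocalizedModule S M) :
    ρ.localizeFun S hS g (x + y) = ρ.localizeFun S hS g x + ρ.localizeFun S hS g y := by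
  induction x with | _ m s
  induction y with | _ n t
  refine ρ.localizeFun_eq S hS g _ _ ((t : B) • m + (s : B) • n) (s * t) ?_ ?_
  · rw [LocalizedModule.mk_add_mk, LocalizedModule.smul'_mk]
    exact LocalizedModule.mk_cancel (s * t) _
  · rw [Submonoid.coe_mul, smul_mul', smul_add, mul_smul, mul_smul, smul_localizeFun_mk,
      smul_comm (g • (s : B)) (g • (t : B)) (ρ.localizeFun S hS g (LocalizedModule.mk m s)),
      smul_localizeFun_mk, map_add, map_add, ρ.act_smul, ρ.act_smul, map_smul, map_smul]

/-- The induced semilinear action on `S⁻¹M`, given by `g(m / s) = g(s)⁻¹ g(m)`, when every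
`g(s)` with `s ∈ S` is invertible in `S⁻¹B`. -/
noncomputable def localize (ρ : SemilinearAction G B M) (S : Submonoid B)
    (hS : ∀ (g : G), ∀ s ∈ S, IsUnit (algebraMap B (Localization S) (g • s))) :
    SemilinearAction G B (LocalizedModule S M) where
  act :=
    { toFun := fun g =>
        { toFun := ρ.localizeFun S hS g
          map_zero' := by simpa using ρ.localizeFun_smul S hS g 0 0
          map_add' := ρ.localizeFun_add S hS g }
      map_one' := by
        ext x
        show ρ.localizeFun S hS 1 x = x
        induction x with | _ m s
        have h : (s : B) • LocalizedModule.mk m s = LocalizedModule.mkLinearMap S M m := by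
          rw [LocalizedModule.smul'_mk]
          exact LocalizedModule.mk_cancel s m
        refine ρ.localizeFun_eq S hS 1 _ _ m s h ?_
        rw [one_smul, h, map_one]; rfl
      map_mul' := fun g g' => by
        ext x
        show ρ.localizeFun S hS (g * g') x = ρ.localizeFun S hS g (ρ.localizeFun S hS g' x)
        induction x with | _ m s
        have h : (s : B) • LocalizedModule.mk m s = LocalizedModule.mkLinearMap S M m := by
          rw [LocalizedModule.smul'_mk]
          exact LocalizedModule.mk_cancel s m
        refine ρ.localizeFun_eq S hS (g * g') _ _ m s h ?_
        rw [mul_smul, ← localizeFun_smul, smul_localizeFun_mk]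
        refine ρ.localizeFun_eq S hS g _ _ (ρ.act g' m) 1 (by rw [Submonoid.coe_one, one_smul]) ?_
        rw [Submonoid.coe_one, smul_one, one_smul, map_mul]; rfl }
  act_smul := ρ.localizeFun_smul S hS

end Localize
end SemilinearAction
end Semilinear
open IntermediateField UniformSpace

/-- `K` is a `p`-adic field: a complete discretely valued field of characteristic `0` with perfect
residue field of characteristic `p` (completeness is a separate instance). -/
class IsPAdicField (p : ℕ) (K : Type*) [NontriviallyNormedField K] [IsUltrametricDist K] :
    Prop where
  charZero : CharZero K
  isDiscreteValuationRing :
    IsDiscreteValuationRing (NormedField.valuation (K := K)).valuationSubring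
  charP : CharP (IsLocalRing.ResidueField (NormedField.valuation (K := K)).valuationSubring) p
  perfectField :
    PerfectField (IsLocalRing.ResidueField (NormedField.valuation (K := K)).valuationSubring)

/-- A compatible sequence `(ζ_{p^n})_n` of `p`-power roots of unity in an algebraic closure. -/
structure CompatibleRootsOfUnity (p : ℕ) (K : Type*) [Field K] where
  root : ℕ → AlgebraicClosure K
  isPrimitiveRoot : ∀ n, IsPrimitiveRoot (root n) (p ^ n)
  root_succ_pow : ∀ n, root (n + 1) ^ p = root n

section Fields
variable {p : ℕ} {K : Type*} [NontriviallyNormedField K] [IsUltrametricDist K] [CompleteSpace K]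

/-- The `p`-cyclotomic extension `K_∞ = ⋃ₙ K(ζ_{p^n})` of `K`. -/
noncomputable abbrev CyclotomicTower (ζ : CompatibleRootsOfUnity p K) : IntermediateField K (AlgebraicClosure K) :=
  ⨆ n, K⟮ζ.root n⟯

/-- The field `K_∞` carries the unique norm extending that of `K`. -/
noncomputable instance (ζ : CompatibleRootsOfUnity p K) : NormedField (CyclotomicTower ζ) :=
  spectralNorm.normedField K (CyclotomicTower ζ)

noncomputable instance (ζ : CompatibleRootsOfUnity p K) : NormedAlgebra K (CyclotomicTower ζ) :=
  spectralNorm.normedAlgebra K (CyclotomicTower ζ)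

instance (ζ : CompatibleRootsOfUnity p K) : IsUltrametricDist (CyclotomicTower ζ) :=
  IsUltrametricDist.of_normedAlgebra K

/-- The group `Γ_K = Gal(K_∞ / K)`. -/
abbrev GammaK (ζ : CompatibleRootsOfUnity p K) : Type _ := CyclotomicTower ζ ≃ₐ[K] CyclotomicTower ζ

/-- The completion of `K_∞`. -/
abbrev KInftyHat (ζ : CompatibleRootsOfUnity p K) : Type _ := Completion (CyclotomicTower ζ)

instance (ζ : CompatibleRootsOfUnity p K) : IsUltrametricDist (KInftyHat ζ) :=
  IsUltrametricDist.of_normedAlgebra K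

/-- The ring of integers of the completion of `K_∞`. -/
noncomputable abbrev OKInftyHat (ζ : CompatibleRootsOfUnity p K) : ValuationSubring (KInftyHat ζ) :=
  (NormedField.valuation (K := KInftyHat ζ)).valuationSubring

theorem mem_OKInftyHat {ζ : CompatibleRootsOfUnity p K} {x : KInftyHat ζ} :
    x ∈ OKInftyHat ζ ↔ ‖x‖ ≤ 1 := Iff.rfl

theorem gammaK_norm {ζ : CompatibleRootsOfUnity p K} (g : GammaK ζ) (x : CyclotomicTower ζ) :
    ‖g x‖ = ‖x‖ := (spectralNorm_eq_of_equiv g x).symm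

theorem gammaK_isometry {ζ : CompatibleRootsOfUnity p K} (g : GammaK ζ) :
    Isometry (g : CyclotomicTower ζ →+* CyclotomicTower ζ) :=
  AddMonoidHomClass.isometry_of_norm _ (gammaK_norm g)

/-- The action of `Γ_K` on the completion of `K_∞`, by continuity. -/
noncomputable def completionMap {ζ : CompatibleRootsOfUnity p K} (g : GammaK ζ) :
    KInftyHat ζ →+* KInftyHat ζ :=
  Completion.mapRingHom (g : CyclotomicTower ζ →+* CyclotomicTower ζ) (gammaK_isometry g).continuous

theorem completionMap_coe {ζ : CompatibleRootsOfUnity p K} (g : GammaK ζ) (x : CyclotomicTower ζ) :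
    completionMap g (x : KInftyHat ζ) = ((g x : CyclotomicTower ζ) : KInftyHat ζ) :=
  Completion.mapRingHom_coe _ _

theorem continuous_completionMap {ζ : CompatibleRootsOfUnity p K} (g : GammaK ζ) :
    Continuous (completionMap g) := Completion.continuous_map

theorem norm_completionMap {ζ : CompatibleRootsOfUnity p K} (g : GammaK ζ) (x : KInftyHat ζ) :
    ‖completionMap g x‖ = ‖x‖ := by
  induction x using Completion.induction_on with
  | hp => exact isClosed_eq (continuous_completionMap g).norm continuous_norm
  | ih a => rw [completionMap_coe, Completion.norm_coe, Completion.norm_coe, gammaK_norm]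

theorem completionMap_one {ζ : CompatibleRootsOfUnity p K} (x : KInftyHat ζ) :
    completionMap (1 : GammaK ζ) x = x := by
  induction x using Completion.induction_on with
  | hp => exact isClosed_eq (continuous_completionMap _) continuous_id
  | ih a => rw [completionMap_coe]; rfl

theorem completionMap_mul {ζ : CompatibleRootsOfUnity p K} (g h : GammaK ζ) (x : KInftyHat ζ) :
    completionMap (g * h) x = completionMap g (completionMap h x) := by
  induction x using Completion.induction_on with
  | hp =>
    exact isClosed_eq (continuous_completionMap (g * h))
      ((continuous_completionMap g).comp (continuous_completionMap h))
  | ih a => rw [completionMap_coe, completionMap_coe, completionMap_coe]; rfl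

/-- The action of `Γ_K` on the ring of integers of the completion of `K_∞`. -/
noncomputable def integerMap {ζ : CompatibleRootsOfUnity p K} (g : GammaK ζ) :
    OKInftyHat ζ →+* OKInftyHat ζ :=
  ((completionMap g).comp (OKInftyHat ζ).subtype).codRestrict (OKInftyHat ζ) (fun x => by
    rw [mem_OKInftyHat]
    exact (norm_completionMap g x).le.trans (mem_OKInftyHat.1 x.2))

theorem integerMap_one {ζ : CompatibleRootsOfUnity p K} :
    integerMap (1 : GammaK ζ) = RingHom.id (OKInftyHat ζ) :=
  RingHom.ext fun x => Subtype.ext (completionMap_one (x : KInftyHat ζ))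

theorem integerMap_mul {ζ : CompatibleRootsOfUnity p K} (g h : GammaK ζ) :
    integerMap (g * h) = (integerMap g).comp (integerMap h) :=
  RingHom.ext fun x => Subtype.ext (completionMap_mul g h (x : KInftyHat ζ))

theorem norm_p_lt_one (p : ℕ) (K : Type*) [NontriviallyNormedField K] [IsUltrametricDist K]
    [h : IsPAdicField p K] : ‖(p : K)‖ < 1 := by
  have := h.charP
  have h1 : IsLocalRing.residue (NormedField.valuation (K := K)).valuationSubring p = 0 := by
    rw [map_natCast, CharP.cast_eq_zero]
  rw [IsLocalRing.residue_eq_zero_iff, IsLocalRing.mem_maximalIdeal, mem_nonunits_iff] at h1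
  by_contra hn
  refine h1 (IsUnit.of_mul_eq_one ⟨(p : K)⁻¹, ?_⟩ (Subtype.ext (mul_inv_cancel₀ ?_)))
  · show ‖(p : K)⁻¹‖ ≤ 1
    rw [norm_inv]
    exact inv_le_one_of_one_le₀ (not_lt.1 hn)
  · rintro (h0 : (p : K) = 0)
    rw [h0, norm_zero] at hn
    exact hn one_pos

theorem norm_p_lt_one' [IsPAdicField p K] (ζ : CompatibleRootsOfUnity p K) :
    ‖(p : KInftyHat ζ)‖ < 1 := by
  have h : ‖algebraMap K (KInftyHat ζ) p‖ = ‖(p : K)‖ := norm_algebraMap' _ _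
  rw [map_natCast] at h
  rw [h]
  exact norm_p_lt_one p K

instance [IsPAdicField p K] (ζ : CompatibleRootsOfUnity p K) :
    Fact (¬ IsUnit (p : OKInftyHat ζ)) := ⟨fun h => by
  obtain ⟨y, hy⟩ := h.exists_right_inv
  have h1 : (p : KInftyHat ζ) * (y : KInftyHat ζ) = 1 := congrArg Subtype.val hy
  have h2 := congrArg norm h1
  rw [norm_mul, norm_one] at h2
  have h3 : ‖(y : KInftyHat ζ)‖ ≤ 1 := mem_OKInftyHat.1 y.2
  have h4 := norm_p_lt_one' ζ
  nlinarith [norm_nonneg (y : KInftyHat ζ), norm_nonneg (p : KInftyHat ζ)]⟩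
end Fields

section Ring
set_option linter.unusedSectionVars false
variable {p : ℕ} [Fact p.Prime] {K : Type*} [NontriviallyNormedField K] [IsUltrametricDist K]
  [CompleteSpace K] [IsPAdicField p K]

/-- The tilt `lim_{x ↦ x^p} O / p` of the ring of integers `O` of the completion of `K_∞`. -/
abbrev TiltOK (ζ : CompatibleRootsOfUnity p K) : Type _ := PreTilt (OKInftyHat ζ) p

/-- The ring `Ã_K⁺ = W(O^♭)`. -/
abbrev AKPlus (ζ : CompatibleRootsOfUnity p K) : Type _ := WittVector p (TiltOK ζ)

/-- The action of `Γ_K` on `Ã_K⁺`. -/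
noncomputable def gammaMap {ζ : CompatibleRootsOfUnity p K} (g : GammaK ζ) :
    AKPlus ζ →+* AKPlus ζ :=
  WittVector.map (tiltMap (integerMap g))

theorem gammaMap_one {ζ : CompatibleRootsOfUnity p K} (x : AKPlus ζ) :
    gammaMap (1 : GammaK ζ) x = x := by
  refine WittVector.ext fun n => ?_
  rw [gammaMap, integerMap_one, tiltMap_id, WittVector.map_coeff, RingHom.id_apply]

theorem gammaMap_mul {ζ : CompatibleRootsOfUnity p K} (g h : GammaK ζ) (x : AKPlus ζ) :
    gammaMap (g * h) x = gammaMap g (gammaMap h x) := by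
  refine WittVector.ext fun n => ?_
  rw [gammaMap, gammaMap, gammaMap, integerMap_mul, tiltMap_comp, WittVector.map_coeff,
    WittVector.map_coeff, WittVector.map_coeff, RingHom.comp_apply]

noncomputable instance (ζ : CompatibleRootsOfUnity p K) :
    MulSemiringAction (GammaK ζ) (AKPlus ζ) where
  smul g x := gammaMap g x
  one_smul := gammaMap_one
  mul_smul := gammaMap_mul
  smul_zero g := map_zero (gammaMap g)
  smul_add g := map_add (gammaMap g)
  smul_one g := map_one (gammaMap g)
  smul_mul g := map_mul (gammaMap g)

theorem gammaK_smul_def {ζ : CompatibleRootsOfUnity p K} (g : GammaK ζ) (x : AKPlus ζ) :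
    g • x = gammaMap g x := rfl

/-- The root of unity `ζ_{p^n}`, as an element of `K_∞`. -/
noncomputable def zetaTower (ζ : CompatibleRootsOfUnity p K) (n : ℕ) : CyclotomicTower ζ :=
  ⟨ζ.root n, (le_iSup (fun n => K⟮ζ.root n⟯) n) (mem_adjoin_simple_self K (ζ.root n))⟩

theorem zetaTower_primitive (ζ : CompatibleRootsOfUnity p K) (n : ℕ) :
    IsPrimitiveRoot (zetaTower ζ n) (p ^ n) :=
  IsPrimitiveRoot.of_map_of_injective (f := (CyclotomicTower ζ).val) (ζ.isPrimitiveRoot n)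
    (CyclotomicTower ζ).val.injective

/-- The root of unity `ζ_{p^n}`, as an integer of the completion of `K_∞`. -/
noncomputable def zetaInt (ζ : CompatibleRootsOfUnity p K) (n : ℕ) : OKInftyHat ζ :=
  ⟨(zetaTower ζ n : KInftyHat ζ), by
    rw [mem_OKInftyHat, Completion.norm_coe]
    have h := congrArg norm (zetaTower_primitive ζ n).pow_eq_one
    rw [norm_pow, norm_one] at h
    exact ((pow_eq_one_iff_of_nonneg (norm_nonneg _)
      (pow_ne_zero _ (Fact.out : p.Prime).ne_zero)).1 h).le⟩

theorem zetaInt_primitive (ζ : CompatibleRootsOfUnity p K) (n : ℕ) :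
    IsPrimitiveRoot (zetaInt ζ n) (p ^ n) :=
  IsPrimitiveRoot.of_map_of_injective (f := (OKInftyHat ζ).subtype)
    ((zetaTower_primitive ζ n).map_of_injective
      (f := (Completion.coeRingHom : CyclotomicTower ζ →+* KInftyHat ζ)) (RingHom.injective _))
    Subtype.val_injective

theorem zetaInt_succ_pow (ζ : CompatibleRootsOfUnity p K) (n : ℕ) :
    zetaInt ζ (n + 1) ^ p = zetaInt ζ n := by
  have h : zetaTower ζ (n + 1) ^ p = zetaTower ζ n := Subtype.ext (ζ.root_succ_pow n)
  refine Subtype.ext ?_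
  show ((zetaTower ζ (n + 1) : CyclotomicTower ζ) : KInftyHat ζ) ^ p = (zetaTower ζ n : KInftyHat ζ)
  rw [← h]
  exact (map_pow (Completion.coeRingHom : CyclotomicTower ζ →+* KInftyHat ζ) _ _).symm

/-- The element `ε = (1, ζ_p, ζ_{p^2}, …)` of the tilt. -/
noncomputable def epsilonElt (ζ : CompatibleRootsOfUnity p K) : TiltOK ζ :=
  tiltOfSeq (zetaInt ζ) (zetaInt_succ_pow ζ)

/-- The element `μ = [ε] - 1` of `Ã_K⁺`. -/
noncomputable def muElt (ζ : CompatibleRootsOfUnity p K) : AKPlus ζ :=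
  WittVector.teichmuller p (epsilonElt ζ) - 1

instance (ζ : CompatibleRootsOfUnity p K) : IsDomain (TiltOK ζ) := by
  have hv : (NormedField.valuation (K := KInftyHat ζ)).Integers (OKInftyHat ζ) :=
    { hom_inj := Subtype.val_injective
      map_le_one := fun x => x.2
      exists_of_le_one := fun {r} hr => ⟨⟨r, hr⟩, rfl⟩ }
  exact PreTilt.isDomain (KInftyHat ζ) NormedField.valuation (OKInftyHat ζ) hv p

theorem p_ne_zero_OKInftyHat (ζ : CompatibleRootsOfUnity p K) : (p : OKInftyHat ζ) ≠ 0 := by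
  intro h
  have h1 : (p : KInftyHat ζ) = 0 := congrArg Subtype.val h
  have : CharZero K := IsPAdicField.charZero p
  rw [← map_natCast (algebraMap K (KInftyHat ζ)), map_eq_zero, Nat.cast_eq_zero] at h1
  exact (Fact.out : p.Prime).ne_zero h1

theorem muElt_dvd_smul (ζ : CompatibleRootsOfUnity p K) (g : GammaK ζ) :
    muElt ζ ∣ g • muElt ζ :=
  teichmuller_sub_one_dvd_map (zetaInt ζ) (zetaInt_succ_pow ζ) (zetaInt_primitive ζ)
    (p_ne_zero_OKInftyHat ζ) (integerMap g)

/-- The ideal generated by `μ` is `Γ_K`-stable. -/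
theorem smul_mem_span_muElt (ζ : CompatibleRootsOfUnity p K) :
    ∀ (g : GammaK ζ), ∀ a ∈ Ideal.span {muElt ζ}, g • a ∈ Ideal.span {muElt ζ} := by
  intro g a ha
  rw [Ideal.mem_span_singleton] at ha ⊢
  obtain ⟨b, rfl⟩ := ha
  rw [smul_mul']
  exact (muElt_dvd_smul ζ g).mul_right _

/-- Every `g(μ^n)` is invertible in `Ã_K⁺[1/μ]`. -/
theorem isUnit_smul_powers_muElt (ζ : CompatibleRootsOfUnity p K) :
    ∀ (g : GammaK ζ), ∀ s ∈ Submonoid.powers (muElt ζ),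
      IsUnit (algebraMap (AKPlus ζ) (Localization (Submonoid.powers (muElt ζ))) (g • s)) := by
  rintro g _ ⟨n, rfl⟩
  have h : g • muElt ζ ∣ muElt ζ := by
    obtain ⟨c, hc⟩ := muElt_dvd_smul ζ g⁻¹
    refine ⟨g • c, ?_⟩
    rw [← smul_mul', ← hc, smul_inv_smul]
  have hu : IsUnit (algebraMap (AKPlus ζ) (Localization (Submonoid.powers (muElt ζ))) (muElt ζ)) :=
    IsLocalization.map_units _ (⟨muElt ζ, Submonoid.mem_powers _⟩ : Submonoid.powers (muElt ζ))
  show IsUnit (algebraMap (AKPlus ζ) (Localization (Submonoid.powers (muElt ζ)))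
    (g • (muElt ζ ^ n)))
  rw [smul_pow', map_pow]
  exact (isUnit_of_dvd_unit (map_dvd _ h) hu).pow n

/-- The module `N[1/μ]`. -/
abbrev InvertMu (ζ : CompatibleRootsOfUnity p K) (N : Type*) [AddCommGroup N]
    [Module (AKPlus ζ) N] : Type _ :=
  LocalizedModule (Submonoid.powers (muElt ζ)) N

variable {ζ : CompatibleRootsOfUnity p K} {N : Type*} [AddCommGroup N] [Module (AKPlus ζ) N]

/-- The induced semilinear action of `Γ_K` on `N[1/μ]`. -/
noncomputable def SemilinearAction.invertMu (ρ : SemilinearAction (GammaK ζ) (AKPlus ζ) N) :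
    SemilinearAction (GammaK ζ) (AKPlus ζ) (InvertMu ζ N) :=
  ρ.localize (Submonoid.powers (muElt ζ)) (isUnit_smul_powers_muElt ζ)

/-- The action of `Γ_K` on `N` is trivial modulo `μ`. -/
def SemilinearAction.IsTrivialModMu (ρ : SemilinearAction (GammaK ζ) (AKPlus ζ) N) : Prop :=
  ρ.IsTrivialMod (Ideal.span {muElt ζ}) (smul_mem_span_muElt ζ)

/-- The natural map `N'[1/μ] → N[1/μ]` for a submodule `N'` of `N[1/μ]`. -/
noncomputable def invertMuMap (N' : Submodule (AKPlus ζ) (InvertMu ζ N)) :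
    InvertMu ζ N' →ₗ[AKPlus ζ] InvertMu ζ N :=
  LocalizedModule.lift (Submonoid.powers (muElt ζ)) N'.subtype
    (IsLocalizedModule.map_units (LocalizedModule.mkLinearMap (Submonoid.powers (muElt ζ)) N))

/-- `N'` is a finite free `Γ_K`-stable submodule of `N[1/μ]` with `N'[1/μ] = N[1/μ]` on which
the action of `Γ_K` is trivial modulo `μ`. -/
structure IsTrivialLattice (ρ : SemilinearAction (GammaK ζ) (AKPlus ζ) N)
    (N' : Submodule (AKPlus ζ) (InvertMu ζ N)) : Prop where
  finite : Module.Finite (AKPlus ζ) N'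
  free : Module.Free (AKPlus ζ) N'
  stable : ∀ (g : GammaK ζ), ∀ x ∈ N', ρ.invertMu.act g x ∈ N'
  bijective : Function.Bijective (invertMuMap N')
  trivial : (ρ.invertMu.restrict N' stable).IsTrivialModMu

end Ring

/-! Write `B` for the ring, `μ` for the distinguished element and `u g = g(μ) / μ`. Both assertions
follow from one statement, `exists_eq_of_isTrivialMod`: an equivariant map from a module `M₁`
trivial modulo `μ` into `M₂[1/μ]`, with `M₂` trivial modulo `μ`, lands in `M₂`. Applied to two
lattices in both directions it gives uniqueness.

The proof removes one power of `μ` from the denominator at a time. Suppose `μ^(k+1) f` maps into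
`M₂`, and let `m` be invariant modulo `μ`. Then `n = μ^(k+1) f(m)` satisfies `g(n) ≡ u(g)^(k+1) n`
modulo `μ`. As `M₂/μ` embeds equivariantly into a power of `B/μ`, it suffices that `B/μ` has no
nonzero eigenvector for a positive power of `u` (`muElt_dvd_of_twisted`). Then `n` is divisible by
`μ`, so `μ^k f(m)` lies in `M₂`, and such `m` generate `M₁` modulo `μ`.

The vanishing in `B/μ` is reduced to characteristic zero by the maps `θ ∘ φ^r`, `r ≥ 0`. All of them
kill `μ`, and the intersection of their kernels is exactly `(μ)`
(`teichmuller_sub_one_dvd_of_thetaFrob_eq_zero`). They send `u(g)` to the cyclotomic character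
`χ(g)` (`pow_dvd_thetaFrob_sub`), so an eigenvector in `B/μ` gives elements `y` of the completion of
`K_∞` with `g(y) = χ(g)^k y`, and Tate's theorem says `y = 0` (`eq_zero_of_completionMap_eq`).

Tate's theorem is proved over the absolutely unramified subfield `K₀`, over which `K` is finite. On
`K₀(ζ_{p^∞})` the normalized traces are explicit and uniformly bounded, because the powers of `ζ -
1` form an orthogonal basis at each level. An eigenvector with eigenvalue different from `1` has
trace zero, yet at a high level the trace is close to the vector itself, so the vector vanishes. The
passage from `K₀` to `K` uses the constant term of a minimal polynomial. -/

set_option linter.unusedSectionVars false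

/-! ### Descent along powers of `μ` for modules trivial modulo `μ`. -/

section TrivialMod
variable {G B M : Type*} [Group G] [CommRing B] [MulSemiringAction G B]
  [AddCommGroup M] [Module B M]

namespace SemilinearAction

theorem quotientMap_smul (ρ : SemilinearAction G B M) (I : Ideal B)
    (hI : ∀ (g : G), ∀ b ∈ I, g • b ∈ I) (g : G) (r : B ⧸ I)
    (x : M ⧸ (I • ⊤ : Submodule B M)) :
    ρ.quotientMap I hI g (r • x) = quotientAct I hI g r • ρ.quotientMap I hI g x := by
  obtain ⟨b, rfl⟩ := Ideal.Quotient.mk_surjective r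
  exact map_smulₛₗ (ρ.quotientMap I hI g) b x

/-- Surjectivity of the base change map: the invariants generate `M / I M`. -/
theorem IsTrivialMod.span_eq_top {ρ : SemilinearAction G B M} {I : Ideal B}
    {hI : ∀ (g : G), ∀ b ∈ I, g • b ∈ I} (h : ρ.IsTrivialMod I hI)
    (S : Submodule B (M ⧸ (I • ⊤ : Submodule B M)))
    (hS : ∀ x, (∀ g, ρ.quotientMap I hI g x = x) → x ∈ S) (x : M ⧸ (I • ⊤ : Submodule B M)) :
    x ∈ S := by
  induction x using h.isBaseChange.inductionOn with
  | zero => exact S.zero_mem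
  | tmul m => exact hS _ m.2
  | smul r n hn =>
    obtain ⟨b, rfl⟩ := Ideal.Quotient.mk_surjective r
    exact S.smul_mem b hn
  | add a b ha hb => exact S.add_mem ha hb

/-- If the twist of `B / I` by `c` has no nonzero invariants, neither has the twist of `M / I M`
when the action on `M` is trivial modulo `I`. -/
theorem IsTrivialMod.eq_zero_of_twisted {ρ : SemilinearAction G B M} {I : Ideal B}
    {hI : ∀ (g : G), ∀ b ∈ I, g • b ∈ I} (h : ρ.IsTrivialMod I hI) (c : G → B ⧸ I)
    (hv : ∀ b : B ⧸ I, (∀ g, quotientAct I hI g b = c g * b) → b = 0)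
    (x : M ⧸ (I • ⊤ : Submodule B M)) (hx : ∀ g, ρ.quotientMap I hI g x = c g • x) : x = 0 := by
  have := h.finite
  have := h.projective
  -- The invariants form a retract of a finite free module. Extending the coordinates of the section
  -- `s` to `M / I M` gives functionals `L i` that jointly determine an element (`hsum`) and commute
  -- with `G` (`hequiv`), so the claim can be checked in `B / I`.
  obtain ⟨n, f, s, -, -, hs⟩ := Module.Finite.exists_comp_eq_id_of_projective
    (quotientInvariants I hI) (ρ.invariants I hI)
  let l : Fin n → ρ.invariants I hI →ₗ[quotientInvariants I hI] B ⧸ I := fun i =>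
    Algebra.linearMap (quotientInvariants I hI) (B ⧸ I) ∘ₗ LinearMap.proj i ∘ₗ s
  let L : Fin n → (M ⧸ (I • ⊤ : Submodule B M)) →ₗ[B ⧸ I] B ⧸ I := fun i =>
    h.isBaseChange.lift (l i)
  have hL : ∀ i (z : ρ.invariants I hI), L i z = ((s z i : quotientInvariants I hI) : B ⧸ I) :=
    fun i z => h.isBaseChange.lift_eq (l i) z
  have hsum : ∀ y, y = ∑ i, L i y • ((f (fun j => if i = j then 1 else 0) : ρ.invariants I hI) :
      M ⧸ (I • ⊤ : Submodule B M)) := by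
    intro y
    induction y using h.isBaseChange.inductionOn with
    | zero => simp
    | tmul z =>
      have h1 : f (s z) = z := LinearMap.congr_fun hs z
      conv_lhs => rw [← h1, LinearMap.pi_apply_eq_sum_univ f (s z)]
      simp only [Submodule.subtype_apply, hL, Submodule.coe_sum, Submodule.coe_smul]
      rfl
    | smul r y hy =>
      conv_lhs => rw [hy]
      simp [Finset.smul_sum, smul_smul]
    | add y z hy hz =>
      conv_lhs => rw [hy, hz]
      simp [add_smul, Finset.sum_add_distrib]
  have hequiv : ∀ i g y, L i (ρ.quotientMap I hI g y) = quotientAct I hI g (L i y) := by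
    intro i g y
    induction y using h.isBaseChange.inductionOn with
    | zero => simp
    | tmul z =>
      have h1 : ρ.quotientMap I hI g (z : M ⧸ (I • ⊤ : Submodule B M)) = z := z.2 g
      rw [Submodule.subtype_apply, h1, hL]
      exact ((s z i).2 g).symm
    | smul r y hy => rw [quotientMap_smul, map_smul, hy, map_smul, smul_eq_mul, smul_eq_mul, map_mul]
    | add y z hy hz => rw [map_add, map_add, hy, hz, map_add, map_add]
  rw [hsum x]
  refine Finset.sum_eq_zero fun i _ => ?_
  rw [hv (L i x) fun g => ?_, zero_smul]
  rw [← hequiv, hx, map_smul, smul_eq_mul]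

end SemilinearAction

/-- Let `D` be a module with semilinear action on which `μ` is injective, and let `M₁ → D` and
`M₂ ↪ D` be equivariant with `M₂[1/μ] = D`. If both actions are trivial modulo `μ` and the powers
of the cocycle `u g = g(μ) / μ` have no nonzero eigenvectors in `B / μ`, then the image of `M₁`
is contained in that of `M₂`. -/
theorem exists_eq_of_isTrivialMod {M₁ M₂ D : Type*} [AddCommGroup M₁] [Module B M₁]
    [AddCommGroup M₂] [Module B M₂] [AddCommGroup D] [Module B D] [Module.Finite B M₁]
    (μ : B) (u : G → B) (hu : ∀ g, g • μ = u g * μ)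
    (hI : ∀ (g : G), ∀ b ∈ Ideal.span {μ}, g • b ∈ Ideal.span {μ})
    (hv : ∀ k : ℕ, k ≠ 0 → ∀ x : B, (∀ g, μ ∣ g • x - u g ^ k * x) → μ ∣ x)
    (ρ₁ : SemilinearAction G B M₁) (ρ₂ : SemilinearAction G B M₂) (σ : SemilinearAction G B D)
    (h₁ : ρ₁.IsTrivialMod (Ideal.span {μ}) hI) (h₂ : ρ₂.IsTrivialMod (Ideal.span {μ}) hI)
    (hD : ∀ d : D, μ • d = 0 → d = 0)
    (f : M₁ →ₗ[B] D) (hf : ∀ g m, f (ρ₁.act g m) = σ.act g (f m))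
    (i : M₂ →ₗ[B] D) (hi : ∀ g m, i (ρ₂.act g m) = σ.act g (i m))
    (hinj : Function.Injective i) (hloc : ∀ d : D, ∃ k : ℕ, ∃ m, μ ^ k • d = i m) (m₁ : M₁) :
    ∃ m₂, f m₁ = i m₂ := by
  have hDpow : ∀ (k : ℕ) (d d' : D), μ ^ k • d = μ ^ k • d' → d = d' := by
    intro k
    induction k with
    | zero => intro d d' h; simpa using h
    | succ k ih =>
      intro d d' h
      refine ih _ _ (sub_eq_zero.1 (hD _ ?_))
      rw [smul_sub, smul_smul, smul_smul, ← pow_succ', h, sub_self]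
  -- `S k` collects the elements whose image has denominator at most `μ^k`. It is everything for
  -- some `k` by finite generation, and the aim is to descend to `k = 0`.
  let S : ℕ → Submodule B M₁ := fun k => (LinearMap.range i).comap (μ ^ k • f)
  have hS : ∀ k m, m ∈ S k ↔ ∃ n, μ ^ k • f m = i n := fun k m =>
    ⟨fun ⟨n, hn⟩ => ⟨n, hn.symm⟩, fun ⟨n, hn⟩ => ⟨n, hn.symm⟩⟩
  have hmono : ∀ k l, k ≤ l → S k ≤ S l := by
    intro k l hkl m hm
    rw [hS] at hm ⊢
    obtain ⟨n, hn⟩ := hm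
    refine ⟨μ ^ (l - k) • n, ?_⟩
    rw [map_smul, ← hn, smul_smul, ← pow_add, Nat.sub_add_cancel hkl]
  have hstart : ∃ k, S k = ⊤ := by
    obtain ⟨t, ht⟩ := (Module.Finite.fg_top : (⊤ : Submodule B M₁).FG)
    choose k hk using fun m : M₁ => hloc (f m)
    refine ⟨t.sup k, top_unique ?_⟩
    rw [← ht, Submodule.span_le]
    intro m hm
    exact hmono (k m) _ (Finset.le_sup (f := k) hm) ((hS _ _).2 (hk m))
  have hstep : ∀ k, S (k + 1) = ⊤ → S k = ⊤ := by
    intro k hk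
    have hinv : ∀ m : M₁, (∀ g, ρ₁.quotientMap (Ideal.span {μ}) hI g (Submodule.Quotient.mk m) =
        Submodule.Quotient.mk m) → m ∈ S k := by
      intro m hm
      obtain ⟨n, hn⟩ := (hS (k + 1) m).1 (hk ▸ Submodule.mem_top)
      -- Acting by `g` on `i n = μ^(k+1) f(m)` produces the factor `u(g)^(k+1)` from `μ^(k+1)`. The
      -- change of `m` lies in `μ M₁`, and its contribution is in `μ M₂` because `S (k + 1)` is
      -- everything.
      have key : ∀ g, ρ₂.quotientMap (Ideal.span {μ}) hI g (Submodule.Quotient.mk n) =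
          Ideal.Quotient.mk (Ideal.span {μ}) (u g ^ (k + 1)) •
            (Submodule.Quotient.mk n : M₂ ⧸ (Ideal.span {μ} • ⊤ : Submodule B M₂)) := by
        intro g
        have h3 : (Submodule.Quotient.mk (ρ₁.act g m) :
            M₁ ⧸ (Ideal.span {μ} • ⊤ : Submodule B M₁)) = Submodule.Quotient.mk m := hm g
        rw [Submodule.Quotient.eq, Submodule.ideal_span_singleton_smul] at h3
        obtain ⟨m', -, hm'⟩ := (Submodule.mem_smul_pointwise_iff_exists _ _ _).1 h3
        obtain ⟨n', hn'⟩ := (hS (k + 1) m').1 (hk ▸ Submodule.mem_top)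
        show (Submodule.Quotient.mk (ρ₂.act g n) :
            M₂ ⧸ (Ideal.span {μ} • ⊤ : Submodule B M₂)) = Submodule.Quotient.mk (u g ^ (k + 1) • n)
        rw [Submodule.Quotient.eq, Submodule.ideal_span_singleton_smul]
        refine (Submodule.mem_smul_pointwise_iff_exists _ _ _).2
          ⟨u g ^ (k + 1) • n', trivial, hinj ?_⟩
        rw [map_sub, hi, ← hn, σ.act_smul, ← hf, eq_add_of_sub_eq hm'.symm, smul_pow', hu, mul_pow,
          map_add, map_smul, map_smul, map_smul, map_smul, ← hn, ← hn']
        simp only [smul_add, smul_smul]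
        rw [add_sub_assoc, sub_self, add_zero]
        congr 1
        ring
      have hzero := h₂.eq_zero_of_twisted
        (fun g => Ideal.Quotient.mk (Ideal.span {μ}) (u g ^ (k + 1))) (fun b hb => ?_) _ key
      · rw [Submodule.Quotient.mk_eq_zero, Submodule.ideal_span_singleton_smul] at hzero
        obtain ⟨n', -, rfl⟩ := (Submodule.mem_smul_pointwise_iff_exists _ _ _).1 hzero
        refine (hS k m).2 ⟨n', hDpow 1 _ _ ?_⟩
        rw [smul_smul, ← pow_add, add_comm 1 k, hn, map_smul, pow_one]
      · obtain ⟨x, rfl⟩ := Ideal.Quotient.mk_surjective b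
        rw [Ideal.Quotient.eq_zero_iff_dvd]
        refine hv (k + 1) k.succ_ne_zero x fun g => ?_
        rw [← Ideal.Quotient.eq_zero_iff_dvd, map_sub, map_mul, sub_eq_zero]
        exact hb g
    have hsub : (Ideal.span {μ} • ⊤ : Submodule B M₁) ≤ S k := by
      rw [Submodule.ideal_span_singleton_smul]
      intro m hm
      obtain ⟨m', -, rfl⟩ := (Submodule.mem_smul_pointwise_iff_exists _ _ _).1 hm
      obtain ⟨n, hn⟩ := (hS (k + 1) m').1 (hk ▸ Submodule.mem_top)
      exact (hS _ _).2 ⟨n, by rw [map_smul, smul_smul, ← pow_succ, hn]⟩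
    refine top_unique fun m _ => ?_
    have h4 : Submodule.Quotient.mk m ∈ (S k).map (Ideal.span {μ} • ⊤ : Submodule B M₁).mkQ := by
      refine h₁.span_eq_top _ (fun x hx => ?_) _
      obtain ⟨m, rfl⟩ := Submodule.Quotient.mk_surjective _ x
      exact ⟨m, hinv m hx, rfl⟩
    obtain ⟨m', hm', h5⟩ := h4
    have h6 := hsub ((Submodule.Quotient.eq _).1 h5.symm)
    simpa using (S k).add_mem h6 hm'
  have hall : ∀ k, S k = ⊤ → S 0 = ⊤ := fun k => by
    induction k with
    | zero => exact id
    | succ k ih => exact fun h => ih (hstep k h)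
  obtain ⟨k, hk⟩ := hstart
  have h0 : m₁ ∈ S 0 := hall k hk ▸ Submodule.mem_top
  simpa using (hS 0 m₁).1 h0

end TrivialMod

/-! ### Absolute values of `ζ - 1` for roots of unity of `p`-power order. -/

section NormRootsOfUnity
variable {p : ℕ} [hp : Fact p.Prime] {M : Type*} [NormedField M]

theorem IsPrimitiveRoot.norm_eq_one_of_prime_pow {z : M} {n : ℕ} (hz : IsPrimitiveRoot z (p ^ n)) :
    ‖z‖ = 1 := by
  have h := congrArg norm hz.pow_eq_one
  rw [norm_pow, norm_one] at h
  exact (pow_eq_one_iff_of_nonneg (norm_nonneg _) (pow_ne_zero _ hp.out.ne_zero)).1 h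

variable [IsUltrametricDist M]

theorem norm_pow_sub_one_le {z : M} (hz : ‖z‖ = 1) (c : ℕ) : ‖z ^ c - 1‖ ≤ ‖z - 1‖ := by
  rw [← geom_sum_mul, norm_mul]
  refine mul_le_of_le_one_left (norm_nonneg _) ?_
  refine IsUltrametricDist.norm_sum_le_of_forall_le_of_nonneg zero_le_one fun i _ => ?_
  rw [norm_pow, hz, one_pow]

/-- Each of the two roots is a power of the other, so `z - 1` and `w - 1` bound each other. -/
theorem IsPrimitiveRoot.norm_sub_one_eq {z w : M} {n : ℕ} (hz : IsPrimitiveRoot z (p ^ n))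
    (hw : IsPrimitiveRoot w (p ^ n)) : ‖w - 1‖ = ‖z - 1‖ := by
  have : NeZero (p ^ n) := ⟨pow_ne_zero _ hp.out.ne_zero⟩
  obtain ⟨i, -, rfl⟩ := hz.eq_pow_of_pow_eq_one hw.pow_eq_one
  refine le_antisymm (norm_pow_sub_one_le hz.norm_eq_one_of_prime_pow i) ?_
  obtain ⟨j, -, hj⟩ := hw.eq_pow_of_pow_eq_one hz.pow_eq_one
  conv_lhs => rw [← hj]
  exact norm_pow_sub_one_le hw.norm_eq_one_of_prime_pow j

/-- The cyclotomic polynomial takes the value `p` at `1`, and all its roots are at the same distance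
from `1`. -/
theorem IsPrimitiveRoot.norm_sub_one_pow_totient {z : M} {n : ℕ}
    (hz : IsPrimitiveRoot z (p ^ (n + 1))) :
    ‖z - 1‖ ^ (p ^ (n + 1)).totient = ‖(p : M)‖ := by
  have h1 : (Polynomial.cyclotomic (p ^ (n + 1)) M).eval 1 = p :=
    Polynomial.eval_one_cyclotomic_prime_pow n
  rw [Polynomial.cyclotomic_eq_prod_X_sub_primitiveRoots hz, Polynomial.eval_prod] at h1
  rw [← h1, norm_prod, ← hz.card_primitiveRoots]
  symm
  refine Finset.prod_eq_pow_card fun w hw => ?_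
  rw [Polynomial.eval_sub, Polynomial.eval_X, Polynomial.eval_C, norm_sub_rev]
  exact hz.norm_sub_one_eq (isPrimitiveRoot_of_mem_primitiveRoots hw)

end NormRootsOfUnity

/-! ### Normalized traces on cyclotomic extensions, as maps on polynomials. -/

section FilteredEval
variable {p : ℕ} [hp : Fact p.Prime] {M : Type*} [NormedField M]
  {F : Type*} [Field F] [Algebra F M]

/-- The linear map `F[X] → M` sending `X ^ i` to `z ^ i` if `d ∣ i` and to `0` otherwise. For a
root of unity `z` it computes a normalized trace. -/
noncomputable def filteredEval (F : Type*) [Field F] [Algebra F M] (z : M) (d : ℕ) :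
    Polynomial F →ₗ[F] M :=
  Polynomial.lsum fun i => if d ∣ i then LinearMap.toSpanSingleton F M (z ^ i) else 0

open Polynomial

theorem filteredEval_monomial (z : M) (d i : ℕ) (a : F) :
    filteredEval F z d (monomial i a) = if d ∣ i then a • z ^ i else 0 := by
  rw [filteredEval, lsum_apply, sum_monomial_index _ (fun i a => (if d ∣ i then
    LinearMap.toSpanSingleton F M (z ^ i) else 0 : F →ₗ[F] M) a) (map_zero _)]
  split_ifs <;> simp

/-- The normalized trace is the identity on the smaller field `F(z^d)`. -/
theorem filteredEval_expand (z : M) (d : ℕ) (f : F[X]) :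
    filteredEval F z d (expand F d f) = aeval (z ^ d) f := by
  induction f using Polynomial.induction_on' with
  | add f g hf hg => rw [map_add, map_add, map_add, hf, hg]
  | monomial i a =>
    rw [expand_monomial, filteredEval_monomial, if_pos (dvd_mul_left _ _), aeval_monomial,
      Algebra.smul_def, ← pow_mul, mul_comm i]

/-- The exponents of the cyclotomic polynomial are multiples of `p^n`, hence of `d`, so multiplying
by it does not affect which monomials survive. Therefore the map only depends on the value of the
polynomial at `z`. -/
theorem filteredEval_cyclotomic_mul {z : M} {n d : ℕ} (hz : IsPrimitiveRoot z (p ^ (n + 1)))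
    (hd : d ∣ p ^ n) (f : F[X]) :
    filteredEval F z d (cyclotomic (p ^ (n + 1)) F * f) = 0 := by
  induction f using Polynomial.induction_on' with
  | add f g hf hg => rw [mul_add, map_add, hf, hg, add_zero]
  | monomial i a =>
    rw [cyclotomic_prime_pow_eq_geom_sum hp.out, Finset.sum_mul, map_sum]
    have h1 : ∀ j, filteredEval F z d ((X ^ p ^ n) ^ j * monomial i a) =
        if d ∣ i then a • (z ^ i * (z ^ p ^ n) ^ j) else 0 := fun j => by
      rw [← pow_mul, X_pow_mul_monomial, filteredEval_monomial, pow_add, pow_mul]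
      exact if_congr (Nat.dvd_add_left (hd.mul_right j)) rfl rfl
    rw [Finset.sum_congr rfl fun j _ => h1 j]
    split_ifs
    · rw [← Finset.smul_sum, ← Finset.mul_sum]
      have h2 : IsPrimitiveRoot (z ^ p ^ n) p :=
        hz.pow (pow_pos hp.out.pos _) (pow_succ _ _)
      rw [h2.geom_sum_eq_zero hp.out.one_lt, mul_zero, smul_zero]
    · simp

end FilteredEval

/-! ### Orthogonality of the powers of `ζ - 1` and boundedness of the normalized traces. -/

section CyclotomicBasis
variable {p : ℕ} [hp : Fact p.Prime] {M : Type*} [NormedField M] [IsUltrametricDist M]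
  {F : Type*} [Field F] [Algebra F M]

theorem norm_intCast_le_one_of_isUltrametricDist (a : ℤ) : ‖(a : M)‖ ≤ 1 := by
  obtain ⟨n, rfl | rfl⟩ := a.eq_nat_or_neg
  · exact_mod_cast IsUltrametricDist.norm_natCast_le_one M n
  · rw [Int.cast_neg, norm_neg]
    exact_mod_cast IsUltrametricDist.norm_natCast_le_one M n

/-- If the value group of `F` is generated by that of `p`, the powers of `ζ - 1` are orthogonal. -/
theorem norm_coeff_mul_le_norm_sum (hp0 : (p : M) ≠ 0) (hp1 : ‖(p : M)‖ < 1)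
    (hF : ∀ c : F, c ≠ 0 → ∃ a : ℤ, ‖algebraMap F M c‖ = ‖(p : M)‖ ^ a)
    {z : M} {n : ℕ} (hz : IsPrimitiveRoot z (p ^ (n + 1))) (c : ℕ → F) {i : ℕ}
    (hi : i < (p ^ (n + 1)).totient) :
    ‖algebraMap F M (c i)‖ ≤ ‖(p : M)‖⁻¹ *
      ‖∑ j ∈ Finset.range (p ^ (n + 1)).totient, algebraMap F M (c j) * (z - 1) ^ j‖ := by
  set N := (p ^ (n + 1)).totient with hN
  have hr := hz.norm_sub_one_pow_totient
  rw [← hN] at hr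
  set r := ‖z - 1‖ with hr'
  have hppos : 0 < ‖(p : M)‖ := norm_pos_iff.2 hp0
  have hN0 : N ≠ 0 := by omega
  have hr0 : 0 < r := by
    rcases (norm_nonneg (z - 1)).lt_or_eq with h | h
    · exact h
    · rw [hr', ← h, zero_pow hN0] at hr
      exact absurd hr hppos.ne
  have hr1 : r < 1 := by
    by_contra h
    rw [← hr] at hp1
    exact absurd hp1 (not_lt.2 (one_le_pow₀ (not_lt.1 h)))
  classical
  by_cases hci : c i = 0
  · rw [hci, map_zero, norm_zero]
    positivity
  -- Zero coefficients are discarded, since only nonzero ones have a norm that is a power of `‖p‖`.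
  let s := (Finset.range N).filter fun j => c j ≠ 0
  have his : i ∈ s := Finset.mem_filter.2 ⟨Finset.mem_range.2 hi, hci⟩
  have hsum : ∑ j ∈ Finset.range N, algebraMap F M (c j) * (z - 1) ^ j =
      ∑ j ∈ s, algebraMap F M (c j) * (z - 1) ^ j := by
    symm
    refine Finset.sum_subset (Finset.filter_subset _ _) fun j hj hjs => ?_
    have : c j = 0 := by
      by_contra h
      exact hjs (Finset.mem_filter.2 ⟨hj, h⟩)
    rw [this, map_zero, zero_mul]
  -- As `‖p‖ = r^N`, the term of index `j` has norm `r^(N a + j)` with `0 ≤ j < N`. The exponent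
  -- modulo `N` recovers `j`, so the norms are distinct and the sum has the norm of its largest
  -- term.
  have hpair : Set.Pairwise (s : Set ℕ) fun j k =>
      ‖algebraMap F M (c j) * (z - 1) ^ j‖ ≠ ‖algebraMap F M (c k) * (z - 1) ^ k‖ := by
    intro j hj k hk hjk h
    obtain ⟨hj1, hj2⟩ := Finset.mem_filter.1 (Finset.mem_coe.1 hj)
    obtain ⟨hk1, hk2⟩ := Finset.mem_filter.1 (Finset.mem_coe.1 hk)
    rw [Finset.mem_range] at hj1 hk1
    obtain ⟨a, ha⟩ := hF _ hj2
    obtain ⟨b, hb⟩ := hF _ hk2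
    rw [norm_mul, norm_mul, ha, hb, norm_pow, norm_pow, ← hr, ← hr', ← zpow_natCast r N,
      ← zpow_mul, ← zpow_mul, ← zpow_natCast r j, ← zpow_natCast r k, ← zpow_add₀ hr0.ne',
      ← zpow_add₀ hr0.ne'] at h
    have h2 := zpow_right_injective₀ hr0 hr1.ne h
    have h3 : ((N : ℤ) * a + j) % N = ((N : ℤ) * b + k) % N := by rw [h2]
    rw [Int.mul_add_emod_self_left, Int.mul_add_emod_self_left, Int.emod_eq_of_lt (by omega)
      (by omega), Int.emod_eq_of_lt (by omega) (by omega)] at h3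
    omega
  have hle : ‖algebraMap F M (c i) * (z - 1) ^ i‖ ≤
      ‖∑ j ∈ s, algebraMap F M (c j) * (z - 1) ^ j‖ := by
    rw [IsUltrametricDist.norm_sum_eq_sup'_of_pairwise_ne ⟨i, his⟩ hpair]
    exact Finset.le_sup' (fun j => ‖algebraMap F M (c j) * (z - 1) ^ j‖) his
  rw [hsum, ← div_eq_inv_mul, le_div_iff₀ hppos]
  refine le_trans ?_ hle
  rw [norm_mul, norm_pow, ← hr]
  -- The factor `‖p‖⁻¹` is the price of replacing `r^i` by its lower bound `r^N = ‖p‖`. It does not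
  -- depend on the level `n`.
  exact mul_le_mul_of_nonneg_left (pow_le_pow_of_le_one hr0.le hr1.le hi.le) (norm_nonneg _)

open Polynomial

theorem norm_filteredEval_le {z : M} (hz : ‖z‖ ≤ 1) (d : ℕ) (f : F[X]) (C : ℝ) (hC : 0 ≤ C)
    (hf : ∀ i, ‖algebraMap F M (f.coeff i)‖ ≤ C) : ‖filteredEval F z d f‖ ≤ C := by
  rw [filteredEval, lsum_apply, Polynomial.sum]
  refine IsUltrametricDist.norm_sum_le_of_forall_le_of_nonneg hC fun i _ => ?_
  split_ifs
  · rw [LinearMap.toSpanSingleton_apply, Algebra.smul_def, norm_mul, norm_pow]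
    exact (mul_le_of_le_one_right (norm_nonneg _) (pow_le_one₀ (norm_nonneg _) hz)).trans (hf i)
  · simpa using hC

/-- Boundedness of the normalized traces. -/
theorem norm_filteredEval_le_norm_aeval (hp0 : (p : M) ≠ 0) (hp1 : ‖(p : M)‖ < 1)
    (hF : ∀ c : F, c ≠ 0 → ∃ a : ℤ, ‖algebraMap F M c‖ = ‖(p : M)‖ ^ a)
    {z : M} {n d : ℕ} (hz : IsPrimitiveRoot z (p ^ (n + 1))) (hd : d ∣ p ^ n) (f : F[X]) :
    ‖filteredEval F z d f‖ ≤ ‖(p : M)‖⁻¹ * ‖aeval z f‖ := by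
  set Φ := cyclotomic (p ^ (n + 1)) F with hΦ
  have hmon : Φ.Monic := cyclotomic.monic _ _
  -- Neither side changes modulo `Φ`. The remainder is expanded in powers of `X - 1`: its
  -- coefficients are bounded by orthogonality, and the trace of `(z - 1)^i` has norm at most `1`
  -- because `(X - 1)^i` has integer coefficients.
  set r := f %ₘ Φ with hr
  have hf : f = r + Φ * (f /ₘ Φ) := (modByMonic_add_div f Φ).symm
  have hΦz : aeval z Φ = 0 := by
    have h : (cyclotomic (p ^ (n + 1)) M).IsRoot z := hz.isRoot_cyclotomic (pow_pos hp.out.pos _)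
    rw [hΦ, aeval_def, eval₂_eq_eval_map, map_cyclotomic]
    exact h
  have h1 : filteredEval F z d f = filteredEval F z d r := by
    conv_lhs => rw [hf, map_add, filteredEval_cyclotomic_mul hz hd, add_zero]
  have h2 : aeval z f = aeval z r := by
    conv_lhs => rw [hf, map_add, map_mul, hΦz, zero_mul, add_zero]
  have hdeg : (taylor 1 r).natDegree < (p ^ (n + 1)).totient := by
    rw [natDegree_taylor]
    have h3 := natDegree_modByMonic_lt f hmon fun h => by
      have h4 := congrArg (aeval z) h
      rw [hΦz, map_one] at h4
      exact zero_ne_one h4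
    rwa [natDegree_cyclotomic] at h3
  set c : ℕ → F := fun i => (taylor 1 r).coeff i with hc
  have hrsum : r = ∑ i ∈ Finset.range (p ^ (n + 1)).totient, C (c i) * (X - 1) ^ i := by
    conv_lhs => rw [← sum_taylor_eq r 1]
    rw [Polynomial.sum_over_range' _ (fun i => by simp) _ hdeg]
    simp [hc]
  have h3 : aeval z r =
      ∑ j ∈ Finset.range (p ^ (n + 1)).totient, algebraMap F M (c j) * (z - 1) ^ j := by
    conv_lhs => rw [hrsum]
    simp
  have hcoef : ∀ i j, ‖algebraMap F M (((X - 1 : F[X]) ^ i).coeff j)‖ ≤ 1 := by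
    intro i j
    have h4 : (X - 1 : F[X]) ^ i = ((X - 1 : ℤ[X]) ^ i).map (Int.castRingHom F) := by simp
    rw [h4, coeff_map, eq_intCast, map_intCast]
    exact norm_intCast_le_one_of_isUltrametricDist _
  rw [h1, h2]
  conv_lhs => rw [hrsum, map_sum]
  refine IsUltrametricDist.norm_sum_le_of_forall_le_of_nonneg (by positivity) fun i hi => ?_
  rw [← smul_eq_C_mul, map_smul, Algebra.smul_def, norm_mul]
  refine (mul_le_of_le_one_right (norm_nonneg _) (norm_filteredEval_le
    hz.norm_eq_one_of_prime_pow.le d _ 1 zero_le_one (hcoef i))).trans ?_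
  rw [h3]
  exact norm_coeff_mul_le_norm_sum hp0 hp1 hF hz c (Finset.mem_range.1 hi)

end CyclotomicBasis

/-! ### Eigenvectors in the completed cyclotomic tower. -/

theorem pow_pow_of_succ_pow {R : Type*} [Monoid R] {p : ℕ} {z : ℕ → R}
    (hzs : ∀ n, z (n + 1) ^ p = z n) (n k : ℕ) : z (n + k) ^ p ^ k = z n := by
  induction k with
  | zero => simp
  | succ k ih => rw [pow_succ', pow_mul, ← add_assoc, hzs, ih]

theorem exists_aeval_of_mem_iSup_adjoin {p : ℕ} [hp : Fact p.Prime] {F E : Type*} [Field F]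
    [Field E] [Algebra F E] {z : ℕ → E} (hzs : ∀ n, z (n + 1) ^ p = z n)
    (hz : ∀ n, IsPrimitiveRoot (z n) (p ^ n)) (x : E) (hx : x ∈ ⨆ n, F⟮z n⟯) :
    ∃ m, ∃ f : Polynomial F, x = Polynomial.aeval (z m) f := by
  have hdir : Directed (· ≤ ·) fun n => F⟮z n⟯ := by
    refine (monotone_nat_of_le_succ fun n => ?_).directed_le
    rw [adjoin_simple_le_iff, ← hzs n]
    exact pow_mem (mem_adjoin_simple_self F _) p
  rw [← SetLike.mem_coe, coe_iSup_of_directed hdir, Set.mem_iUnion] at hx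
  obtain ⟨m, hm⟩ := hx
  have halg : IsAlgebraic F (z m) :=
    ((hz m).isIntegral (pow_pos hp.out.pos m)).tower_top.isAlgebraic
  have h1 : x ∈ F⟮z m⟯.toSubalgebra := hm
  rw [adjoin_simple_toSubalgebra_of_isAlgebraic halg, Algebra.adjoin_singleton_eq_range_aeval] at h1
  obtain ⟨f, hf⟩ := h1
  exact ⟨m, f, hf.symm⟩

section Eigenvectors
variable {p : ℕ} [hp : Fact p.Prime] {M : Type*} [NormedField M] [IsUltrametricDist M]
  {F : Type*} [Field F] [Algebra F M] {z : ℕ → M}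

open Polynomial

/-- Galois invariance of the normalized trace: `expand F c` lifts the automorphism `z ↦ z^c`. With
`c` prime to `p^n` it preserves divisibility of exponents by `p^k`, and it fixes `w`, which
generates the target field. -/
theorem filteredEval_expand_eq {z w : M} {n k c : ℕ} (hw : w = z ^ p ^ k)
    (hwc : w ^ c = w) (hc : Nat.Coprime (p ^ n) c) (hkn : k ≤ n) (f : F[X]) :
    filteredEval F z (p ^ k) (expand F c f) = filteredEval F z (p ^ k) f := by
  induction f using Polynomial.induction_on' with
  | add f g hf hg => rw [map_add, map_add, map_add, hf, hg]
  | monomial i a =>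
    rw [expand_monomial, filteredEval_monomial, filteredEval_monomial]
    have hcop : Nat.Coprime (p ^ k) c := hc.coprime_dvd_left (pow_dvd_pow p hkn)
    by_cases h : p ^ k ∣ i
    · rw [if_pos h, if_pos (h.mul_right _)]
      obtain ⟨j, rfl⟩ := h
      rw [mul_assoc, pow_mul, ← hw, mul_comm j, pow_mul, hwc, pow_mul, ← hw]
    · rw [if_neg h, if_neg fun h' => h (hcop.dvd_of_dvd_mul_right h')]

/-- An eigenvector in the closure of `F(ζ_{p^∞})` of an isometry fixing `F` and `ζ_{p^n}`, with
eigenvalue in `F` different from `1`, is far from `F(ζ_{p^n})`. -/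
theorem norm_aeval_le_of_eigenvector (hp0 : (p : M) ≠ 0) (hp1 : ‖(p : M)‖ < 1)
    (hF : ∀ c : F, c ≠ 0 → ∃ a : ℤ, ‖algebraMap F M c‖ = ‖(p : M)‖ ^ a)
    (hz : ∀ n, IsPrimitiveRoot (z n) (p ^ n)) (hzs : ∀ n, z (n + 1) ^ p = z n)
    (y : M) (hy : ∀ ε > 0, ∃ m, ∃ f : F[X], ‖y - aeval (z m) f‖ < ε)
    (σ : M →+* M) (hσ : ∀ x, ‖σ x‖ = ‖x‖) (hσF : ∀ c : F, σ (algebraMap F M c) = algebraMap F M c)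
    (n : ℕ) (hσn : σ (z (n + 1)) = z (n + 1)) (l : F) (hl : l ≠ 1)
    (hly : σ y = algebraMap F M l * y) (h : F[X]) :
    ‖aeval (z (n + 1)) h‖ ≤ ‖(p : M)‖⁻¹ * ‖y - aeval (z (n + 1)) h‖ := by
  have hppos : 0 < ‖(p : M)‖ := norm_pos_iff.2 hp0
  have hl0 : 0 < ‖1 - algebraMap F M l‖ := by
    rw [norm_pos_iff, sub_ne_zero]
    intro h
    exact hl ((algebraMap F M).injective (by rw [← h, map_one]))
  set C := ‖(p : M)‖⁻¹ with hC
  have hC0 : 0 ≤ C := by positivity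
  -- Here `δ` is the error in replacing `y` by an element `x` of a finite level, where the trace is
  -- defined. It tends to `0` at the end.
  have main : ∀ δ > 0, ‖aeval (z (n + 1)) h‖ ≤ C * (‖y - aeval (z (n + 1)) h‖ + δ) +
      C * ((1 + ‖algebraMap F M l‖) * δ) / ‖1 - algebraMap F M l‖ := by
    intro δ hδ
    obtain ⟨m, f₀, hf₀⟩ := hy δ hδ
    -- Substituting a power of the variable moves the approximant up to a level that contains `z (n
    -- + 1)`.
    obtain ⟨f, hf⟩ : ∃ f : F[X], ‖y - aeval (z (n + 1 + m)) f‖ < δ := by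
      refine ⟨expand F (p ^ (n + 1)) f₀, ?_⟩
      rw [expand_aeval, add_comm (n + 1) m, pow_pow_of_succ_pow hzs]
      exact hf₀
    set w := z (n + 1 + m) with hw
    have hwz : z (n + 1) = w ^ p ^ m := (pow_pow_of_succ_pow hzs _ _).symm
    have hwprim : IsPrimitiveRoot w (p ^ (n + m + 1)) := by
      have h1 := hz (n + 1 + m)
      rwa [← hw, add_right_comm] at h1
    have hdvd : p ^ m ∣ p ^ (n + m) := pow_dvd_pow p (Nat.le_add_left m n)
    have : NeZero (p ^ (n + m + 1)) := ⟨pow_ne_zero _ hp.out.ne_zero⟩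
    have hσw : IsPrimitiveRoot (σ w) (p ^ (n + m + 1)) := hwprim.map_of_injective σ.injective
    obtain ⟨c, -, hc⟩ := hwprim.eq_pow_of_pow_eq_one hσw.pow_eq_one
    rw [← hc, hwprim.pow_iff_coprime (pow_pos hp.out.pos _)] at hσw
    have hzc : z (n + 1) ^ c = z (n + 1) := by
      conv_rhs => rw [← hσn, hwz, map_pow, ← hc]
      rw [hwz, ← pow_mul, ← pow_mul, mul_comm]
    have hT : filteredEval F w (p ^ m) (expand F c f) = filteredEval F w (p ^ m) f :=
      filteredEval_expand_eq hwz hzc hσw.symm (by omega) f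
    set x := aeval w f with hx
    have hσx : σ x = aeval w (expand F c f) := by
      rw [expand_aeval, hc, hx]
      exact (hom_eval₂ f (algebraMap F M) σ w).trans
        (congrArg (fun φ => eval₂ φ (σ w) f) (RingHom.ext hσF))
    -- The trace `T` satisfies `T(σ x) = T(x)`, so `(1 - l) T(x) = T(σ x - l x)`, and `σ x - l x` is
    -- small because `σ y = l y`. Hence `T(x)` itself is small.
    have e1 : ‖(1 - algebraMap F M l) * filteredEval F w (p ^ m) f‖ ≤
        C * ((1 + ‖algebraMap F M l‖) * δ) := by
      have h1 : (1 - algebraMap F M l) * filteredEval F w (p ^ m) f =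
          filteredEval F w (p ^ m) (expand F c f - l • f) := by
        rw [map_sub, map_smul, hT, Algebra.smul_def]
        ring
      rw [h1]
      refine (norm_filteredEval_le_norm_aeval hp0 hp1 hF hwprim hdvd _).trans ?_
      refine mul_le_mul_of_nonneg_left ?_ hC0
      rw [map_sub, ← hσx, map_smul, ← hx, Algebra.smul_def]
      have h2 : σ x - algebraMap F M l * x = algebraMap F M l * (y - x) - σ (y - x) := by
        rw [map_sub, hly]
        ring
      rw [h2]
      refine (norm_sub_le _ _).trans ?_
      rw [hσ, norm_mul, add_comm, add_mul, one_mul]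
      gcongr
    rw [norm_mul] at e1
    have e2 : ‖filteredEval F w (p ^ m) f‖ ≤
        C * ((1 + ‖algebraMap F M l‖) * δ) / ‖1 - algebraMap F M l‖ := by
      rw [le_div_iff₀ hl0, mul_comm]
      exact e1
    have e3 : ‖filteredEval F w (p ^ m) f - aeval (z (n + 1)) h‖ ≤
        C * (‖y - aeval (z (n + 1)) h‖ + δ) := by
      have h1 : filteredEval F w (p ^ m) f - aeval (z (n + 1)) h =
          filteredEval F w (p ^ m) (f - expand F (p ^ m) h) := by
        rw [map_sub, filteredEval_expand, ← hwz]
      rw [h1]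
      refine (norm_filteredEval_le_norm_aeval hp0 hp1 hF hwprim hdvd _).trans ?_
      refine mul_le_mul_of_nonneg_left ?_ hC0
      rw [map_sub, expand_aeval, ← hwz, ← hx]
      have h2 : x - aeval (z (n + 1)) h = (y - aeval (z (n + 1)) h) - (y - x) := by ring
      rw [h2]
      exact (norm_sub_le _ _).trans (by gcongr)
    calc ‖aeval (z (n + 1)) h‖ = ‖filteredEval F w (p ^ m) f -
          (filteredEval F w (p ^ m) f - aeval (z (n + 1)) h)‖ := by rw [sub_sub_cancel]
      _ ≤ _ := norm_sub_le _ _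
      _ ≤ _ := by rw [add_comm]; exact add_le_add e3 e2
  have hcont : Filter.Tendsto (fun δ : ℝ => C * (‖y - aeval (z (n + 1)) h‖ + δ) +
      C * ((1 + ‖algebraMap F M l‖) * δ) / ‖1 - algebraMap F M l‖)
      (nhdsWithin 0 (Set.Ioi 0)) (nhds (C * (‖y - aeval (z (n + 1)) h‖ + 0) +
      C * ((1 + ‖algebraMap F M l‖) * 0) / ‖1 - algebraMap F M l‖)) := by
    refine (Continuous.tendsto ?_ 0).mono_left nhdsWithin_le_nhds
    fun_prop
  have := ge_of_tendsto hcont (Filter.eventually_of_mem self_mem_nhdsWithin fun δ hδ => main δ hδ)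
  simpa using this

/-- An approximant of `y` from a finite level is bounded by a constant times its distance to `y`.
The constant is the same at every level, so good approximants are small and `y = 0`. -/
theorem eq_zero_of_eigenvector_of_mem_closure (hp0 : (p : M) ≠ 0) (hp1 : ‖(p : M)‖ < 1)
    (hF : ∀ c : F, c ≠ 0 → ∃ a : ℤ, ‖algebraMap F M c‖ = ‖(p : M)‖ ^ a)
    (hz : ∀ n, IsPrimitiveRoot (z n) (p ^ n)) (hzs : ∀ n, z (n + 1) ^ p = z n)
    (y : M) (hy : ∀ ε > 0, ∃ m, ∃ f : F[X], ‖y - aeval (z m) f‖ < ε)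
    (hσ : ∀ n, ∃ σ : M →+* M, ∃ l : F, (∀ x, ‖σ x‖ = ‖x‖) ∧
      (∀ c : F, σ (algebraMap F M c) = algebraMap F M c) ∧ σ (z n) = z n ∧ l ≠ 1 ∧
      σ y = algebraMap F M l * y) : y = 0 := by
  set C := ‖(p : M)‖⁻¹ with hC
  have hppos : 0 < ‖(p : M)‖ := norm_pos_iff.2 hp0
  have hC0 : 0 < C := by positivity
  rw [← norm_le_zero_iff]
  refine le_of_forall_pos_le_add fun ε hε => ?_
  obtain ⟨m, f₀, hf₀⟩ := hy (ε / (1 + C)) (by positivity)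
  obtain ⟨f, hf⟩ : ∃ f : F[X], ‖y - aeval (z (m + 1)) f‖ < ε / (1 + C) := by
    refine ⟨expand F p f₀, ?_⟩
    rwa [expand_aeval, hzs]
  obtain ⟨σ, l, h1, h2, h3, h4, h5⟩ := hσ (m + 1)
  have h6 := norm_aeval_le_of_eigenvector hp0 hp1 hF hz hzs y hy σ h1 h2 m h3 l h4 h5 f
  calc ‖y‖ = ‖(y - aeval (z (m + 1)) f) + aeval (z (m + 1)) f‖ := by rw [sub_add_cancel]
    _ ≤ ‖y - aeval (z (m + 1)) f‖ + C * ‖y - aeval (z (m + 1)) f‖ :=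
      (norm_add_le _ _).trans (by gcongr)
    _ = ‖y - aeval (z (m + 1)) f‖ * (1 + C) := by ring
    _ ≤ ε / (1 + C) * (1 + C) := by gcongr
    _ = 0 + ε := by field_simp; ring

/-- The closure of `F(ζ_{p^∞})`. -/
noncomputable def cyclotomicClosure (F : Type*) [Field F] [Algebra F M] (z : ℕ → M) : Subfield M :=
  (⨆ n, F⟮z n⟯).toSubfield.topologicalClosure

theorem algebraMap_mem_cyclotomicClosure (c : F) : algebraMap F M c ∈ cyclotomicClosure F z :=
  Subfield.le_topologicalClosure _ ((⨆ n, F⟮z n⟯).algebraMap_mem c)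

theorem mem_cyclotomicClosure (n : ℕ) : z n ∈ cyclotomicClosure F z :=
  Subfield.le_topologicalClosure _ (le_iSup (fun n => F⟮z n⟯) n (mem_adjoin_simple_self F (z n)))

theorem exists_norm_sub_aeval_lt (hzs : ∀ n, z (n + 1) ^ p = z n)
    (hz : ∀ n, IsPrimitiveRoot (z n) (p ^ n)) (y : M) (hy : y ∈ cyclotomicClosure F z) (ε : ℝ)
    (hε : 0 < ε) : ∃ m, ∃ f : F[X], ‖y - aeval (z m) f‖ < ε := by
  obtain ⟨x, hx, hxy⟩ := Metric.mem_closure_iff.1 hy ε hε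
  obtain ⟨m, f, rfl⟩ := exists_aeval_of_mem_iSup_adjoin hzs hz x hx
  exact ⟨m, f, by rwa [← dist_eq_norm]⟩

theorem map_mem_cyclotomicClosure (hzs : ∀ n, z (n + 1) ^ p = z n)
    (hz : ∀ n, IsPrimitiveRoot (z n) (p ^ n)) (σ : M →+* M) (hσ : ∀ x, ‖σ x‖ = ‖x‖)
    (hσF : ∀ c : F, σ (algebraMap F M c) = algebraMap F M c) (y : M)
    (hy : y ∈ cyclotomicClosure F z) : σ y ∈ cyclotomicClosure F z := by
  refine Metric.mem_closure_iff.2 fun ε hε => ?_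
  obtain ⟨m, f, hf⟩ := exists_norm_sub_aeval_lt hzs hz y hy ε hε
  refine ⟨σ (aeval (z m) f), ?_, by rwa [dist_eq_norm, ← map_sub, hσ]⟩
  have h1 : σ (aeval (z m) f) = aeval (σ (z m)) f :=
    (hom_eval₂ f (algebraMap F M) σ (z m)).trans
        (congrArg (fun φ => eval₂ φ (σ (z m)) f) (RingHom.ext hσF))
  have : NeZero (p ^ m) := ⟨pow_ne_zero _ hp.out.ne_zero⟩
  obtain ⟨c, -, hc⟩ := (hz m).eq_pow_of_pow_eq_one
    ((hz m).map_of_injective (f := σ) σ.injective).pow_eq_one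
  rw [h1, ← hc]
  have h2 : z m ^ c ∈ ⨆ n, F⟮z n⟯ :=
    pow_mem (le_iSup (fun n => F⟮z n⟯) m (mem_adjoin_simple_self F (z m))) c
  exact Algebra.adjoin_le (S := (⨆ n, F⟮z n⟯).toSubalgebra) (Set.singleton_subset_iff.2 h2)
    (aeval_mem_adjoin_singleton F _)

/-- A common eigenvector, algebraic over the closure of `F(ζ_{p^∞})`, of isometries fixing `F`
vanishes if the eigenvalues lie in `F` and, on each stabilizer of `ζ_{p^n}`, have no common
order. -/
theorem eq_zero_of_eigenvector_of_isIntegral (hp0 : (p : M) ≠ 0) (hp1 : ‖(p : M)‖ < 1)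
    (hF : ∀ c : F, c ≠ 0 → ∃ a : ℤ, ‖algebraMap F M c‖ = ‖(p : M)‖ ^ a)
    (hz : ∀ n, IsPrimitiveRoot (z n) (p ^ n)) (hzs : ∀ n, z (n + 1) ^ p = z n)
    (y : M) (hy : IsIntegral (cyclotomicClosure F z) y)
    (hσ : ∀ n, ∀ D ≠ 0, ∃ σ : M →+* M, ∃ l : F, (∀ x, ‖σ x‖ = ‖x‖) ∧
      (∀ c : F, σ (algebraMap F M c) = algebraMap F M c) ∧ σ (z n) = z n ∧ l ≠ 0 ∧ l ^ D ≠ 1 ∧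
      σ y = algebraMap F M l * y) : y = 0 := by
  set P := minpoly (cyclotomicClosure F z) y with hP
  have hd : P.natDegree ≠ 0 := (minpoly.natDegree_pos hy).ne'
  have h0 : ((P.coeff 0 : cyclotomicClosure F z) : M) = 0 := by
    refine eq_zero_of_eigenvector_of_mem_closure hp0 hp1 hF hz hzs _
      (exists_norm_sub_aeval_lt hzs hz _ (P.coeff 0).2) fun n => ?_
    obtain ⟨σ, l, h1, h2, h3, h4, h5, h6⟩ := hσ n P.natDegree hd
    refine ⟨σ, l ^ P.natDegree, h1, h2, h3, h5, ?_⟩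
    let σL : cyclotomicClosure F z →+* cyclotomicClosure F z :=
      (σ.comp (cyclotomicClosure F z).subtype).codRestrict (cyclotomicClosure F z)
        fun x => map_mem_cyclotomicClosure hzs hz σ h1 h2 x x.2
    let lL : cyclotomicClosure F z := ⟨algebraMap F M l, algebraMap_mem_cyclotomicClosure l⟩
    have hlL : lL ≠ 0 := fun h => h4 ((algebraMap F M).injective
      ((congrArg Subtype.val h).trans (map_zero _).symm))
    -- Applying `σ` to the coefficients of `P` and scaling the roots by `l⁻¹` gives a monic
    -- polynomial of the same degree vanishing at `l⁻¹ σ(y) = y`. It must be `P`, so the constant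
    -- term of `P` is an eigenvector with eigenvalue `l^(deg P)`.
    let Q := scaleRoots (P.map σL) lL⁻¹
    have hmonP : P.Monic := minpoly.monic hy
    have hdegQ : Q.natDegree = P.natDegree := by
      rw [natDegree_scaleRoots, natDegree_map]
    have hmonQ : Q.Monic := (monic_scaleRoots_iff _).2 (hmonP.map σL)
    have hσy : aeval (σ y) (P.map σL) = 0 := by
      have h7 : aeval y P = 0 := minpoly.aeval _ _
      have h8 := congrArg σ h7
      rw [map_zero, aeval_def, hom_eval₂] at h8
      rw [aeval_def, eval₂_map]
      exact h8
    have hQ : aeval y Q = 0 := by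
      have h7 : y = algebraMap (cyclotomicClosure F z) M lL⁻¹ * σ y := by
        rw [h6, map_inv₀]
        have h8 : algebraMap (cyclotomicClosure F z) M lL ≠ 0 :=
          (_root_.map_ne_zero _).2 hlL
        exact (inv_mul_cancel_left₀ h8 y).symm
      conv_lhs => rw [h7]
      exact scaleRoots_aeval_eq_zero hσy
    have hPQ : Q = P := by
      refine minpoly.unique_of_degree_le_degree_minpoly _ y hmonQ hQ ?_
      rw [degree_eq_natDegree hmonQ.ne_zero, hdegQ, degree_eq_natDegree hmonP.ne_zero]
    have h7 : σL (P.coeff 0) = lL ^ P.natDegree * P.coeff 0 := by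
      have h8 : Q.coeff 0 = σL (P.coeff 0) * lL⁻¹ ^ P.natDegree := by
        rw [coeff_scaleRoots, coeff_map, natDegree_map, Nat.sub_zero]
      rw [hPQ] at h8
      conv_rhs => rw [h8]
      rw [inv_pow, mul_comm, inv_mul_cancel_right₀ (pow_ne_zero _ hlL)]
    rw [map_pow]
    exact congrArg Subtype.val h7
  exact (minpoly.coeff_zero_eq_zero hy).1 (Subtype.ext h0)

end Eigenvectors

/-! ### Divisibility in Witt vectors, tested modulo `p`. -/

section WittDivisibility
variable {p : ℕ} [hp : Fact p.Prime] {R : Type*} [CommRing R] [CharP R p] [PerfectRing R p]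

theorem WittVector.p_dvd_iff_coeff_zero (x : WittVector p R) :
    (p : WittVector p R) ∣ x ↔ x.coeff 0 = 0 := by
  rw [← Ideal.mem_span_singleton, WittVector.mem_span_p_iff_coeff_zero_eq_zero]

theorem WittVector.eq_zero_of_forall_p_pow_dvd (x : WittVector p R)
    (hx : ∀ n, (p : WittVector p R) ^ n ∣ x) : x = 0 := by
  refine (WittVector.isAdicCompleteIdealSpanP (p := p) (k := R)).haus' _ fun n => ?_
  rw [SModEq.sub_mem, smul_eq_mul, Ideal.mul_top, Ideal.span_singleton_pow,
    Ideal.mem_span_singleton, sub_zero]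
  exact hx n

theorem WittVector.exists_limit (s : ℕ → WittVector p R)
    (hs : ∀ n, (p : WittVector p R) ^ n ∣ s (n + 1) - s n) :
    ∃ L, ∀ n, (p : WittVector p R) ^ n ∣ s n - L := by
  have hc : ∀ m n, m ≤ n → (p : WittVector p R) ^ m ∣ s n - s m := by
    intro m n hmn
    induction n, hmn using Nat.le_induction with
    | base => simp
    | succ n hmn ih => simpa using dvd_add ((pow_dvd_pow _ hmn).trans (hs n)) ih
  obtain ⟨L, hL⟩ := (WittVector.isAdicCompleteIdealSpanP (p := p) (k := R)).prec'
    (f := s) (fun {m n} hmn => by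
      rw [SModEq.sub_mem, smul_eq_mul, Ideal.mul_top, Ideal.span_singleton_pow,
        Ideal.mem_span_singleton, ← dvd_neg, neg_sub]
      exact hc m n hmn)
  refine ⟨L, fun n => ?_⟩
  have := hL n
  rwa [SModEq.sub_mem, smul_eq_mul, Ideal.mul_top, Ideal.span_singleton_pow,
    Ideal.mem_span_singleton] at this

/-- A `p`-saturated ideal of `W(R)` is generated by an element of it whose reduction divides the
reductions of all elements. -/
theorem WittVector.dvd_of_mem_of_coeff_zero_dvd (J : Ideal (WittVector p R)) (m : WittVector p R)
    (hm : m ∈ J) (hJ : ∀ b, (p : WittVector p R) * b ∈ J → b ∈ J)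
    (hdvd : ∀ x ∈ J, m.coeff 0 ∣ x.coeff 0) (x : WittVector p R) (hx : x ∈ J) : m ∣ x := by
  -- Divide modulo `p`. The remainder is `p b` and lies in `J`, so saturation puts `b` back in `J`
  -- and the division can be iterated. The quotients sum to a `p`-adically convergent series.
  have hstep : ∀ y : J, ∃ a : WittVector p R, ∃ b : J, (y : WittVector p R) = m * a + p * b := by
    rintro ⟨y, hy⟩
    obtain ⟨a, ha⟩ := hdvd y hy
    have h1 : (p : WittVector p R) ∣ y - m * WittVector.teichmuller p a := by
      rw [WittVector.p_dvd_iff_coeff_zero]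
      change WittVector.constantCoeff (y - m * WittVector.teichmuller p a) = 0
      rw [map_sub, map_mul]
      show y.coeff 0 - m.coeff 0 * (WittVector.teichmuller p a).coeff 0 = 0
      rw [WittVector.teichmuller_coeff_zero, ha, sub_self]
    obtain ⟨b, hb⟩ := h1
    refine ⟨_, ⟨b, hJ b ?_⟩, eq_add_of_sub_eq' hb⟩
    rw [← hb]
    exact J.sub_mem hy (J.mul_mem_right _ hm)
  choose a b hab using hstep
  let y : ℕ → J := fun n => b^[n] ⟨x, hx⟩
  have hy : ∀ n, (y n : WittVector p R) = m * a (y n) + p * y (n + 1) := fun n => by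
    simp only [y, Function.iterate_succ_apply']
    exact hab _
  let s : ℕ → WittVector p R := fun n => ∑ k ∈ Finset.range n, (p : WittVector p R) ^ k * a (y k)
  have hs : ∀ n, x - m * s n = (p : WittVector p R) ^ n * y n := by
    intro n
    induction n with
    | zero => simp [s, y]
    | succ n ih =>
      have h1 : s (n + 1) = s n + (p : WittVector p R) ^ n * a (y n) := Finset.sum_range_succ _ _
      rw [h1, mul_add, ← sub_sub, ih, hy n]
      ring
  obtain ⟨L, hL⟩ := WittVector.exists_limit s fun n => by
    have h1 : s (n + 1) = s n + (p : WittVector p R) ^ n * a (y n) := Finset.sum_range_succ _ _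
    rw [h1, add_sub_cancel_left]
    exact dvd_mul_right _ _
  refine ⟨L, sub_eq_zero.1 (WittVector.eq_zero_of_forall_p_pow_dvd _ fun n => ?_)⟩
  have h1 : x - m * L = (x - m * s n) + m * (s n - L) := by ring
  rw [h1, hs]
  exact dvd_add (dvd_mul_right _ _) ((hL n).mul_left m)

end WittDivisibility

/-! ### The untilt, Fontaine's `θ` and their functoriality. -/

section Untilt
variable {O : Type*} [CommRing O] {p : ℕ} [hp : Fact p.Prime] [Fact (¬ IsUnit (p : O))]
  [IsAdicComplete (Ideal.span {(p : O)}) O]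

theorem PreTilt.mk_untilt_frobeniusEquiv_symm_iterate (x : PreTilt O p) (n : ℕ) :
    Ideal.Quotient.mk (Ideal.span {(p : O)})
      (PreTilt.untilt ((frobeniusEquiv (PreTilt O p) p).symm^[n] x)) = PreTilt.coeff n x := by
  rw [PreTilt.mk_untilt_eq_coeff_zero, PreTilt.coeff_iterate_frobeniusEquiv_symm, zero_add]

/-- Two lifts congruent modulo `p` have `p^n`-th powers congruent modulo `p^(n+1)`, so any lifts of
the components compute the untilt. -/
theorem PreTilt.untilt_eq (x : PreTilt O p) (c : ℕ → O) (y : O)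
    (hc : ∀ n, Ideal.Quotient.mk (Ideal.span {(p : O)}) (c n) = PreTilt.coeff n x)
    (hy : ∀ n, c n ^ p ^ n = y) : PreTilt.untilt x = y := by
  rw [← sub_eq_zero]
  refine IsHausdorff.haus (I := Ideal.span {(p : O)}) inferInstance _ fun n => ?_
  rw [SModEq.sub_mem, smul_eq_mul, Ideal.mul_top, Ideal.span_singleton_pow,
    Ideal.mem_span_singleton, sub_zero]
  have h1 : (p : O) ∣ PreTilt.untilt ((frobeniusEquiv (PreTilt O p) p).symm^[n] x) - c n := by
    rw [← Ideal.mem_span_singleton, ← Ideal.Quotient.eq, hc,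
      PreTilt.mk_untilt_frobeniusEquiv_symm_iterate]
  have h2 := dvd_sub_pow_of_dvd_sub h1 n
  rw [PreTilt.untilt_iterate_frobeniusEquiv_symm_pow, hy] at h2
  exact (pow_dvd_pow _ n.le_succ).trans h2

theorem untilt_tiltOfSeq (c : ℕ → O) (hc : ∀ n, c (n + 1) ^ p = c n) :
    PreTilt.untilt (tiltOfSeq (p := p) c hc) = c 0 :=
  PreTilt.untilt_eq _ c _ (fun _ => rfl) fun n => by
    simpa using pow_pow_of_succ_pow hc 0 n

theorem untilt_tiltMap (f : O →+* O) (x : PreTilt O p) :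
    PreTilt.untilt (tiltMap f x) = f (PreTilt.untilt x) :=
  PreTilt.untilt_eq _
    (fun n => f (PreTilt.untilt ((frobeniusEquiv (PreTilt O p) p).symm^[n] x))) _
    (fun n => by
      rw [coeff_tiltMap, ← PreTilt.mk_untilt_frobeniusEquiv_symm_iterate]
      rfl)
    fun n => by rw [← map_pow, PreTilt.untilt_iterate_frobeniusEquiv_symm_pow]

/-- Modulo `p^n`, ring homomorphisms out of the Witt vectors are determined by Teichmüller elements,
where the claim is functoriality of the untilt. -/
theorem fontaineTheta_map_tiltMap (f : O →+* O) (x : WittVector p (PreTilt O p)) :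
    WittVector.fontaineTheta O p (WittVector.map (tiltMap f) x) =
      f (WittVector.fontaineTheta O p x) := by
  rw [← sub_eq_zero]
  refine IsHausdorff.haus (I := Ideal.span {(p : O)}) inferInstance _ fun n => ?_
  rw [SModEq.zero, smul_eq_mul, Ideal.mul_top, ← Ideal.Quotient.eq_zero_iff_mem, map_sub,
    sub_eq_zero]
  refine RingHom.congr_fun (f := ((Ideal.Quotient.mk (Ideal.span {(p : O)} ^ n)).comp
    (WittVector.fontaineTheta O p)).comp (WittVector.map (tiltMap f)))
    (g := (Ideal.Quotient.mk (Ideal.span {(p : O)} ^ n)).comp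
      (f.comp (WittVector.fontaineTheta O p))) ?_ x
  refine WittVector.eq_of_apply_teichmuller_eq _ _ ⟨n, ?_⟩ fun y => ?_
  · rw [← map_natCast (Ideal.Quotient.mk (Ideal.span {(p : O)} ^ n)), ← map_pow,
      Ideal.Quotient.eq_zero_iff_mem]
    exact Ideal.pow_mem_pow (Ideal.mem_span_singleton_self _) _
  · simp [WittVector.map_teichmuller, untilt_tiltMap]

variable (O p) in
/-- The composition of Fontaine's `θ` with the `r`-th power of Frobenius. -/
noncomputable def thetaFrob (r : ℕ) : WittVector p (PreTilt O p) →+* O :=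
  (WittVector.fontaineTheta O p).comp (WittVector.map (iterateFrobenius (PreTilt O p) p r))

theorem thetaFrob_teichmuller (r : ℕ) (x : PreTilt O p) :
    thetaFrob O p r (WittVector.teichmuller p x) = PreTilt.untilt x ^ p ^ r := by
  rw [thetaFrob, RingHom.comp_apply, WittVector.map_teichmuller,
    WittVector.fontaineTheta_teichmuller, iterateFrobenius_def, map_pow]

theorem thetaFrob_zero (x : WittVector p (PreTilt O p)) :
    thetaFrob O p 0 x = WittVector.fontaineTheta O p x := by
  have h : WittVector.map (iterateFrobenius (PreTilt O p) p 0) x = x := WittVector.ext fun n => by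
    rw [WittVector.map_coeff, iterateFrobenius_zero_apply]
  rw [thetaFrob, RingHom.comp_apply, h]

theorem thetaFrob_map_frobenius (r : ℕ) (x : WittVector p (PreTilt O p)) :
    thetaFrob O p r (WittVector.map (frobenius (PreTilt O p) p) x) = thetaFrob O p (r + 1) x := by
  rw [thetaFrob, thetaFrob, RingHom.comp_apply, RingHom.comp_apply]
  congr 1
  refine WittVector.ext fun n => ?_
  rw [WittVector.map_coeff, WittVector.map_coeff, WittVector.map_coeff, iterateFrobenius_def,
    iterateFrobenius_def, frobenius_def, ← pow_mul, pow_succ']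

theorem thetaFrob_map_tiltMap (r : ℕ) (f : O →+* O) (x : WittVector p (PreTilt O p)) :
    thetaFrob O p r (WittVector.map (tiltMap f) x) = f (thetaFrob O p r x) := by
  rw [thetaFrob, RingHom.comp_apply, RingHom.comp_apply, ← fontaineTheta_map_tiltMap]
  congr 1
  refine WittVector.ext fun n => ?_
  simp only [WittVector.map_coeff, iterateFrobenius_def, map_pow]

end Untilt

/-! ### The value of `g(μ) / μ` under `θ ∘ φ^r`. -/

section Eigenvalue
variable {O : Type*} [CommRing O] {p : ℕ} [hp : Fact p.Prime] [Fact (¬ IsUnit (p : O))]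
  [IsAdicComplete (Ideal.span {(p : O)}) O]

theorem exists_one_add_pow_eq {R : Type*} [CommRing R] (x : R) (n : ℕ) :
    ∃ s, (1 + x) ^ n = 1 + n * x + x ^ 2 * s := by
  induction n with
  | zero => exact ⟨0, by simp⟩
  | succ n ih =>
    obtain ⟨s, hs⟩ := ih
    exact ⟨n + s * (1 + x), by rw [pow_succ, hs]; push_cast; ring⟩

theorem thetaFrob_teichmuller_sub_one (z : ℕ → O) (hz : ∀ n, z (n + 1) ^ p = z n)
    (hz0 : z 0 = 1) (r : ℕ) :
    thetaFrob O p r (WittVector.teichmuller p (tiltOfSeq z hz) - 1) = 0 := by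
  rw [map_sub, map_one, thetaFrob_teichmuller, untilt_tiltOfSeq, hz0, one_pow, sub_self]

/-- If `f` raises `ζ_{p^N}` to the power `c`, then `f(μ) / μ` is congruent to `c` modulo `p^N`
under `θ ∘ φ^r`. -/
theorem pow_dvd_thetaFrob_sub [IsDomain O] [IsDomain (PreTilt O p)] (z : ℕ → O) (hz : ∀ n, z (n + 1) ^ p = z n)
    (hprim : ∀ n, IsPrimitiveRoot (z n) (p ^ n)) (hp0 : (p : O) ≠ 0) (f : O →+* O)
    (u : WittVector p (PreTilt O p))
    (hu : WittVector.map (tiltMap f) (WittVector.teichmuller p (tiltOfSeq z hz) - 1) =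
      u * (WittVector.teichmuller p (tiltOfSeq z hz) - 1))
    (N c : ℕ) (hc : f (z N) = z N ^ c) (r : ℕ) : (p : O) ^ N ∣ thetaFrob O p r u - c := by
  have hz0 : z 0 = 1 := by simpa using (hprim 0).pow_eq_one
  set μ := WittVector.teichmuller p (tiltOfSeq z hz) - 1 with hμ
  have hμ0 : μ ≠ 0 := by
    intro h
    refine tiltOfSeq_ne_one z hz hprim hp0 ?_
    have h2 := congrArg (fun x => WittVector.coeff x 0) (sub_eq_zero.1 h)
    simpa using h2
  -- `b` is a natural number congruent to `-c` modulo `p^N`. It makes `f(ε) ε^b` a `p^N`-th power of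
  -- a sequence `d` that again starts at `1`, so `[d] - 1 = μ t`.
  set b := c * (p ^ N - 1) with hb
  let d : ℕ → O := fun n => f (z (n + N)) * z (n + N) ^ b
  have hfz : ∀ n, f (z (n + 1)) ^ p = f (z n) := fun n => by rw [← map_pow, hz]
  have hd : ∀ n, d (n + 1) ^ p = d n := fun n => by
    simp only [d]
    rw [show n + 1 + N = n + N + 1 by ring, mul_pow, hfz, ← pow_mul, mul_comm b, pow_mul, hz]
  have hd0 : d 0 = 1 := by
    simp only [d, zero_add]
    rw [hc, ← pow_add, hb, show c + c * (p ^ N - 1) = p ^ N * c by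
      obtain ⟨t, ht⟩ := Nat.exists_eq_add_of_le (Nat.one_le_pow N p hp.out.pos)
      rw [ht, Nat.add_sub_cancel_left]; ring,
      pow_mul, (hprim N).pow_eq_one, one_pow]
  obtain ⟨t, ht⟩ := teichmuller_sub_one_dvd z d hz hd hprim hd0 hp0
  rw [← hμ] at ht
  have hmul : tiltMap f (tiltOfSeq (p := p) z hz) * tiltOfSeq z hz ^ b =
      tiltOfSeq d hd ^ p ^ N := by
    refine tilt_ext fun n => ?_
    rw [tiltMap_tiltOfSeq, map_mul, map_pow, map_pow, coeff_tiltOfSeq, coeff_tiltOfSeq,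
      coeff_tiltOfSeq, ← map_pow, ← map_pow, ← map_mul]
    simp only [d]
    rw [mul_pow, ← map_pow, pow_pow_of_succ_pow hz, ← pow_mul (z (n + N)), mul_comm b,
      pow_mul (z (n + N)), pow_pow_of_succ_pow hz]
  have hW := congrArg (WittVector.teichmuller p) hmul
  rw [map_mul, map_pow, map_pow] at hW
  have h1 : WittVector.teichmuller p (tiltMap f (tiltOfSeq (p := p) z hz)) = 1 + u * μ := by
    rw [← hu, hμ, map_sub, map_one, WittVector.map_teichmuller]
    ring
  have h2 : WittVector.teichmuller p (tiltOfSeq (p := p) z hz) = 1 + μ := by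
    rw [hμ]
    ring
  have h3 : WittVector.teichmuller p (tiltOfSeq (p := p) d hd) = 1 + μ * t := by
    rw [← ht]
    ring
  obtain ⟨s, hs⟩ := exists_one_add_pow_eq μ b
  obtain ⟨s', hs'⟩ := exists_one_add_pow_eq (μ * t) (p ^ N)
  rw [h1, h2, h3, hs, hs'] at hW
  -- Compare the terms of first order in `μ` in `(1 + u μ)(1 + μ)^b = (1 + μ t)^(p^N)`. Since `θ ∘
  -- φ^r` kills `μ`, this gives `u ≡ -b ≡ c` modulo `p^N` after applying it.
  have h4 : u + b - (p ^ N : ℕ) * t = μ * (t ^ 2 * s' - s - u * b - u * μ * s) := by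
    apply mul_left_cancel₀ hμ0
    linear_combination hW
  have h5 := congrArg (thetaFrob O p r) h4
  rw [map_mul, hμ, thetaFrob_teichmuller_sub_one z hz hz0, zero_mul, map_sub, map_add, map_mul,
    map_natCast, map_natCast] at h5
  refine ⟨thetaFrob O p r t - c, ?_⟩
  have h6 : ((b : ℕ) : O) = c * (p ^ N - 1) := by
    rw [hb, Nat.cast_mul, Nat.cast_sub (Nat.one_le_pow N p hp.out.pos)]
    push_cast
    ring
  rw [h6] at h5
  push_cast at h5
  linear_combination h5

end Eigenvalue

/-! ### Divisibility and completeness in the valuation ring of an ultrametric field. -/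

section UnitBall
variable {V : Type*} [NormedField V] [IsUltrametricDist V]

/-- The valuation ring of an ultrametric normed field. -/
noncomputable abbrev unitBall (V : Type*) [NormedField V] [IsUltrametricDist V] :
    ValuationSubring V :=
  (NormedField.valuation (K := V)).valuationSubring

theorem norm_unitBall_le (x : unitBall V) : ‖(x : V)‖ ≤ 1 := x.2

theorem unitBall_dvd_of_norm_le {x y : unitBall V} (hy : y ≠ 0) (h : ‖(x : V)‖ ≤ ‖(y : V)‖) :
    y ∣ x := by
  have hy' : (y : V) ≠ 0 := fun h => hy (Subtype.ext h)
  have h1 : ‖(x : V) / y‖ ≤ 1 := by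
    rw [norm_div]
    exact div_le_one_of_le₀ h (norm_nonneg _)
  exact ⟨⟨(x : V) / y, h1⟩, Subtype.ext (mul_div_cancel₀ _ hy').symm⟩

theorem norm_le_of_unitBall_dvd {x y : unitBall V} (h : y ∣ x) : ‖(x : V)‖ ≤ ‖(y : V)‖ := by
  obtain ⟨c, rfl⟩ := h
  show ‖(y : V) * c‖ ≤ _
  rw [norm_mul]
  exact mul_le_of_le_one_right (norm_nonneg _) (norm_unitBall_le c)

theorem not_isUnit_unitBall {x : unitBall V} (hx : ‖(x : V)‖ < 1) : ¬ IsUnit x := by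
  intro h
  have h1 := norm_le_of_unitBall_dvd (h.dvd (a := 1))
  rw [OneMemClass.coe_one, norm_one] at h1
  exact absurd hx (not_lt.2 h1)

theorem isAdicComplete_unitBall [CompleteSpace V] {a : unitBall V} (ha0 : a ≠ 0)
    (ha1 : ‖(a : V)‖ < 1) : IsAdicComplete (Ideal.span {a}) (unitBall V) := by
  have hmem : ∀ (n : ℕ) (x y : unitBall V),
      x ≡ y [SMOD (Ideal.span {a} ^ n • ⊤ : Ideal (unitBall V))] ↔
        ‖(x : V) - y‖ ≤ ‖(a : V)‖ ^ n := by
    intro n x y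
    rw [SModEq.sub_mem, smul_eq_mul, Ideal.mul_top, Ideal.span_singleton_pow,
      Ideal.mem_span_singleton]
    have h1 : ‖((a ^ n : unitBall V) : V)‖ = ‖(a : V)‖ ^ n := by
      rw [← norm_pow]; rfl
    constructor
    · intro h
      rw [← h1]
      exact norm_le_of_unitBall_dvd h
    · intro h
      rw [← h1] at h
      exact unitBall_dvd_of_norm_le (pow_ne_zero n ha0) h
  have hlim := tendsto_pow_atTop_nhds_zero_of_lt_one (norm_nonneg (a : V)) ha1
  refine { haus' := fun x hx => ?_, prec' := fun {f} hf => ?_ }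
  · refine Subtype.ext (norm_le_zero_iff.1 (ge_of_tendsto' hlim fun n => ?_))
    simpa using (hmem n x 0).1 (hx n)
  · have hcau : CauchySeq fun n => (f n : V) := by
      refine cauchySeq_of_le_tendsto_0' (fun n => ‖(a : V)‖ ^ n) (fun n m hnm => ?_) hlim
      rw [dist_eq_norm]
      exact (hmem _ _ _).1 (hf hnm)
    obtain ⟨L, hL⟩ := cauchySeq_tendsto_of_complete hcau
    refine ⟨⟨L, le_of_tendsto' hL.norm fun n => norm_unitBall_le (f n)⟩, fun n => ?_⟩
    rw [hmem]
    have h1 := (tendsto_const_nhds (x := (f n : V))).sub hL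
    refine le_of_tendsto h1.norm (Filter.eventually_atTop.2 ⟨n, fun m hm => ?_⟩)
    exact (hmem _ _ _).1 (hf hm)

end UnitBall

/-! ### The absolute value of the tilt and the kernels of `θ ∘ φ^r`. -/

section TiltNorm
variable {V : Type*} [NormedField V] [IsUltrametricDist V] {p : ℕ} [hp : Fact p.Prime]
  [Fact (¬ IsUnit (p : unitBall V))] [IsAdicComplete (Ideal.span {(p : unitBall V)}) (unitBall V)]

/-- The absolute value on the tilt. -/
noncomputable def tiltNorm (x : PreTilt (unitBall V) p) : ℝ := ‖((PreTilt.untilt x : unitBall V) : V)‖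

theorem tiltNorm_mul (x y : PreTilt (unitBall V) p) :
    tiltNorm (x * y) = tiltNorm x * tiltNorm y := by
  rw [tiltNorm, map_mul]
  exact norm_mul _ _

theorem tiltNorm_pow (x : PreTilt (unitBall V) p) (n : ℕ) : tiltNorm (x ^ n) = tiltNorm x ^ n := by
  rw [tiltNorm, map_pow]
  exact norm_pow _ _

theorem tiltNorm_nonneg (x : PreTilt (unitBall V) p) : 0 ≤ tiltNorm x := norm_nonneg _

theorem tiltNorm_le_one (x : PreTilt (unitBall V) p) : tiltNorm x ≤ 1 := norm_unitBall_le _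

theorem tiltNorm_frobeniusEquiv_symm_iterate (x : PreTilt (unitBall V) p) (n : ℕ) :
    tiltNorm ((frobeniusEquiv (PreTilt (unitBall V) p) p).symm^[n] x) ^ p ^ n = tiltNorm x := by
  conv_rhs => rw [tiltNorm, ← PreTilt.untilt_iterate_frobeniusEquiv_symm_pow x n]
  exact (norm_pow _ _).symm

theorem tiltNorm_zero : tiltNorm (0 : PreTilt (unitBall V) p) = 0 := by
  rw [tiltNorm, PreTilt.untilt_eq (0 : PreTilt (unitBall V) p) (fun _ => 0) 0
    (fun n => by rw [map_zero, map_zero])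
    (fun n => zero_pow (pow_ne_zero _ hp.out.ne_zero))]
  exact norm_zero

theorem tiltNorm_eq_zero {x : PreTilt (unitBall V) p} (h : tiltNorm x = 0) : x = 0 := by
  refine tilt_ext fun n => ?_
  have h1 := tiltNorm_frobeniusEquiv_symm_iterate x n
  rw [h] at h1
  have h2 : PreTilt.untilt ((frobeniusEquiv (PreTilt (unitBall V) p) p).symm^[n] x) = 0 :=
    Subtype.ext (norm_eq_zero.1 (eq_zero_of_pow_eq_zero h1))
  rw [← PreTilt.mk_untilt_frobeniusEquiv_symm_iterate, h2, map_zero, map_zero]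

theorem tiltNorm_le_of_coeff_zero_eq_zero {x : PreTilt (unitBall V) p}
    (hx : PreTilt.coeff 0 x = 0) : tiltNorm x ≤ ‖(p : V)‖ := by
  rw [← PreTilt.mk_untilt_eq_coeff_zero, Ideal.Quotient.eq_zero_iff_dvd] at hx
  exact norm_le_of_unitBall_dvd hx

/-- The tilt behaves as a valuation ring: the untilts of the `p^n`-th roots can be divided in `V`,
and the quotients are again compatible under `p`-th powers. -/
theorem tilt_dvd_of_tiltNorm_le {x y : PreTilt (unitBall V) p} (hy : y ≠ 0)
    (h : tiltNorm x ≤ tiltNorm y) : y ∣ x := by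
  let X : ℕ → unitBall V := fun n =>
    PreTilt.untilt ((frobeniusEquiv (PreTilt (unitBall V) p) p).symm^[n] x)
  let Y : ℕ → unitBall V := fun n =>
    PreTilt.untilt ((frobeniusEquiv (PreTilt (unitBall V) p) p).symm^[n] y)
  have hsucc : ∀ (w : PreTilt (unitBall V) p) (n : ℕ),
      PreTilt.untilt ((frobeniusEquiv (PreTilt (unitBall V) p) p).symm^[n + 1] w) ^ p =
        PreTilt.untilt ((frobeniusEquiv (PreTilt (unitBall V) p) p).symm^[n] w) := fun w n => by
    rw [← map_pow, Function.iterate_succ_apply', ← frobenius_def,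
      frobenius_apply_frobeniusEquiv_symm]
  have hY0 : ∀ n, Y n ≠ 0 := fun n hn => by
    refine hy (tiltNorm_eq_zero ?_)
    rw [← tiltNorm_frobeniusEquiv_symm_iterate y n]
    have : tiltNorm ((frobeniusEquiv (PreTilt (unitBall V) p) p).symm^[n] y) = 0 :=
      (congrArg (fun w : unitBall V => ‖(w : V)‖) hn).trans norm_zero
    rw [this, zero_pow (pow_ne_zero _ hp.out.ne_zero)]
  have hdvd : ∀ n, Y n ∣ X n := fun n => by
    refine unitBall_dvd_of_norm_le (hY0 n) ?_
    rw [← tiltNorm_frobeniusEquiv_symm_iterate x n, ← tiltNorm_frobeniusEquiv_symm_iterate y n] at h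
    exact (pow_le_pow_iff_left₀ (tiltNorm_nonneg _) (tiltNorm_nonneg _)
      (pow_ne_zero _ hp.out.ne_zero)).1 h
  choose c hc using hdvd
  have hcc : ∀ n, c (n + 1) ^ p = c n := fun n => by
    apply mul_left_cancel₀ (hY0 n)
    have hYs : Y (n + 1) ^ p = Y n := hsucc y n
    have hXs : X (n + 1) ^ p = X n := hsucc x n
    rw [← hc n]
    nth_rw 1 [← hYs]
    rw [← mul_pow, ← hc (n + 1), hXs]
  refine ⟨tiltOfSeq c hcc, tilt_ext fun n => ?_⟩
  rw [map_mul, coeff_tiltOfSeq, ← PreTilt.mk_untilt_frobeniusEquiv_symm_iterate,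
    ← PreTilt.mk_untilt_frobeniusEquiv_symm_iterate, ← map_mul]
  exact congrArg _ (hc n)

variable (z : ℕ → unitBall V) (hz : ∀ n, z (n + 1) ^ p = z n)
  (hprim : ∀ n, IsPrimitiveRoot (z n) (p ^ n))
include hprim

/-- This says `|ε - 1| = |p|^(p/(p-1))`. The untilt of `ε^(1/p²) - 1` is congruent to `ζ_{p²} - 1`
modulo `p`, and `ζ_{p²} - 1` is strictly larger than `p`. With `ζ_p` the strict inequality would
fail for `p = 2`. -/
theorem tiltNorm_tiltOfSeq_sub_one_pow (hp0 : (p : V) ≠ 0) (hp1 : ‖(p : V)‖ < 1) :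
    tiltNorm (tiltOfSeq (p := p) z hz - 1) ^ (p - 1) = ‖(p : V)‖ ^ p := by
  have hshift : ∀ n, z (n + 1 + 2) ^ p = z (n + 2) := fun n => by
    rw [add_right_comm]; exact hz _
  let e : PreTilt (unitBall V) p := tiltOfSeq (fun n => z (n + 2)) hshift
  have he : e ^ p ^ 2 = tiltOfSeq z hz := tilt_ext fun n => by
    rw [map_pow, coeff_tiltOfSeq, coeff_tiltOfSeq, ← map_pow, pow_pow_of_succ_pow hz]
  have hprim2 : IsPrimitiveRoot (z 2 : V) (p ^ (1 + 1)) :=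
    (hprim 2).map_of_injective (f := (unitBall V).subtype) Subtype.val_injective
  have hr := hprim2.norm_sub_one_pow_totient
  have htot : (p ^ (1 + 1)).totient = p * (p - 1) := by
    rw [Nat.totient_prime_pow_succ hp.out, pow_one]
  rw [htot] at hr
  have hr1 : ‖(z 2 : V) - 1‖ ≤ 1 := norm_unitBall_le (z 2 - 1)
  have hp2 := hp.out.two_le
  have hlt : ‖(p : V)‖ < ‖(z 2 : V) - 1‖ := by
    have hlt1 : ‖(z 2 : V) - 1‖ < 1 := by
      refine lt_of_le_of_ne hr1 fun h => ?_
      rw [h, one_pow] at hr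
      exact hp1.ne' hr
    have h0 : 0 < ‖(z 2 : V) - 1‖ := by
      refine lt_of_le_of_ne (norm_nonneg _) fun h => ?_
      rw [← h, zero_pow (Nat.mul_ne_zero (by omega) (by omega))] at hr
      exact (norm_pos_iff.2 hp0).ne hr
    rw [← hr]
    refine pow_lt_self_of_lt_one₀ h0 hlt1 ?_
    calc 1 < p * 1 := by omega
      _ ≤ p * (p - 1) := Nat.mul_le_mul_left p (by omega)
  have hcong : ‖((PreTilt.untilt (e - 1) : unitBall V) : V) - ((z 2 : V) - 1)‖ ≤ ‖(p : V)‖ := by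
    have h1 : (p : unitBall V) ∣ PreTilt.untilt (e - 1) - (z 2 - 1) := by
      rw [← Ideal.mem_span_singleton, ← Ideal.Quotient.eq, PreTilt.mk_untilt_eq_coeff_zero,
        map_sub, map_one, map_sub, map_one]
      rfl
    exact norm_le_of_unitBall_dvd h1
  have hN : tiltNorm (e - 1) = ‖(z 2 : V) - 1‖ := by
    have h2 := IsUltrametricDist.norm_add_eq_max_of_norm_ne_norm (hcong.trans_lt hlt).ne
    rw [sub_add_cancel] at h2
    rw [tiltNorm, h2, max_eq_right (hcong.trans hlt.le)]
  have h3 : tiltOfSeq (p := p) z hz - 1 = (e - 1) ^ p ^ 2 := by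
    rw [sub_pow_char_pow, one_pow, he]
  rw [h3, tiltNorm_pow, hN, ← hr, ← pow_mul, ← pow_mul]
  congr 1
  ring

/-- The sum is `(ε - 1) / (ε^(1/p) - 1)`, of norm `t^(1 - 1/p)` with `t = |ε - 1|`. -/
theorem tiltNorm_geom_sum (hp0 : (p : V) ≠ 0) (hp1 : ‖(p : V)‖ < 1) (e : PreTilt (unitBall V) p)
    (he : e ^ p = tiltOfSeq z hz) :
    tiltNorm (∑ i ∈ Finset.range p, e ^ i) = ‖(p : V)‖ := by
  have ht := tiltNorm_tiltOfSeq_sub_one_pow z hz hprim hp0 hp1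
  set t := tiltNorm (tiltOfSeq (p := p) z hz - 1) with ht'
  have hp2 := hp.out.two_le
  have hppos := norm_pos_iff.2 hp0
  have ht0 : t ≠ 0 := by
    intro h
    rw [h, zero_pow (by omega)] at ht
    exact (pow_pos hppos p).ne ht
  have h1 : tiltNorm (e - 1) ^ p = t := by
    rw [← tiltNorm_pow, sub_pow_char, one_pow, he]
  have h2 : tiltNorm (∑ i ∈ Finset.range p, e ^ i) * tiltNorm (e - 1) = t := by
    rw [← tiltNorm_mul, geom_sum_mul, he]
  have h3 := congrArg (· ^ p) h2
  simp only [mul_pow, h1] at h3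
  have h4 : t ^ p = t ^ (p - 1) * t := by
    rw [← pow_succ, Nat.sub_add_cancel (by omega)]
  rw [h4, ht] at h3
  exact (pow_left_inj₀ (tiltNorm_nonneg _) hppos.le hp.out.ne_zero).1 (mul_right_cancel₀ ht0 h3)

/-- The intersection of the kernels of the maps `θ ∘ φ^r` is generated by `μ = [ε] - 1`. -/
theorem teichmuller_sub_one_dvd_of_thetaFrob_eq_zero [IsDomain (PreTilt (unitBall V) p)]
    (hp0 : (p : V) ≠ 0) (hp1 : ‖(p : V)‖ < 1) (x : WittVector p (PreTilt (unitBall V) p))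
    (hx : ∀ r, thetaFrob (unitBall V) p r x = 0) :
    WittVector.teichmuller p (tiltOfSeq z hz) - 1 ∣ x := by
  have hz0 : z 0 = 1 := by simpa using (hprim 0).pow_eq_one
  have hpO : (p : unitBall V) ≠ 0 := fun h => hp0 (congrArg Subtype.val h)
  have hcc : ∀ x : WittVector p (PreTilt (unitBall V) p),
      x.coeff 0 = WittVector.constantCoeff x := fun _ => rfl
  set t := tiltNorm (tiltOfSeq (p := p) z hz - 1) with ht
  have htp := tiltNorm_tiltOfSeq_sub_one_pow z hz hprim hp0 hp1
  rw [← ht] at htp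
  have hppos := norm_pos_iff.2 hp0
  have hp2 := hp.out.two_le
  have ht0 : 0 < t := by
    refine lt_of_le_of_ne (tiltNorm_nonneg _) fun h => ?_
    rw [← h, zero_pow (by omega)] at htp
    exact (pow_pos hppos p).ne htp
  let e : PreTilt (unitBall V) p := tiltOfSeq (fun n => z (n + 1)) fun n => hz (n + 1)
  have he : e ^ p = tiltOfSeq z hz := tilt_ext fun n => by
    rw [map_pow, coeff_tiltOfSeq, coeff_tiltOfSeq, ← map_pow, hz]
  have hue : PreTilt.untilt e = z 1 := untilt_tiltOfSeq _ _
  -- `ξ = ([ε] - 1) / ([ε^(1/p)] - 1)` generates the kernel of `θ`: its reduction has norm exactly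
  -- `|p|`, the largest norm possible for reductions of elements of the kernel. The higher maps `θ ∘
  -- φ^(r+1)` send it to `p`.
  let ξ : WittVector p (PreTilt (unitBall V) p) :=
    ∑ i ∈ Finset.range p, WittVector.teichmuller p e ^ i
  have hξ0 : ξ.coeff 0 = ∑ i ∈ Finset.range p, e ^ i := by
    rw [hcc, map_sum]
    refine Finset.sum_congr rfl fun i _ => ?_
    rw [map_pow, ← hcc, WittVector.teichmuller_coeff_zero]
  have hξN : tiltNorm (ξ.coeff 0) = ‖(p : V)‖ := by
    rw [hξ0]
    exact tiltNorm_geom_sum z hz hprim hp0 hp1 e he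
  have hξne : ξ.coeff 0 ≠ 0 := fun h => by
    have h1 := hξN
    rw [h, tiltNorm_zero] at h1
    exact hppos.ne h1
  have hξθ : WittVector.fontaineTheta (unitBall V) p ξ = 0 := by
    simp only [ξ, map_sum, map_pow, WittVector.fontaineTheta_teichmuller, hue]
    simpa using (hprim 1).geom_sum_eq_zero (by simpa using hp.out.one_lt)
  have hξr : ∀ r, thetaFrob (unitBall V) p (r + 1) ξ = p := fun r => by
    have h1 : z 1 ^ p ^ (r + 1) = 1 := by
      rw [pow_succ', pow_mul, hz, hz0, one_pow]
    simp only [ξ, map_sum, map_pow, thetaFrob_teichmuller, hue, h1, one_pow]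
    simp
  have hker : ∀ y, WittVector.fontaineTheta (unitBall V) p y = 0 → ξ ∣ y := by
    refine WittVector.dvd_of_mem_of_coeff_zero_dvd
      (RingHom.ker (WittVector.fontaineTheta (unitBall V) p)) ξ hξθ (fun b hb => ?_)
      fun y hy => ?_
    · rw [RingHom.mem_ker, map_mul, map_natCast] at hb
      exact (mul_eq_zero.1 hb).resolve_left hpO
    · refine tilt_dvd_of_tiltNorm_le hξne ?_
      rw [hξN]
      refine tiltNorm_le_of_coeff_zero_eq_zero ?_
      rw [← WittVector.mk_fontaineTheta, RingHom.mem_ker.1 hy, map_zero]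
  -- Put `N(y) = |y mod p| / t`. If all `θ ∘ φ^r` kill `y`, then `y = ξ y'` and they also kill
  -- `φ(y')`, with `N(y)^p = N(φ(y'))` because `t^(p-1) = |p|^p`. Iterating bounds all `N(y)^(p^k)`
  -- by `1/t`, which forces `N(y) ≤ 1`.
  have hbound : ∀ k : ℕ, ∀ y, (∀ r, thetaFrob (unitBall V) p r y = 0) →
      (tiltNorm (y.coeff 0) / t) ^ p ^ k ≤ 1 / t := by
    intro k
    induction k with
    | zero =>
      intro y _
      rw [pow_zero, pow_one]
      exact div_le_div_of_nonneg_right (tiltNorm_le_one _) ht0.le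
    | succ k ih =>
      intro y hy
      obtain ⟨y', rfl⟩ := hker y (by rw [← thetaFrob_zero]; exact hy 0)
      have h1 := ih (WittVector.map (frobenius _ p) y') fun r => by
        rw [thetaFrob_map_frobenius]
        have h2 := hy (r + 1)
        rw [map_mul, hξr] at h2
        exact (mul_eq_zero.1 h2).resolve_left hpO
      rw [WittVector.map_coeff, frobenius_def, tiltNorm_pow] at h1
      refine le_trans (le_of_eq ?_) h1
      rw [hcc, map_mul, ← hcc, ← hcc, tiltNorm_mul, hξN, pow_succ' p k, pow_mul]
      congr 1
      rw [div_pow, mul_pow, ← htp]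
      have h4 : t ^ p = t ^ (p - 1) * t := by
        rw [← pow_succ, Nat.sub_add_cancel (by omega)]
      rw [h4, mul_div_mul_left _ _ (pow_ne_zero _ ht0.ne')]
  have hle : ∀ y, (∀ r, thetaFrob (unitBall V) p r y = 0) → tiltNorm (y.coeff 0) ≤ t := by
    intro y hy
    by_contra h
    have h1 : 1 < tiltNorm (y.coeff 0) / t := (one_lt_div ht0).2 (not_le.1 h)
    obtain ⟨n, hn⟩ := pow_unbounded_of_one_lt (1 / t) h1
    have h2 : n ≤ p ^ n := (Nat.lt_pow_self hp.out.one_lt).le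
    exact absurd (hbound n y hy) (not_le.2 (hn.trans_le (pow_le_pow_right₀ h1.le h2)))
  refine WittVector.dvd_of_mem_of_coeff_zero_dvd
    (⨅ r, RingHom.ker (thetaFrob (unitBall V) p r)) _ ?_ (fun b hb => ?_) (fun y hy => ?_) x ?_
  · exact (Submodule.mem_iInf _).2 fun r => thetaFrob_teichmuller_sub_one z hz hz0 r
  · refine (Submodule.mem_iInf _).2 fun r => ?_
    have h1 := (Submodule.mem_iInf _).1 hb r
    rw [RingHom.mem_ker, map_mul, map_natCast] at h1
    exact (mul_eq_zero.1 h1).resolve_left hpO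
  · have h1 : (WittVector.teichmuller p (tiltOfSeq (p := p) z hz) - 1).coeff 0 =
        tiltOfSeq z hz - 1 := by
      rw [hcc, map_sub, map_one, ← hcc, WittVector.teichmuller_coeff_zero]
    rw [h1]
    have hpO' := tiltOfSeq_ne_one z hz hprim hpO
    exact tilt_dvd_of_tiltNorm_le (sub_ne_zero.2 hpO')
      (hle y fun r => (Submodule.mem_iInf _).1 hy r)
  · exact (Submodule.mem_iInf _).2 hx

end TiltNorm

/-! ### The absolutely unramified subfield of `K`, over which `K` is finite. -/

section CoefficientField
variable {p : ℕ} [hp : Fact p.Prime] {K : Type*} [NontriviallyNormedField K] [IsUltrametricDist K]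
  [CompleteSpace K] [hK : IsPAdicField p K]

theorem IsPAdicField.natCast_ne_zero (p : ℕ) [hp : Fact p.Prime] (K : Type*)
    [NontriviallyNormedField K] [IsUltrametricDist K] [hK : IsPAdicField p K] : (p : K) ≠ 0 := by
  have := hK.charZero
  exact Nat.cast_ne_zero.2 hp.out.ne_zero

instance : Fact (¬ IsUnit (p : unitBall K)) := ⟨not_isUnit_unitBall (norm_p_lt_one p K)⟩

instance : IsAdicComplete (Ideal.span {(p : unitBall K)}) (unitBall K) :=
  isAdicComplete_unitBall
    (fun h => IsPAdicField.natCast_ne_zero p K (congrArg Subtype.val h)) (norm_p_lt_one p K)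

variable (p K) in
/-- A uniformizer exists, and `p` is a power of it up to a unit. -/
theorem IsPAdicField.exists_uniformizer : ∃ (π : unitBall K) (e : ℕ), (π : K) ≠ 0 ∧
    ‖(π : K)‖ < 1 ∧ (∀ x : unitBall K, ‖(x : K)‖ < 1 → π ∣ x) ∧ ‖(p : K)‖ = ‖(π : K)‖ ^ e := by
  have := hK.isDiscreteValuationRing
  obtain ⟨π, hπ⟩ := IsDiscreteValuationRing.exists_irreducible (unitBall K)
  have hp0 : (p : unitBall K) ≠ 0 :=
    fun h => IsPAdicField.natCast_ne_zero p K (congrArg Subtype.val h)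
  obtain ⟨e, he⟩ := IsDiscreteValuationRing.associated_pow_irreducible hp0 hπ
  have hmax := hπ.maximalIdeal_eq
  refine ⟨π, e, fun h => hπ.ne_zero (Subtype.ext h), ?_, fun x hx => ?_, ?_⟩
  · refine lt_of_le_of_ne (norm_unitBall_le π) fun h => hπ.not_isUnit ?_
    refine isUnit_of_dvd_one (unitBall_dvd_of_norm_le hπ.ne_zero ?_)
    rw [h]
    exact norm_one.le
  · rw [← Ideal.mem_span_singleton, ← hmax]
    exact not_isUnit_unitBall hx
  · have h1 : ‖((π ^ e : unitBall K) : K)‖ = ‖(π : K)‖ ^ e := norm_pow _ _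
    rw [← h1]
    exact le_antisymm (norm_le_of_unitBall_dvd he.symm.dvd) (norm_le_of_unitBall_dvd he.dvd)

/-- Every residue class contains an element with a compatible system of `p`-power roots. -/
theorem IsPAdicField.exists_norm_untilt_sub_lt_one (x : unitBall K) :
    ∃ t : PreTilt (unitBall K) p, ‖((PreTilt.untilt t : unitBall K) : K) - x‖ < 1 := by
  obtain ⟨π, e, hπ0, hπ1, hπ, hpe⟩ := IsPAdicField.exists_uniformizer p K
  have := hK.charP
  have := hK.perfectField
  let k := IsLocalRing.ResidueField (unitBall K)
  have : ExpChar k p := ExpChar.prime hp.out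
  have : PerfectRing k p := PerfectField.toPerfectRing p
  have hres : ∀ y : unitBall K, IsLocalRing.residue (unitBall K) y = 0 → ‖(y : K)‖ < 1 := by
    intro y hy
    rw [IsLocalRing.residue_eq_zero_iff, IsLocalRing.mem_maximalIdeal, mem_nonunits_iff] at hy
    refine lt_of_le_of_ne (norm_unitBall_le y) fun h => hy ?_
    refine isUnit_of_dvd_one (unitBall_dvd_of_norm_le (fun h0 => ?_) ?_)
    · rw [h0] at h
      exact one_ne_zero (h.symm.trans norm_zero)
    · rw [h]
      exact norm_one.le
  have hlift : ∀ n : ℕ, ∃ b : unitBall K, IsLocalRing.residue (unitBall K) b =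
      (frobeniusEquiv k p).symm^[n] (IsLocalRing.residue (unitBall K) x) := fun n =>
    IsLocalRing.residue_surjective _
  choose b hb using hlift
  have hbs : ∀ n, ‖((b (n + 1) ^ p - b n : unitBall K) : K)‖ < 1 := fun n => by
    apply hres
    rw [map_sub, map_pow, hb, hb, Function.iterate_succ_apply', ← frobenius_def,
      frobenius_apply_frobeniusEquiv_symm, sub_self]
  have hπpow : ∀ y : unitBall K, ‖(y : K)‖ < 1 → (p : unitBall K) ∣ y ^ p ^ e := by
    intro y hy
    refine unitBall_dvd_of_norm_le
      (fun h => IsPAdicField.natCast_ne_zero p K (congrArg Subtype.val h)) ?_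
    have h1 : ‖((y ^ p ^ e : unitBall K) : K)‖ = ‖(y : K)‖ ^ p ^ e := norm_pow _ _
    have h2 : ‖((p : unitBall K) : K)‖ = ‖(π : K)‖ ^ e := hpe
    rw [h1, h2]
    calc ‖(y : K)‖ ^ p ^ e ≤ ‖(y : K)‖ ^ e :=
          pow_le_pow_of_le_one (norm_nonneg _) hy.le (Nat.lt_pow_self hp.out.one_lt).le
      _ ≤ _ := pow_le_pow_left₀ (norm_nonneg _) (norm_le_of_unitBall_dvd (hπ y hy)) e
  -- The lifts `b n` of the `p^n`-th roots of the residue class are compatible only modulo the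
  -- maximal ideal. Raising to the power `p^e` makes them compatible modulo `p`, since `p^e ≥ e`;
  -- the index shift by `e` restores the residue class.
  let s : ℕ → ModP (unitBall K) p := fun n => Ideal.Quotient.mk _ (b (n + e)) ^ p ^ e
  have hs : ∀ n, s (n + 1) ^ p = s n := fun n => by
    simp only [s]
    rw [← pow_mul, mul_comm, pow_mul, ← sub_eq_zero, ← sub_pow_char_pow, ← map_pow, ← map_sub,
      ← map_pow, Ideal.Quotient.eq_zero_iff_dvd, add_right_comm]
    exact hπpow _ (hbs _)
  let t : PreTilt (unitBall K) p := ⟨s, hs⟩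
  refine ⟨t, ?_⟩
  have h1 : (p : unitBall K) ∣ PreTilt.untilt t - b e ^ p ^ e := by
    rw [← Ideal.Quotient.eq_zero_iff_dvd, map_sub, PreTilt.mk_untilt_eq_coeff_zero, map_pow,
      sub_eq_zero]
    show Ideal.Quotient.mk _ (b (0 + e)) ^ p ^ e = _
    rw [zero_add]
  have h2 : ‖((b e ^ p ^ e - x : unitBall K) : K)‖ < 1 := by
    apply hres
    rw [map_sub, map_pow, hb, sub_eq_zero, ← iterate_frobenius]
    exact Function.LeftInverse.iterate (frobenius_apply_frobeniusEquiv_symm k p) e _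
  have h3 : ‖((PreTilt.untilt t - b e ^ p ^ e : unitBall K) : K)‖ < 1 :=
    (norm_le_of_unitBall_dvd h1).trans_lt (norm_p_lt_one p K)
  have h4 : ((PreTilt.untilt t : unitBall K) : K) - x =
      ((PreTilt.untilt t - b e ^ p ^ e : unitBall K) : K) +
        ((b e ^ p ^ e - x : unitBall K) : K) := by
    push_cast
    ring
  rw [h4]
  exact (IsUltrametricDist.norm_add_le_max _ _).trans_lt (max_lt h3 h2)

/-- The untilt has `p^n`-th roots in `K` for all `n`. With a discrete valuation, a norm below `1`
would be at most `‖π‖^(p^n)` for every `n`, hence zero. -/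
theorem IsPAdicField.norm_untilt_eq_one {t : PreTilt (unitBall K) p} (ht : t ≠ 0) :
    ‖((PreTilt.untilt t : unitBall K) : K)‖ = 1 := by
  obtain ⟨π, e, hπ0, hπ1, hπ, hpe⟩ := IsPAdicField.exists_uniformizer p K
  by_contra h
  refine ht (tiltNorm_eq_zero (le_antisymm ?_ (tiltNorm_nonneg t)))
  have hlt : tiltNorm t < 1 := lt_of_le_of_ne (tiltNorm_le_one t) h
  refine ge_of_tendsto' (tendsto_pow_atTop_nhds_zero_of_lt_one (norm_nonneg (π : K)) hπ1)
    fun n => ?_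
  set r := (frobeniusEquiv (PreTilt (unitBall K) p) p).symm^[n] t with hr
  have h1 : tiltNorm r ^ p ^ n = tiltNorm t := tiltNorm_frobeniusEquiv_symm_iterate t n
  have h2 : tiltNorm r < 1 := by
    refine lt_of_le_of_ne (tiltNorm_le_one r) fun h3 => ?_
    rw [h3, one_pow] at h1
    exact hlt.ne h1.symm
  have h3 : tiltNorm r ≤ ‖(π : K)‖ := norm_le_of_unitBall_dvd (hπ _ h2)
  rw [← h1]
  calc tiltNorm r ^ p ^ n ≤ ‖(π : K)‖ ^ p ^ n := pow_le_pow_left₀ (tiltNorm_nonneg r) h3 _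
    _ ≤ ‖(π : K)‖ ^ n :=
      pow_le_pow_of_le_one (norm_nonneg _) hπ1.le (Nat.lt_pow_self hp.out.one_lt).le

/-- Remove the exact power of `p` from `w`. What remains has nonzero reduction, and its image under
`θ` is congruent modulo `p` to an untilt of norm `1`. -/
theorem IsPAdicField.norm_fontaineTheta (w : WittVector p (PreTilt (unitBall K) p)) (hw : w ≠ 0) :
    ∃ n : ℕ, ‖((WittVector.fontaineTheta (unitBall K) p w : unitBall K) : K)‖ =
      ‖(p : K)‖ ^ n := by
  classical
  have hex : ∃ n, ¬ (p : WittVector p (PreTilt (unitBall K) p)) ^ n ∣ w := by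
    by_contra h
    exact hw (WittVector.eq_zero_of_forall_p_pow_dvd w (not_exists_not.1 h))
  obtain ⟨n, hn⟩ : ∃ n, Nat.find hex = n + 1 := Nat.exists_eq_succ_of_ne_zero fun h => by
    have := Nat.find_spec hex
    rw [h, pow_zero] at this
    exact this (one_dvd w)
  obtain ⟨w', rfl⟩ := not_not.1 (Nat.find_min hex (m := n) (by omega))
  have hw' : w'.coeff 0 ≠ 0 := by
    intro h
    have h1 := Nat.find_spec hex
    rw [hn, pow_succ] at h1
    exact h1 (mul_dvd_mul_left _ ((WittVector.p_dvd_iff_coeff_zero w').2 h))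
  refine ⟨n, ?_⟩
  have h1 : (p : unitBall K) ∣ WittVector.fontaineTheta (unitBall K) p w' -
      PreTilt.untilt (w'.coeff 0) := by
    rw [← Ideal.Quotient.eq_zero_iff_dvd, map_sub, WittVector.mk_fontaineTheta,
      PreTilt.mk_untilt_eq_coeff_zero, sub_self]
  have h2 := (norm_le_of_unitBall_dvd h1).trans_lt (norm_p_lt_one p K)
  have h3 := IsPAdicField.norm_untilt_eq_one hw'
  have h4 : ‖((WittVector.fontaineTheta (unitBall K) p w' : unitBall K) : K)‖ = 1 := by
    rw [← h3] at h2
    have h5 := IsUltrametricDist.norm_add_eq_max_of_norm_ne_norm h2.ne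
    rw [max_eq_right h2.le, h3] at h5
    rw [← h5]
    congr 1
    push_cast
    ring
  have h5 : ((WittVector.fontaineTheta (unitBall K) p ((p : WittVector p
      (PreTilt (unitBall K) p)) ^ n * w') : unitBall K) : K) =
      (p : K) ^ n * ((WittVector.fontaineTheta (unitBall K) p w' : unitBall K) : K) := by
    rw [map_mul, map_pow, map_natCast]
    push_cast
    rfl
  rw [h5, norm_mul, h4, mul_one, norm_pow]

variable (p K) in
/-- The maximal absolutely unramified subfield of `K`. -/
noncomputable def coefficientField : Subfield K :=
  (Subfield.closure (((unitBall K).subtype.comp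
    (WittVector.fontaineTheta (unitBall K) p)).range : Set K)).topologicalClosure

theorem isClosed_coefficientField : IsClosed (coefficientField p K : Set K) :=
  Subfield.isClosed_topologicalClosure _

theorem fontaineTheta_mem_coefficientField (w : WittVector p (PreTilt (unitBall K) p)) :
    ((WittVector.fontaineTheta (unitBall K) p w : unitBall K) : K) ∈ coefficientField p K :=
  Subfield.le_topologicalClosure _ (Subfield.subset_closure ⟨w, rfl⟩)

/-- In an ultrametric field a close approximation has the same norm, so passing to the closure adds
no new values. This is the condition needed for the orthogonality of the powers of `ζ - 1`. -/
theorem norm_coefficientField (c : K) (hc : c ∈ coefficientField p K) (hc0 : c ≠ 0) :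
    ∃ a : ℤ, ‖c‖ = ‖(p : K)‖ ^ a := by
  obtain ⟨d, hd, hcd⟩ := Metric.mem_closure_iff.1 hc ‖c‖ (norm_pos_iff.2 hc0)
  rw [dist_comm, dist_eq_norm] at hcd
  have hcd' : ‖c‖ = ‖d‖ := by
    have h1 := IsUltrametricDist.norm_add_eq_max_of_norm_ne_norm hcd.ne
    rw [sub_add_cancel, max_eq_right hcd.le] at h1
    exact h1.symm
  have hd0 : d ≠ 0 := by
    rintro rfl
    exact hc0 (norm_eq_zero.1 (hcd'.trans norm_zero))
  rw [hcd']
  obtain ⟨y, hy, z, hz, rfl⟩ := Subfield.mem_closure_iff.1 hd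
  rw [Subring.closure_eq] at hy hz
  obtain ⟨v, rfl⟩ := hy
  obtain ⟨w, rfl⟩ := hz
  have hnum : ∀ v, v ≠ 0 → ∃ n : ℕ, ‖(unitBall K).subtype.comp
      (WittVector.fontaineTheta (unitBall K) p) v‖ = ‖(p : K)‖ ^ n := fun v hv =>
    IsPAdicField.norm_fontaineTheta v hv
  obtain ⟨m, hm⟩ := hnum v fun h => hd0 (by rw [h, map_zero, zero_div])
  obtain ⟨n, hn⟩ := hnum w fun h => hd0 (by rw [h, map_zero, div_zero])
  refine ⟨(m : ℤ) - n, ?_⟩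
  rw [norm_div, hm, hn, zpow_sub₀ (norm_ne_zero_iff.2 (IsPAdicField.natCast_ne_zero p K)),
    zpow_natCast, zpow_natCast]

/-- The powers `π^i` with `i < e` span `K`. Untilts represent all residue classes, so successive
approximation reaches each integer modulo `π^e`, hence modulo every power of `p`; the span is closed
because it is finite-dimensional over a complete field. -/
instance finiteDimensional_coefficientField : FiniteDimensional (coefficientField p K) K := by
  obtain ⟨π, e, hπ0, hπ1, hπ, hpe⟩ := IsPAdicField.exists_uniformizer p K
  have hp0 := IsPAdicField.natCast_ne_zero p K
  have hp1 := norm_p_lt_one p K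
  let F := coefficientField p K
  let V : Submodule F K := Submodule.span F ((fun i : ℕ => (π : K) ^ i) '' Finset.range e)
  have hVfin : FiniteDimensional F V :=
    FiniteDimensional.span_of_finite F ((Finset.finite_toSet _).image _)
  let _ : NontriviallyNormedField F := NontriviallyNormedField.ofNormNeOne
    ⟨(p : F), fun h => hp0 (congrArg Subtype.val h), fun h => hp1.ne h⟩
  have : CompleteSpace F := isClosed_coefficientField.completeSpace_coe
  have : ContinuousSMul F K := ⟨by
    show Continuous fun x : F × K => (x.1 : K) * x.2
    fun_prop⟩
  have hclosed : IsClosed (V : Set K) := V.closed_of_finiteDimensional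
  have hres : ∀ x : unitBall K, ∃ s : F, ‖((s : F) : K)‖ ≤ 1 ∧ ‖(x : K) - s‖ ≤ ‖(π : K)‖ := by
    intro x
    obtain ⟨t, ht⟩ := IsPAdicField.exists_norm_untilt_sub_lt_one (p := p) x
    have h1 := fontaineTheta_mem_coefficientField (WittVector.teichmuller p t)
    rw [WittVector.fontaineTheta_teichmuller] at h1
    refine ⟨⟨_, h1⟩, norm_unitBall_le _, ?_⟩
    rw [norm_sub_rev] at ht
    exact norm_le_of_unitBall_dvd (hπ (x - PreTilt.untilt t) ht)
  have hstep : ∀ j ≤ e, ∀ x : unitBall K, ∃ v ∈ V, ‖(x : K) - v‖ ≤ ‖(π : K)‖ ^ j := by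
    intro j
    induction j with
    | zero => exact fun _ x => ⟨0, V.zero_mem, by simpa using norm_unitBall_le x⟩
    | succ j ih =>
      intro hj x
      obtain ⟨v, hv, hxv⟩ := ih (by omega) x
      have h1 : ‖((x : K) - v) / (π : K) ^ j‖ ≤ 1 := by
        rw [norm_div, norm_pow]
        exact div_le_one_of_le₀ hxv (by positivity)
      obtain ⟨s, -, hs⟩ := hres ⟨_, h1⟩
      refine ⟨v + s • (π : K) ^ j, V.add_mem hv (V.smul_mem s (Submodule.subset_span
        ⟨j, Finset.mem_coe.2 (Finset.mem_range.2 (by omega)), rfl⟩)), ?_⟩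
      have h2 : (x : K) - (v + s • (π : K) ^ j) =
          (((x : K) - v) / (π : K) ^ j - s) * (π : K) ^ j := by
        rw [sub_mul, div_mul_cancel₀ _ (pow_ne_zero j hπ0), sub_sub]
        rfl
      rw [h2, norm_mul, norm_pow, pow_succ']
      exact mul_le_mul_of_nonneg_right hs (by positivity)
  have happrox : ∀ n : ℕ, ∀ x : unitBall K, ∃ v ∈ V, ‖(x : K) - v‖ ≤ ‖(p : K)‖ ^ n := by
    intro n
    induction n with
    | zero => exact fun x => ⟨0, V.zero_mem, by simpa using norm_unitBall_le x⟩
    | succ n ih =>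
      intro x
      obtain ⟨v, hv, hxv⟩ := ih x
      have h1 : ‖((x : K) - v) / (p : K) ^ n‖ ≤ 1 := by
        rw [norm_div, norm_pow]
        exact div_le_one_of_le₀ hxv (by positivity)
      obtain ⟨w, hw, hxw⟩ := hstep e le_rfl ⟨_, h1⟩
      refine ⟨v + (p : F) ^ n • w, V.add_mem hv (V.smul_mem _ hw), ?_⟩
      have h2 : (x : K) - (v + (p : F) ^ n • w) =
          (((x : K) - v) / (p : K) ^ n - w) * (p : K) ^ n := by
        rw [sub_mul, div_mul_cancel₀ _ (pow_ne_zero n hp0), sub_sub, mul_comm w]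
        rfl
      rw [h2, norm_mul, norm_pow, pow_succ', hpe]
      exact mul_le_mul_of_nonneg_right hxw (by positivity)
  have hball : ∀ x : unitBall K, (x : K) ∈ V := by
    intro x
    rw [← SetLike.mem_coe, ← hclosed.closure_eq]
    refine Metric.mem_closure_iff.2 fun ε hε => ?_
    obtain ⟨n, hn⟩ := exists_pow_lt_of_lt_one hε hp1
    obtain ⟨v, hv, hxv⟩ := happrox n x
    exact ⟨v, hv, by rw [dist_eq_norm]; exact hxv.trans_lt hn⟩
  have htop : V = ⊤ := by
    refine top_unique fun x _ => ?_
    obtain ⟨n, hn⟩ : ∃ n : ℕ, ‖(p : K) ^ n * x‖ ≤ 1 := by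
      by_cases hx : x = 0
      · exact ⟨0, by simp [hx]⟩
      obtain ⟨n, hn⟩ := exists_pow_lt_of_lt_one (inv_pos.2 (norm_pos_iff.2 hx)) hp1
      refine ⟨n, ?_⟩
      rw [norm_mul, norm_pow]
      exact (mul_le_mul_of_nonneg_right hn.le (norm_nonneg _)).trans
        (inv_mul_cancel₀ (norm_ne_zero_iff.2 hx)).le
    have h1 := V.smul_mem ((p : F) ^ n)⁻¹ (hball ⟨_, hn⟩)
    have h2 : ((p : F) ^ n)⁻¹ • ((p : K) ^ n * x) = x := by
      show (((p : F) ^ n)⁻¹ : F) * ((p : K) ^ n * x) = x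
      push_cast
      exact inv_mul_cancel_left₀ (pow_ne_zero n hp0) x
    rwa [← h2]
  have : FiniteDimensional F (⊤ : Submodule F K) := htop ▸ hVfin
  exact Module.Finite.equiv (Submodule.topEquiv (R := F) (M := K))

end CoefficientField

/-! ### The completed cyclotomic tower and its Galois group. -/

theorem pow_dvd_of_norm_intCast_le {p : ℕ} [hp : Fact p.Prime] {M : Type*} [NormedField M]
    [IsUltrametricDist M] (hp0 : (p : M) ≠ 0) (hp1 : ‖(p : M)‖ < 1) (N : ℕ) (k : ℤ)
    (hk : ‖(k : M)‖ ≤ ‖(p : M)‖ ^ N) : (p : ℤ) ^ N ∣ k := by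
  induction N generalizing k with
  | zero => simp
  | succ N ih =>
    have hlt : ‖(k : M)‖ < 1 := hk.trans_lt (pow_lt_one₀ (norm_nonneg _) hp1 N.succ_ne_zero)
    have hdvd : (p : ℤ) ∣ k := by
      by_contra h
      obtain ⟨a, b, hab⟩ := (Int.isCoprime_iff_gcd_eq_one.2
        ((Nat.prime_iff_prime_int.1 hp.out).irreducible.coprime_iff_not_dvd.2 h |>
          Int.isCoprime_iff_gcd_eq_one.1))
      have h1 : (a : M) * p + b * k = 1 := by exact_mod_cast congrArg (Int.cast (R := M)) hab
      have h2 := IsUltrametricDist.norm_add_le_max ((a : M) * p) (b * k)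
      rw [h1, norm_one, norm_mul, norm_mul] at h2
      have ha := norm_intCast_le_one_of_isUltrametricDist (M := M) a
      have hb := norm_intCast_le_one_of_isUltrametricDist (M := M) b
      exact absurd h2 (not_le.2 (max_lt
        ((mul_le_of_le_one_left (norm_nonneg _) ha).trans_lt hp1)
        ((mul_le_of_le_one_left (norm_nonneg _) hb).trans_lt hlt)))
    obtain ⟨k', rfl⟩ := hdvd
    rw [pow_succ']
    refine mul_dvd_mul_left _ (ih k' ?_)
    rw [Int.cast_mul, Int.cast_natCast, norm_mul, pow_succ'] at hk
    exact le_of_mul_le_mul_left hk (norm_pos_iff.2 hp0)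

section Cyclotomic
variable {p : ℕ} [hp : Fact p.Prime] {K : Type*} [NontriviallyNormedField K] [IsUltrametricDist K]
  [CompleteSpace K] [hK : IsPAdicField p K] (ζ : CompatibleRootsOfUnity p K)

theorem p_ne_zero_KInftyHat : (p : KInftyHat ζ) ≠ 0 :=
  fun h => p_ne_zero_OKInftyHat ζ (Subtype.ext h)

instance : IsAdicComplete (Ideal.span {(p : OKInftyHat ζ)}) (OKInftyHat ζ) :=
  isAdicComplete_unitBall (p_ne_zero_OKInftyHat ζ) (norm_p_lt_one' ζ)

/-- The root of unity `ζ_{p^n}` in the completion of `K_∞`. -/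
noncomputable def zetaHat (n : ℕ) : KInftyHat ζ := zetaInt ζ n

theorem zetaHat_primitive (n : ℕ) : IsPrimitiveRoot (zetaHat ζ n) (p ^ n) :=
  (zetaInt_primitive ζ n).map_of_injective (f := (OKInftyHat ζ).subtype) Subtype.val_injective

theorem zetaHat_succ_pow (n : ℕ) : zetaHat ζ (n + 1) ^ p = zetaHat ζ n :=
  congrArg Subtype.val (zetaInt_succ_pow ζ n)

theorem completionMap_algebraMap (g : GammaK ζ) (c : K) :
    completionMap g (algebraMap K (KInftyHat ζ) c) = algebraMap K (KInftyHat ζ) c := by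
  have h : algebraMap K (KInftyHat ζ) c = (algebraMap K (CyclotomicTower ζ) c : KInftyHat ζ) := rfl
  rw [h, completionMap_coe, AlgEquiv.commutes]

theorem exists_aeval_zetaTower (x : CyclotomicTower ζ) :
    ∃ m, ∃ f : Polynomial K, x = Polynomial.aeval (zetaTower ζ m) f := by
  obtain ⟨m, f, hf⟩ := exists_aeval_of_mem_iSup_adjoin ζ.root_succ_pow ζ.isPrimitiveRoot x x.2
  refine ⟨m, f, Subtype.ext ?_⟩
  rw [hf]
  exact (Polynomial.aeval_algHom_apply (CyclotomicTower ζ).val (zetaTower ζ m) f)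

theorem gammaK_ext (g : GammaK ζ) (h : ∀ n, g (zetaTower ζ n) = zetaTower ζ n) : g = 1 := by
  ext1 x
  obtain ⟨m, f, rfl⟩ := exists_aeval_zetaTower ζ x
  rw [AlgEquiv.one_apply]
  refine (Polynomial.aeval_algHom_apply (g : CyclotomicTower ζ →ₐ[K] CyclotomicTower ζ)
    (zetaTower ζ m) f).symm.trans ?_
  show Polynomial.aeval (g (zetaTower ζ m)) f = _
  rw [h]

instance : IsGalois K (CyclotomicTower ζ) := by
  have : CharZero K := hK.charZero
  have : ∀ n, Normal K K⟮ζ.root n⟯ := fun n => by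
    have : NeZero (p ^ n) := ⟨pow_ne_zero _ hp.out.ne_zero⟩
    have := (ζ.isPrimitiveRoot n).intermediateField_adjoin_isCyclotomicExtension K
    have := IsCyclotomicExtension.isGalois {p ^ n} K K⟮ζ.root n⟯
    infer_instance
  have : Normal K (CyclotomicTower ζ) := IntermediateField.normal_iSup K _ fun n => K⟮ζ.root n⟯
  exact ⟨⟩

/-- If the group had finite order `G`, the product of the conjugates of `ζ_{p^(n+1)} - 1` would lie
in `K` with norm below `1`, hence at most `‖π‖`. Raising to the power `φ(p^(n+1))` gives `φ(p^(n+1))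
≤ e G` for all `n`, which is absurd. -/
theorem infinite_gammaK : Infinite (GammaK ζ) := by
  rw [← not_finite_iff_infinite]
  intro hfin
  have := Fintype.ofFinite (GammaK ζ)
  obtain ⟨π, e, hπ0, hπ1, hπ, hpe⟩ := IsPAdicField.exists_uniformizer p K
  have hπpos := norm_pos_iff.2 hπ0
  have hnormp : ‖(p : CyclotomicTower ζ)‖ = ‖(p : K)‖ := by
    rw [← map_natCast (algebraMap K (CyclotomicTower ζ)), norm_algebraMap']
  set G := Fintype.card (GammaK ζ) with hG
  have hkey : ∀ n : ℕ, (p ^ (n + 1)).totient ≤ e * G := by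
    intro n
    have hr := (zetaTower_primitive ζ (n + 1)).norm_sub_one_pow_totient
    rw [hnormp] at hr
    set x := zetaTower ζ (n + 1) - 1
    have hx1 : ‖x‖ < 1 := by
      by_contra h
      have h1 := norm_p_lt_one p K
      rw [← hr] at h1
      exact absurd h1 (not_lt.2 (one_le_pow₀ (not_lt.1 h)))
    obtain ⟨y, hy⟩ : ∏ g : GammaK ζ, g x ∈ Set.range (algebraMap K (CyclotomicTower ζ)) := by
      rw [InfiniteGalois.mem_range_algebraMap_iff_fixed]
      intro h
      rw [map_prod]
      exact Fintype.prod_equiv (Equiv.mulLeft h) _ _ fun g => rfl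
    have hynorm : ‖y‖ = ‖x‖ ^ G := by
      rw [← norm_algebraMap' (CyclotomicTower ζ) y, hy, norm_prod,
        Finset.prod_congr rfl fun g _ => gammaK_norm g x, Finset.prod_const, Finset.card_univ]
    have hG0 : G ≠ 0 := Fintype.card_ne_zero
    have hy1 : ‖y‖ < 1 := by
      rw [hynorm]
      exact pow_lt_one₀ (norm_nonneg _) hx1 hG0
    have hle : ‖x‖ ^ G ≤ ‖(π : K)‖ := by
      rw [← hynorm]
      exact norm_le_of_unitBall_dvd (x := ⟨y, hy1.le⟩) (hπ _ hy1)
    have h2 : ‖(π : K)‖ ^ (e * G) ≤ ‖(π : K)‖ ^ (p ^ (n + 1)).totient := by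
      rw [pow_mul, ← hpe, ← hr, ← pow_mul, mul_comm, pow_mul]
      exact pow_le_pow_left₀ (by positivity) hle _
    exact (pow_le_pow_iff_right_of_lt_one₀ hπpos hπ1).1 h2
  have h3 := hkey (e * G + 1)
  rw [Nat.totient_prime_pow_succ hp.out] at h3
  have h4 : e * G + 1 < p ^ (e * G + 1) := Nat.lt_pow_self hp.out.one_lt
  have h5 : p ^ (e * G + 1) * 1 ≤ p ^ (e * G + 1) * (p - 1) :=
    Nat.mul_le_mul_left _ (by have := hp.out.two_le; omega)
  omega

/-- The completion of `K_∞` is algebraic over the closure of `K₀(ζ_{p^∞})`. -/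
theorem isIntegral_KInftyHat (y : KInftyHat ζ) :
    IsIntegral (cyclotomicClosure (coefficientField p K) (zetaHat ζ)) y := by
  let F := coefficientField p K
  let L := cyclotomicClosure F (zetaHat ζ)
  have hint : ∀ x : K, IsIntegral L (algebraMap K (KInftyHat ζ) x) := fun x => by
    refine IsIntegral.map_of_comp_eq (R := F) ((algebraMap F (KInftyHat ζ)).codRestrict L
      algebraMap_mem_cyclotomicClosure) (algebraMap K (KInftyHat ζ)) ?_
      (Algebra.IsIntegral.isIntegral (R := F) x)
    rfl
  obtain ⟨s, hs⟩ := (Module.Finite.fg_top : (⊤ : Submodule F K).FG)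
  -- The subalgebra generated by `K` is finite over the complete field `L`, hence closed. It
  -- contains the dense subfield `K_∞`.
  let W : Subalgebra L (KInftyHat ζ) :=
    Algebra.adjoin L (algebraMap K (KInftyHat ζ) '' (s : Set K))
  have hWfin : Module.Finite L W := Algebra.finite_adjoin_of_finite_of_isIntegral
    (s.finite_toSet.image _) (by rintro _ ⟨x, -, rfl⟩; exact hint x)
  have hLW : ∀ x ∈ L, x ∈ W := fun x hx => W.algebraMap_mem ⟨x, hx⟩
  have hKW : ∀ x : K, algebraMap K (KInftyHat ζ) x ∈ W := by
    intro x
    have hx : x ∈ Submodule.span F (s : Set K) := hs ▸ Submodule.mem_top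
    induction hx using Submodule.span_induction with
    | mem x hx => exact Algebra.subset_adjoin ⟨x, hx, rfl⟩
    | zero => rw [map_zero]; exact W.zero_mem
    | add x y _ _ hx hy => rw [map_add]; exact W.add_mem hx hy
    | smul c x _ hx =>
      rw [Algebra.smul_def, map_mul]
      exact W.mul_mem (hLW _ (algebraMap_mem_cyclotomicClosure (F := F) c)) hx
  have hp0 := p_ne_zero_KInftyHat ζ
  have hp1 := norm_p_lt_one' ζ
  let _ : NontriviallyNormedField L := NontriviallyNormedField.ofNormNeOne
    ⟨(p : L), fun h => hp0 (congrArg Subtype.val h), fun h => hp1.ne h⟩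
  have : CompleteSpace L := (Subfield.isClosed_topologicalClosure _).completeSpace_coe
  have : ContinuousSMul L (KInftyHat ζ) := ⟨by
    show Continuous fun x : L × KInftyHat ζ => (x.1 : KInftyHat ζ) * x.2
    fun_prop⟩
  have : FiniteDimensional L (Subalgebra.toSubmodule W) := hWfin
  have hclosed : IsClosed (W : Set (KInftyHat ζ)) :=
    (Subalgebra.toSubmodule W).closed_of_finiteDimensional
  have htop : ∀ y, y ∈ W := by
    intro y
    induction y using Completion.induction_on with
    | hp => exact hclosed
    | ih x =>
      obtain ⟨m, f, rfl⟩ := exists_aeval_zetaTower ζ x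
      have h1 : ((Polynomial.aeval (zetaTower ζ m) f : CyclotomicTower ζ) : KInftyHat ζ) =
          Polynomial.aeval (zetaHat ζ m) f :=
        Polynomial.hom_eval₂ f (algebraMap K (CyclotomicTower ζ))
          (Completion.coeRingHom : CyclotomicTower ζ →+* KInftyHat ζ) (zetaTower ζ m)
      rw [h1, Polynomial.aeval_eq_sum_range]
      refine W.sum_mem fun i _ => ?_
      rw [Algebra.smul_def]
      exact W.mul_mem (hKW _) (W.pow_mem (hLW _ (mem_cyclotomicClosure m)) i)
  exact IsIntegral.of_mem_of_fg W (Module.Finite.iff_fg.1 hWfin) y (htop y)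

end Cyclotomic

/-! ### The cyclotomic character, Tate's theorem and vanishing modulo `μ`. -/

section Vanishing
variable {p : ℕ} [hp : Fact p.Prime] {K : Type*} [NontriviallyNormedField K] [IsUltrametricDist K]
  [CompleteSpace K] [hK : IsPAdicField p K] {ζ : CompatibleRootsOfUnity p K}

/-- The cocycle `g ↦ g(μ) / μ`. -/
noncomputable def muCocycle (g : GammaK ζ) : AKPlus ζ := (muElt_dvd_smul ζ g).choose

theorem smul_muElt (g : GammaK ζ) : g • muElt ζ = muCocycle g * muElt ζ := by
  rw [mul_comm]
  exact (muElt_dvd_smul ζ g).choose_spec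

theorem muElt_ne_zero (ζ : CompatibleRootsOfUnity p K) : muElt ζ ≠ 0 := by
  intro h
  refine tiltOfSeq_ne_one (zetaInt ζ) (zetaInt_succ_pow ζ) (zetaInt_primitive ζ)
    (p_ne_zero_OKInftyHat ζ) ?_
  have h2 := congrArg (fun x => WittVector.coeff x 0) (sub_eq_zero.1 h)
  exact (by simpa using h2 : epsilonElt ζ = 1)

theorem thetaFrob_smul (r : ℕ) (g : GammaK ζ) (x : AKPlus ζ) :
    thetaFrob (OKInftyHat ζ) p r (g • x) = integerMap g (thetaFrob (OKInftyHat ζ) p r x) :=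
  thetaFrob_map_tiltMap r (integerMap g) x

theorem exists_integerMap_zetaInt (g : GammaK ζ) (N : ℕ) :
    ∃ c : ℕ, integerMap g (zetaInt ζ N) = zetaInt ζ N ^ c := by
  have : NeZero (p ^ N) := ⟨pow_ne_zero _ hp.out.ne_zero⟩
  obtain ⟨c, -, hc⟩ := (zetaInt_primitive ζ N).eq_pow_of_pow_eq_one (ξ := integerMap g (zetaInt ζ N))
    (by rw [← map_pow, (zetaInt_primitive ζ N).pow_eq_one, map_one])
  exact ⟨c, hc.symm⟩

/-- The image of `g(μ) / μ` under `θ ∘ φ^r`. -/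
noncomputable def thetaCocycle (r : ℕ) (g : GammaK ζ) : KInftyHat ζ :=
  thetaFrob (OKInftyHat ζ) p r (muCocycle g)

theorem norm_thetaCocycle_sub_le (r : ℕ) (g : GammaK ζ) (N c : ℕ)
    (hc : integerMap g (zetaInt ζ N) = zetaInt ζ N ^ c) :
    ‖thetaCocycle r g - c‖ ≤ ‖(p : KInftyHat ζ)‖ ^ N := by
  have h := norm_le_of_unitBall_dvd (pow_dvd_thetaFrob_sub (zetaInt ζ) (zetaInt_succ_pow ζ)
    (zetaInt_primitive ζ) (p_ne_zero_OKInftyHat ζ) (integerMap g) (muCocycle g) (smul_muElt g)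
    N c hc r)
  rw [← norm_pow]
  exact h

/-- The value is a limit of natural numbers, and the image of the coefficient field is closed. -/
theorem exists_thetaCocycle_eq (r : ℕ) (g : GammaK ζ) :
    ∃ l : coefficientField p K, algebraMap K (KInftyHat ζ) l = thetaCocycle r g := by
  have hcl : IsClosed (algebraMap K (KInftyHat ζ) '' (coefficientField p K : Set K)) :=
    (algebraMap_isometry K (KInftyHat ζ)).isClosedEmbedding.isClosedMap _ isClosed_coefficientField
  have hmem : thetaCocycle r g ∈ algebraMap K (KInftyHat ζ) '' (coefficientField p K : Set K) := by
    rw [← hcl.closure_eq]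
    refine Metric.mem_closure_iff.2 fun ε hε => ?_
    obtain ⟨N, hN⟩ := exists_pow_lt_of_lt_one hε (norm_p_lt_one' ζ)
    obtain ⟨c, hc⟩ := exists_integerMap_zetaInt g N
    refine ⟨c, ⟨c, natCast_mem (coefficientField p K) c, map_natCast _ c⟩, ?_⟩
    rw [dist_eq_norm]
    exact (norm_thetaCocycle_sub_le r g N c hc).trans_lt hN
  obtain ⟨l, hl, h⟩ := hmem
  exact ⟨⟨l, hl⟩, h⟩

theorem completionMap_thetaCocycle (r : ℕ) (g h : GammaK ζ) :
    completionMap g (thetaCocycle r h) = thetaCocycle r h := by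
  obtain ⟨l, hl⟩ := exists_thetaCocycle_eq r h
  rw [← hl, completionMap_algebraMap]

/-- A cocycle with Galois-invariant values is a character. -/
theorem thetaCocycle_mul (r : ℕ) (g h : GammaK ζ) :
    thetaCocycle r (g * h) = thetaCocycle r g * thetaCocycle r h := by
  have h1 : muCocycle (g * h) = (g • muCocycle h) * muCocycle g := by
    apply mul_right_cancel₀ (muElt_ne_zero ζ)
    rw [← smul_muElt, mul_smul, smul_muElt h, smul_mul', smul_muElt g, mul_assoc]
  have h2 : thetaCocycle r (g * h) = completionMap g (thetaCocycle r h) * thetaCocycle r g := by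
    rw [thetaCocycle, h1, map_mul, thetaFrob_smul]
    rfl
  rw [h2, completionMap_thetaCocycle, mul_comm]

theorem thetaCocycle_one (r : ℕ) : thetaCocycle r (1 : GammaK ζ) = 1 := by
  have h1 : muCocycle (1 : GammaK ζ) = 1 := by
    apply mul_right_cancel₀ (muElt_ne_zero ζ)
    rw [← smul_muElt, one_smul, one_mul]
  rw [thetaCocycle, h1, map_one]
  rfl

variable (ζ) in
/-- The cyclotomic character, with values in the completion of `K_∞`. -/
noncomputable def thetaCharacter (r : ℕ) : GammaK ζ →* KInftyHat ζ where
  toFun := thetaCocycle r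
  map_one' := thetaCocycle_one r
  map_mul' := thetaCocycle_mul r

theorem integerMap_zetaInt_eq_of_zetaTower (g : GammaK ζ) (n : ℕ)
    (h : integerMap g (zetaInt ζ n) = zetaInt ζ n) : g (zetaTower ζ n) = zetaTower ζ n := by
  have h1 : completionMap g (zetaTower ζ n : KInftyHat ζ) = (zetaTower ζ n : KInftyHat ζ) :=
    congrArg Subtype.val h
  rw [completionMap_coe] at h1
  exact (Completion.coeRingHom : CyclotomicTower ζ →+* KInftyHat ζ).injective h1

/-- If `g` raises `ζ_{p^N}` to the power `c`, the character is congruent to `c` modulo `p^N`. A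
trivial value thus forces `c ≡ 1`, and `g` fixes every root of unity of the tower. -/
theorem eq_one_of_thetaCharacter_eq_one (r : ℕ) (g : GammaK ζ) (h : thetaCharacter ζ r g = 1) :
    g = 1 := by
  refine gammaK_ext ζ g fun N => integerMap_zetaInt_eq_of_zetaTower g N ?_
  obtain ⟨c, hc⟩ := exists_integerMap_zetaInt g N
  have h1 := norm_thetaCocycle_sub_le r g N c hc
  rw [show thetaCocycle r g = 1 from h] at h1
  have h2 := pow_dvd_of_norm_intCast_le (p_ne_zero_KInftyHat ζ) (norm_p_lt_one' ζ) N (1 - c)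
    (by push_cast; exact h1)
  have h3 : c ≡ 1 [MOD p ^ N] := by
    rw [Nat.modEq_iff_dvd]
    exact_mod_cast h2
  rw [hc]
  conv_rhs => rw [← pow_one (zetaInt ζ N)]
  exact pow_eq_pow_of_modEq h3 (zetaInt_primitive ζ N).pow_eq_one

theorem thetaCharacter_injective (r : ℕ) : Function.Injective (thetaCharacter ζ r) := by
  intro g h hgh
  rw [← mul_inv_eq_one]
  refine eq_one_of_thetaCharacter_eq_one r _ ?_
  rw [map_mul, hgh, ← map_mul, mul_inv_cancel, map_one]

/-- The cyclotomic character has elements of arbitrarily large order on each stabilizer. -/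
theorem exists_thetaCharacter_pow_ne_one (r n D : ℕ) (hD : D ≠ 0) :
    ∃ g : GammaK ζ, integerMap g (zetaInt ζ n) = zetaInt ζ n ∧ thetaCharacter ζ r g ^ D ≠ 1 := by
  by_contra hcon
  push Not at hcon
  -- The power `φ(p^n)` of any `g` stabilizes `ζ_{p^n}`. Were the `D`-th power of the character
  -- trivial on the stabilizer, all its values would be roots of unity of one fixed order, and
  -- injectivity would make the group finite.
  have hfix : ∀ g : GammaK ζ,
      integerMap (g ^ (p ^ n).totient) (zetaInt ζ n) = zetaInt ζ n := by
    intro g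
    obtain ⟨c, hc⟩ := exists_integerMap_zetaInt g n
    have hpow : ∀ k : ℕ, integerMap (g ^ k) (zetaInt ζ n) = zetaInt ζ n ^ c ^ k := by
      intro k
      induction k with
      | zero => rw [pow_zero, integerMap_one, pow_zero, pow_one]; rfl
      | succ k ih =>
        rw [pow_succ, integerMap_mul, RingHom.comp_apply, hc, map_pow, ih, ← pow_mul, pow_succ]
    have hinj : Function.Injective (integerMap g) := fun x y hxy =>
      Subtype.ext ((completionMap g).injective (congrArg Subtype.val hxy))
    have hcop : Nat.Coprime c (p ^ n) := by
      have h1 := (zetaInt_primitive ζ n).map_of_injective hinj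
      rwa [hc, (zetaInt_primitive ζ n).pow_iff_coprime (pow_pos hp.out.pos n)] at h1
    rw [hpow]
    conv_rhs => rw [← pow_one (zetaInt ζ n)]
    exact pow_eq_pow_of_modEq (Nat.ModEq.pow_totient hcop) (zetaInt_primitive ζ n).pow_eq_one
  have hE : (p ^ n).totient * D ≠ 0 :=
    Nat.mul_ne_zero (Nat.totient_pos.2 (pow_pos hp.out.pos n)).ne' hD
  have hroot : ∀ g : GammaK ζ, thetaCharacter ζ r g ∈
      Polynomial.nthRootsFinset ((p ^ n).totient * D) (1 : KInftyHat ζ) := fun g => by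
    rw [Polynomial.mem_nthRootsFinset (Nat.pos_of_ne_zero hE), pow_mul, ← map_pow]
    exact hcon _ (hfix g)
  have := infinite_gammaK ζ
  exact Set.infinite_range_of_injective (thetaCharacter_injective (ζ := ζ) r)
    ((Finset.finite_toSet _).subset (Set.range_subset_iff.2 hroot))

/-- Tate: no nonzero power of the cyclotomic character occurs in the completion of `K_∞`. -/
theorem eq_zero_of_completionMap_eq (r k : ℕ) (hk : k ≠ 0) (y : KInftyHat ζ)
    (hy : ∀ g : GammaK ζ, completionMap g y = thetaCharacter ζ r g ^ k * y) : y = 0 := by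
  refine eq_zero_of_eigenvector_of_isIntegral (F := coefficientField p K) (p_ne_zero_KInftyHat ζ)
    (norm_p_lt_one' ζ) (fun c hc => ?_) (zetaHat_primitive ζ) (zetaHat_succ_pow ζ) y
    (isIntegral_KInftyHat ζ y) fun n D hD => ?_
  · have h1 : ‖(p : KInftyHat ζ)‖ = ‖(p : K)‖ := by
      rw [← map_natCast (algebraMap K (KInftyHat ζ)), norm_algebraMap']
    rw [h1]
    obtain ⟨a, ha⟩ := norm_coefficientField (p := p) (c : K) c.2 fun h => hc (Subtype.ext h)
    exact ⟨a, (norm_algebraMap' (KInftyHat ζ) (c : K)).trans ha⟩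
  -- The eigenvalue is `l^k`, so its `D`-th power is `l^(k D)`.
  · obtain ⟨g, hg, hgD⟩ := exists_thetaCharacter_pow_ne_one (ζ := ζ) r n (k * D)
      (Nat.mul_ne_zero hk hD)
    obtain ⟨l, hl⟩ := exists_thetaCocycle_eq r g
    have hl' : algebraMap (coefficientField p K) (KInftyHat ζ) l = thetaCharacter ζ r g := hl
    refine ⟨completionMap g, l ^ k, norm_completionMap g, fun c => completionMap_algebraMap ζ g c,
      congrArg Subtype.val hg, pow_ne_zero k ?_, ?_, ?_⟩
    · rintro rfl
      have h1 : thetaCharacter ζ r g * thetaCharacter ζ r g⁻¹ = 1 := by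
        rw [← map_mul, mul_inv_cancel, map_one]
      rw [← hl', map_zero, zero_mul] at h1
      exact zero_ne_one h1
    · intro h1
      rw [← pow_mul] at h1
      exact hgD (by rw [← hl', ← map_pow, h1, map_one])
    · rw [map_pow, hl', hy]

/-- Every `θ ∘ φ^r` turns the congruence modulo `μ` into an eigenvector equation in the completion
of `K_∞`. Tate's theorem kills each image, and the common kernel is `(μ)`. -/
theorem muElt_dvd_of_twisted (k : ℕ) (hk : k ≠ 0) (x : AKPlus ζ)
    (hx : ∀ g : GammaK ζ, muElt ζ ∣ g • x - muCocycle g ^ k * x) : muElt ζ ∣ x := by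
  refine teichmuller_sub_one_dvd_of_thetaFrob_eq_zero (zetaInt ζ) (zetaInt_succ_pow ζ)
    (zetaInt_primitive ζ) (p_ne_zero_KInftyHat ζ) (norm_p_lt_one' ζ) x fun r => Subtype.ext ?_
  refine eq_zero_of_completionMap_eq r k hk _ fun g => ?_
  obtain ⟨w, hw⟩ := hx g
  have h0 : thetaFrob (OKInftyHat ζ) p r (muElt ζ) = 0 :=
    thetaFrob_teichmuller_sub_one (zetaInt ζ) (zetaInt_succ_pow ζ)
      (by simpa using (zetaInt_primitive ζ 0).pow_eq_one) r
  have h1 := congrArg (thetaFrob (OKInftyHat ζ) p r) hw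
  rw [map_sub, map_mul, map_mul, h0, zero_mul, sub_eq_zero, thetaFrob_smul, map_pow] at h1
  exact congrArg Subtype.val h1

end Vanishing

theorem SemilinearAction.localize_act_mkLinearMap {G B M : Type*} [Group G] [CommRing B]
    [MulSemiringAction G B] [AddCommGroup M] [Module B M] (ρ : SemilinearAction G B M)
    (S : Submonoid B) (hS : ∀ (g : G), ∀ s ∈ S, IsUnit (algebraMap B (Localization S) (g • s)))
    (g : G) (m : M) : (ρ.localize S hS).act g (LocalizedModule.mkLinearMap S M m) =
      LocalizedModule.mkLinearMap S M (ρ.act g m) := by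
  have h : ∀ x, (ρ.localize S hS).act g x = ρ.localizeFun S hS g x := fun _ => rfl
  rw [h]
  exact ρ.localizeFun_eq S hS g _ _ m 1 (by rw [Submonoid.coe_one, one_smul])
    (by rw [Submonoid.coe_one, smul_one, one_smul])

/-! ### Lattices in `N[1/μ]` and the main theorem. -/

section Lattices
variable {p : ℕ} [hp : Fact p.Prime] {K : Type*} [NontriviallyNormedField K] [IsUltrametricDist K]
  [CompleteSpace K] [hK : IsPAdicField p K] {ζ : CompatibleRootsOfUnity p K}

theorem eq_zero_of_muElt_smul_eq_zero {N : Type*} [AddCommGroup N] [Module (AKPlus ζ) N]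
    (d : InvertMu ζ N) (hd : muElt ζ • d = 0) : d = 0 :=
  IsLocalizedModule.smul_injective (LocalizedModule.mkLinearMap (Submonoid.powers (muElt ζ)) N)
    (⟨muElt ζ, Submonoid.mem_powers _⟩ : Submonoid.powers (muElt ζ))
    (hd.trans (smul_zero (muElt ζ)).symm)

theorem exists_pow_smul_eq_mkLinearMap {N : Type*} [AddCommGroup N] [Module (AKPlus ζ) N]
    (d : InvertMu ζ N) : ∃ (k : ℕ) (n : N),
      muElt ζ ^ k • d = LocalizedModule.mkLinearMap (Submonoid.powers (muElt ζ)) N n := by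
  obtain ⟨⟨n, ⟨s, k, rfl⟩⟩, hn⟩ := IsLocalizedModule.surj (Submonoid.powers (muElt ζ))
    (LocalizedModule.mkLinearMap (Submonoid.powers (muElt ζ)) N) d
  exact ⟨k, n, hn⟩

theorem invertMu_act_mkLinearMap {N : Type*} [AddCommGroup N] [Module (AKPlus ζ) N]
    (ρ : SemilinearAction (GammaK ζ) (AKPlus ζ) N) (g : GammaK ζ) (n : N) :
    ρ.invertMu.act g (LocalizedModule.mkLinearMap (Submonoid.powers (muElt ζ)) N n) =
      LocalizedModule.mkLinearMap (Submonoid.powers (muElt ζ)) N (ρ.act g n) :=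
  ρ.localize_act_mkLinearMap _ (isUnit_smul_powers_muElt ζ) g n

/-- The descent is applied to the inclusions of both lattices in `N[1/μ]`; surjectivity of `N''[1/μ]
→ N[1/μ]` supplies the denominators. -/
theorem IsTrivialLattice.le {N : Type*} [AddCommGroup N] [Module (AKPlus ζ) N]
    {ρ : SemilinearAction (GammaK ζ) (AKPlus ζ) N} {N' N'' : Submodule (AKPlus ζ) (InvertMu ζ N)}
    (h' : IsTrivialLattice ρ N') (h'' : IsTrivialLattice ρ N'') : N' ≤ N'' := by
  intro x hx
  have := h'.finite
  have hloc : ∀ d : InvertMu ζ N, ∃ (k : ℕ) (m : N''), muElt ζ ^ k • d = N''.subtype m := by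
    intro d
    obtain ⟨d', rfl⟩ := h''.bijective.surjective d
    obtain ⟨k, m, hm⟩ := exists_pow_smul_eq_mkLinearMap d'
    refine ⟨k, m, ?_⟩
    rw [← map_smul, hm]
    exact LocalizedModule.lift_mk_one _ _ _ _
  obtain ⟨m, hm⟩ := exists_eq_of_isTrivialMod (muElt ζ) muCocycle smul_muElt
    (smul_mem_span_muElt ζ) muElt_dvd_of_twisted (ρ.invertMu.restrict N' h'.stable)
    (ρ.invertMu.restrict N'' h''.stable) ρ.invertMu h'.trivial h''.trivial
    eq_zero_of_muElt_smul_eq_zero N'.subtype (fun _ _ => rfl) N''.subtype (fun _ _ => rfl)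
    N''.injective_subtype hloc ⟨x, hx⟩
  have hxm : x = m := hm
  exact hxm ▸ m.2

theorem mkLinearMap_muElt_injective {N : Type*} [AddCommGroup N] [Module (AKPlus ζ) N]
    [Module.Free (AKPlus ζ) N] :
    Function.Injective (LocalizedModule.mkLinearMap (Submonoid.powers (muElt ζ)) N) := by
  intro x y hxy
  obtain ⟨⟨s, k, rfl⟩, hs⟩ := (IsLocalizedModule.eq_iff_exists (Submonoid.powers (muElt ζ))
    (LocalizedModule.mkLinearMap (Submonoid.powers (muElt ζ)) N)).1 hxy
  exact smul_right_injective N (pow_ne_zero k (muElt_ne_zero ζ)) hs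

end Lattices

theorem mainTheorem6 (p : ℕ) [Fact p.Prime] (K : Type*) [NontriviallyNormedField K]
    [IsUltrametricDist K] [CompleteSpace K] [IsPAdicField p K]
    (ζ : CompatibleRootsOfUnity p K) :
    (∀ (N : Type*) [AddCommGroup N] [Module (AKPlus ζ) N]
        [Module.Finite (AKPlus ζ) N] [Module.Free (AKPlus ζ) N]
        (ρ : SemilinearAction (GammaK ζ) (AKPlus ζ) N)
        (N' N'' : Submodule (AKPlus ζ) (InvertMu ζ N)),
        IsTrivialLattice ρ N' → IsTrivialLattice ρ N'' → N' = N'') ∧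
    (∀ (N₁ N₂ : Type*) [AddCommGroup N₁] [Module (AKPlus ζ) N₁]
        [Module.Finite (AKPlus ζ) N₁] [Module.Free (AKPlus ζ) N₁]
        [AddCommGroup N₂] [Module (AKPlus ζ) N₂]
        [Module.Finite (AKPlus ζ) N₂] [Module.Free (AKPlus ζ) N₂]
        (ρ₁ : SemilinearAction (GammaK ζ) (AKPlus ζ) N₁)
        (ρ₂ : SemilinearAction (GammaK ζ) (AKPlus ζ) N₂),
        ρ₁.IsTrivialModMu → ρ₂.IsTrivialModMu →
        ∀ f : InvertMu ζ N₁ →ₗ[Localization (Submonoid.powers (muElt ζ))] InvertMu ζ N₂,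
          (∀ (g : GammaK ζ) (x : InvertMu ζ N₁),
            f (ρ₁.invertMu.act g x) = ρ₂.invertMu.act g (f x)) →
          ∀ n₁ : N₁, ∃ n₂ : N₂,
            f (LocalizedModule.mkLinearMap _ N₁ n₁) = LocalizedModule.mkLinearMap _ N₂ n₂) := by
  refine ⟨fun N _ _ _ _ ρ N' N'' h' h'' => le_antisymm (h'.le h'') (h''.le h'), ?_⟩
  intro N₁ N₂ _ _ _ _ _ _ _ _ ρ₁ ρ₂ h₁ h₂ f hf n₁
  -- The ambient module is `N₂[1/μ]`, in which `N₂` embeds because it is free over a domain and `μ ≠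
  -- 0`.
  refine exists_eq_of_isTrivialMod (muElt ζ) muCocycle smul_muElt
    (smul_mem_span_muElt ζ) muElt_dvd_of_twisted ρ₁ ρ₂ ρ₂.invertMu h₁ h₂
    eq_zero_of_muElt_smul_eq_zero
    ((f.restrictScalars (AKPlus ζ)) ∘ₗ LocalizedModule.mkLinearMap _ N₁)
    (fun g m => ?_) (LocalizedModule.mkLinearMap _ N₂)
    (fun g m => (invertMu_act_mkLinearMap ρ₂ g m).symm) mkLinearMap_muElt_injective
    exists_pow_smul_eq_mkLinearMap n₁
  rw [LinearMap.comp_apply, LinearMap.comp_apply, ← invertMu_act_mkLinearMap]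
  exact hf g _
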